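/- A *graph* is a finite undirected graph without loops or multiple edges; $d_G$ is the shortest-path distance (with value $\infty$ between different components). A *map of graphs* is a map of vertex sets that preserves or contracts each edge. For $k,l\ge 0$ let $MC_{k,l}(G)$ be the free abelian group on the tuples $(x_0,\dots,x_k)$ of vertices with $x_0\ne x_1\ne\cdots\ne x_k$ and length $\ell(x_0,\dots,x_k)=\sum_{i} d_G(x_{i-1},x_i)=l$. The differential is $\partial=\sum_{i=1}^{k-1}(-1)^i\partial_i$, where $\partial_i$ deletes $x_i$ if this preserves the length and is $0$ otherwise. Let $MH_{k,l}(G)=H_k(MC_{*,l}(G))$ be the magnitude homology. A map of graphs $f$ induces $f_*$ by applying $f$ to every entry of a tuple if this preserves the length, and $0$ otherwise. Let $G\mathbin{\Box}H$ be the cartesian product of graphs. The *exterior product* $\Box\colon MH_{*,*}(G)\otimes MH_{*,*}(H)\to MH_{*,*}(G\mathbin{\Box}H)$ is induced by the chain map $$(x_0,\dots,x_{k_1})\mathbin{\Box}(y_0,\dots,y_{k_2})=\sum_\sigma \mathrm{sign}(\sigma)\,\bigl((x_{i_0},y_{j_0}),\dots,(x_{i_k},y_{j_k})\bigr),\qquad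 k=k_1+k_2,$$ where $\sigma=((i_0,j_0),\dots,(i_k,j_k))$ runs over the lattice paths from $(0,0)$ to $(k_1,k_2)$ whose steps increase exactly one coordinate by $1$, and $\mathrm{sign}(\sigma)=(-1)^n$ with $n$ the number of pairs $(i,j)$, $0\le i\le k_1$, $0\le j\le k_2$, such that $j<j_r$ whenever $i_r=i$. **Theorem (Künneth theorem for magnitude homology).** For graphs $G$ and $H$ and all $k,l\ge 0$ there is a short exact sequence $$0\to\bigoplus_{\substack{k_1+k_2=k\\ l_1+l_2=l}}MH_{k_1,l_1}(G)\otimes MH_{k_2,l_2}(H)\xrightarrow{\ \Box\ }MH_{k,l}(G\mathbin{\Box}H)\to\bigoplus_{\substack{k_1+k_2=k-1\\ l_1+l_2=l}}\mathrm{Tor}\bigl(MH_{k_1,l_1}(G),MH_{k_2,l_2}(H)\bigr)\to 0$$ (tensor products and $\mathrm{Tor}=\mathrm{Tor}_1$ over $\mathbb Z$) whose two maps are natural with respect to maps of graphs $G\to G'$ and $H\to H'$. For each $G$, $H$, $k$, $l$ the sequence splits (the splitting is not claimed to be natural). Moreover, $\Box$ becomes an isomorphism after tensoring with $\mathbb Q$,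 and $\Box$ is an isomorphism if all the groups $MH_{i,j}(G)$ are torsion-free or all the groups $MH_{i,j}(H)$ are torsion-free. -/

import Mathlib

universe u

namespace MagnitudeHomology

open CategoryTheory
open scoped TensorProduct DirectSum

/-! ### Magnitude chains -/

/-- The length `ℓ(x₀, …, x_k) = d(x₀, x₁) + ⋯ + d(x_{k-1}, x_k)` of a tuple of vertices. -/
noncomputable def tupleLength {V : Type u} (G : SimpleGraph V) {k : ℕ} (x : Fin (k + 1) → V) :
    ℕ∞ :=
  ∑ i : Fin k, G.edist (x i.castSucc) (x i.succ)

/-- The tuples `(x₀, …, x_k)` with `x₀ ≠ x₁ ≠ ⋯ ≠ x_k` and length `l`. -/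
def IsGenerator {V : Type u} (G : SimpleGraph V) (l : ℕ) {k : ℕ} (x : Fin (k + 1) → V) : Prop :=
  (∀ i : Fin k, x i.castSucc ≠ x i.succ) ∧ tupleLength G x = l

/-- The magnitude chain group `MC_{k,l}(G)`. -/
abbrev Chains {V : Type u} (G : SimpleGraph V) (k l : ℕ) : Type u :=
  {x : Fin (k + 1) → V // IsGenerator G l x} →₀ ℤ

open Classical in
/-- The generator given by a tuple, or `0` if the tuple is not a generator of `MC_{k,l}(G)`.
Where this is used below, a tuple of length `l` has distinct neighbouring entries automatically. -/
noncomputable def basisOrZero {V : Type u} (G : SimpleGraph V) (k l : ℕ) (x : Fin (k + 1) → V) :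
    Chains G k l :=
  if h : IsGenerator G l x then Finsupp.single ⟨x, h⟩ 1 else 0

/-- The differential `∂ = ∑ᵢ (-1)ⁱ ∂ᵢ`, the sum over `1 ≤ i ≤ k`, of `MC_{k+1,l}(G)`. Here `∂ᵢ`
deletes the entry with index `i`, and is `0` if this changes the length. -/
noncomputable def boundary {V : Type u} (G : SimpleGraph V) (k l : ℕ) :
    Chains G (k + 1) l →ₗ[ℤ] Chains G k l :=
  Finsupp.linearCombination ℤ fun x => ∑ i : Fin k,
    (-1 : ℤ) ^ (i.val + 1) • basisOrZero G k l fun j => x.1 (i.succ.castSucc.succAbove j)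

/-- A map of graphs: a map of vertices that preserves or contracts each edge. -/
structure GraphMap {V W : Type u} (G : SimpleGraph V) (H : SimpleGraph W) where
  toFun : V → W
  map_adj : ∀ x y, G.Adj x y → H.Adj (toFun x) (toFun y) ∨ toFun x = toFun y

/-- The induced map `f_#`: it applies `f` to every entry, and is `0` if this changes the length. -/
noncomputable def inducedChains {V W : Type u} {G : SimpleGraph V} {H : SimpleGraph W}
    (f : GraphMap G H) (k l : ℕ) : Chains G k l →ₗ[ℤ] Chains H k l :=
  Finsupp.linearCombination ℤ fun x => basisOrZero H k l fun j => f.toFun (x.1 j)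

/-- `t` is obtained from `s` by increasing exactly one of the two components by `1`. -/
def IsStep {p q : ℕ} (s t : Fin (p + 1) × Fin (q + 1)) : Prop :=
  (t.1.val = s.1.val + 1 ∧ t.2 = s.2) ∨ (t.1 = s.1 ∧ t.2.val = s.2.val + 1)

open Classical in
/-- The sequences `σ = ((i₀, j₀), …, (i_n, j_n))` with `0 ≤ i_r ≤ p`, `0 ≤ j_r ≤ q`, `i₀ = j₀ = 0`,
each term being obtained from its predecessor by increasing one component by `1`. -/
noncomputable def latticePaths (p q n : ℕ) : Finset (Fin (n + 1) → Fin (p + 1) × Fin (q + 1)) :=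
  Finset.univ.filter fun σ => σ 0 = (0, 0) ∧ ∀ r : Fin n, IsStep (σ r.castSucc) (σ r.succ)

open Classical in
/-- The number of pairs `(i, j)` such that `j < j_r` whenever `i = i_r`; the sign of `σ` is
`(-1)` to this power. -/
noncomputable def pathArea {p q n : ℕ} (σ : Fin (n + 1) → Fin (p + 1) × Fin (q + 1)) : ℕ :=
  (Finset.univ.filter fun c : Fin (p + 1) × Fin (q + 1) =>
    ∀ r, c.1 = (σ r).1 → c.2 < (σ r).2).card

/-- The exterior product `MC_{p,a}(G) ⊗ MC_{q,b}(H) ⟶ MC_{n,l}(G □ H)` of chains, as a bilinear map.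
It is used for `n = p + q` and `l = a + b`, when every tuple in the sum is a generator. -/
noncomputable def exteriorChains {V W : Type u} (G : SimpleGraph V) (H : SimpleGraph W)
    (p a q b n l : ℕ) : Chains G p a →ₗ[ℤ] Chains H q b →ₗ[ℤ] Chains (G □ H) n l :=
  Finsupp.lift _ ℤ _ fun x => Finsupp.linearCombination ℤ fun y => ∑ σ ∈ latticePaths p q n,
    (-1 : ℤ) ^ pathArea σ • basisOrZero (G □ H) n l fun r => (x.1 (σ r).1, y.1 (σ r).2)

/-! ### Formal sums of tuples, written as lists

The differential, the induced maps and the exterior product are compared with maps on formal sums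
of lists that do not refer to lengths, followed by the projection to the lists that are generators.
This shows that they are compatible with the differentials. -/

abbrev FormalSum (V : Type u) : Type u := List V →₀ ℤ

noncomputable def consMap {V : Type u} (a : V) : FormalSum V →ₗ[ℤ] FormalSum V :=
  Finsupp.lmapDomain ℤ ℤ (List.cons a)

noncomputable def rList {V : Type u} : List V → FormalSum V
  | [] => 0
  | [_] => 0
  | b :: c :: t => -Finsupp.single (c :: t) 1 - consMap b (rList (c :: t))

noncomputable def dList {V : Type u} : List V → FormalSum V
  | [] => 0
  | a :: t => consMap a (rList t)

noncomputable def dMap {V : Type u} : FormalSum V →ₗ[ℤ] FormalSum V :=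
  Finsupp.linearCombination ℤ dList

noncomputable def rMap {V : Type u} : FormalSum V →ₗ[ℤ] FormalSum V :=
  Finsupp.linearCombination ℤ rList

@[simp] lemma consMap_single {V : Type u} (a : V) (s : List V) (n : ℤ) :
    consMap a (Finsupp.single s n) = Finsupp.single (a :: s) n := by
  simp [consMap]

@[simp] lemma dMap_single {V : Type u} (s : List V) (n : ℤ) :
    dMap (Finsupp.single s n) = n • dList s := by
  simp [dMap]

@[simp] lemma rMap_single {V : Type u} (s : List V) (n : ℤ) :
    rMap (Finsupp.single s n) = n • rList s := by
  simp [rMap]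

lemma dMap_consMap {V : Type u} (a : V) (z : FormalSum V) :
    dMap (consMap a z) = consMap a (rMap z) := by
  induction z using Finsupp.induction_linear with
  | zero => simp
  | add f g hf hg => simp [hf, hg]
  | single s n => simp [dList]

lemma eqOn_supported {α M : Type*} [AddCommGroup M] {A : Set α} (f g : (α →₀ ℤ) →ₗ[ℤ] M)
    (h : ∀ s ∈ A, f (Finsupp.single s 1) = g (Finsupp.single s 1)) {z : α →₀ ℤ}
    (hz : z ∈ Finsupp.supported ℤ ℤ A) : f z = g z := by
  rw [Finsupp.supported_eq_span_single] at hz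
  refine LinearMap.eqOn_span (f := f) (g := g) ?_ hz
  rintro _ ⟨s, hs, rfl⟩
  exact h s hs

lemma map_mem_supported {α β : Type*} {A : Set α} {B : Set β} (f : (α →₀ ℤ) →ₗ[ℤ] (β →₀ ℤ))
    (h : ∀ s ∈ A, f (Finsupp.single s 1) ∈ Finsupp.supported ℤ ℤ B) {z : α →₀ ℤ}
    (hz : z ∈ Finsupp.supported ℤ ℤ A) : f z ∈ Finsupp.supported ℤ ℤ B := by
  rw [Finsupp.supported_eq_span_single] at hz
  have : Submodule.span ℤ ((fun i => Finsupp.single i (1 : ℤ)) '' A) ≤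
      (Finsupp.supported ℤ ℤ B).comap f := by
    rw [Submodule.span_le]
    rintro _ ⟨s, hs, rfl⟩
    exact h s hs
  exact this hz

lemma single_mem {α : Type*} {A : Set α} {s : α} (hs : s ∈ A) (n : ℤ) :
    Finsupp.single s n ∈ Finsupp.supported ℤ ℤ A :=
  Finsupp.single_mem_supported ℤ n hs

lemma rMap_consMap {V : Type u} (b : V) {z : FormalSum V}
    (hz : z ∈ Finsupp.supported ℤ ℤ {s : List V | s ≠ []}) :
    rMap (consMap b z) = -z - consMap b (rMap z) := by
  refine eqOn_supported (rMap ∘ₗ consMap b) (-LinearMap.id - consMap b ∘ₗ rMap) ?_ hz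
  intro s hs
  cases s with
  | nil => simp at hs
  | cons c t => simp [rList]

lemma rList_mem {V : Type u} (x : List V) :
    rList x ∈ Finsupp.supported ℤ ℤ {s : List V | s.length + 1 = x.length ∧ s ≠ []} := by
  induction x with
  | nil => simp [rList]
  | cons b t ih =>
    cases t with
    | nil => simp [rList]
    | cons c t =>
      rw [rList]
      refine Submodule.sub_mem _ (Submodule.neg_mem _ (single_mem (by simp) _)) ?_
      refine map_mem_supported (consMap b) ?_ ih
      intro s hs
      rw [consMap_single]
      exact single_mem (by simp at hs ⊢; omega) _

lemma rMap_rList {V : Type u} (x : List V) : rMap (rList x) = 0 := by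
  induction x with
  | nil => simp [rList]
  | cons b t ih =>
    cases t with
    | nil => simp [rList]
    | cons c t =>
      rw [rList, map_sub, map_neg, rMap_consMap b
        (Finsupp.supported_mono (fun s hs => hs.2) (rList_mem (c :: t))), ih]
      simp

lemma dMap_dMap {V : Type u} (z : FormalSum V) : dMap (dMap z) = 0 := by
  induction z using Finsupp.induction_linear with
  | zero => simp
  | add f g hf hg => simp [hf, hg]
  | single s n =>
    cases s with
    | nil => simp [dList]
    | cons a t => simp [dList, dMap_consMap, rMap_rList]

/-! ### Shuffles of lists -/

noncomputable def shuffle {V W : Type u} : List V → List W → FormalSum (V × W)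
  | [], _ => 0
  | _ :: _, [] => 0
  | a :: xs, b :: ys =>
    consMap (a, b) ((if xs = [] ∧ ys = [] then Finsupp.single [] 1 else 0) +
      shuffle xs (b :: ys) + (-1 : ℤ) ^ xs.length • shuffle (a :: xs) ys)
  termination_by x y => x.length + y.length

lemma shuffle_nil_left {V W : Type u} (y : List W) : shuffle ([] : List V) y = 0 := by
  rw [shuffle]

lemma shuffle_nil_right {V W : Type u} (x : List V) : shuffle x ([] : List W) = 0 := by
  cases x <;> rw [shuffle]

lemma shuffle_cons_cons {V W : Type u} (a : V) (xs : List V) (b : W) (ys : List W) :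
    shuffle (a :: xs) (b :: ys) =
    consMap (a, b) ((if xs = [] ∧ ys = [] then Finsupp.single [] 1 else 0) +
      shuffle xs (b :: ys) + (-1 : ℤ) ^ xs.length • shuffle (a :: xs) ys) := by
  rw [shuffle]

noncomputable def shuffleMap {V W : Type u} :
    FormalSum V →ₗ[ℤ] FormalSum W →ₗ[ℤ] FormalSum (V × W) :=
  Finsupp.lift _ ℤ _ fun x => Finsupp.linearCombination ℤ fun y => shuffle x y

@[simp] lemma shuffleMap_single {V W : Type u} (x : List V) (y : List W) (m n : ℤ) :
    shuffleMap (Finsupp.single x m) (Finsupp.single y n) = (m * n) • shuffle x y := by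
  simp [shuffleMap, mul_smul]

lemma shuffleMap_consMap_left {V W : Type u} (a : V) (b : W) (ys : List W) (m : ℕ)
    {u : FormalSum V} (hu : u ∈ Finsupp.supported ℤ ℤ {s : List V | s.length = m ∧ s ≠ []}) :
    shuffleMap (consMap a u) (Finsupp.single (b :: ys) 1) =
      consMap (a, b) (shuffleMap u (Finsupp.single (b :: ys) 1) +
        (-1 : ℤ) ^ m • shuffleMap (consMap a u) (Finsupp.single ys 1)) := by
  refine eqOn_supported (shuffleMap.flip (Finsupp.single (b :: ys) 1) ∘ₗ consMap a)
    (consMap (a, b) ∘ₗ (shuffleMap.flip (Finsupp.single (b :: ys) 1) +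
        (-1 : ℤ) ^ m • shuffleMap.flip (Finsupp.single ys 1) ∘ₗ consMap a)) ?_ hu
  rintro s ⟨rfl, hs⟩
  simp [shuffle_cons_cons, hs]

lemma shuffleMap_consMap_right {V W : Type u} (a : V) (b : W) (xs : List V)
    {u : FormalSum W} (hu : u ∈ Finsupp.supported ℤ ℤ {s : List W | s ≠ []}) :
    shuffleMap (Finsupp.single (a :: xs) 1) (consMap b u) =
      consMap (a, b) (shuffleMap (Finsupp.single xs 1) (consMap b u) +
        (-1 : ℤ) ^ xs.length • shuffleMap (Finsupp.single (a :: xs) 1) u) := by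
  refine eqOn_supported (shuffleMap (Finsupp.single (a :: xs) 1) ∘ₗ consMap b)
    (consMap (a, b) ∘ₗ (shuffleMap (Finsupp.single xs 1) ∘ₗ consMap b +
        (-1 : ℤ) ^ xs.length • shuffleMap (Finsupp.single (a :: xs) 1))) ?_ hu
  rintro s hs
  have hs : s ≠ [] := hs
  simp [shuffle_cons_cons, hs]

lemma shuffle_ne_nil {V W : Type u} (x : List V) (y : List W) :
    shuffle x y ∈ Finsupp.supported ℤ ℤ {s : List (V × W) | s ≠ []} := by
  cases x with
  | nil => simp [shuffle_nil_left]
  | cons a xs =>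
    cases y with
    | nil => simp [shuffle_nil_right]
    | cons b ys =>
      rw [shuffle_cons_cons]
      refine map_mem_supported (A := Set.univ) _ (fun s _ => ?_) (by simp)
      rw [consMap_single]
      exact single_mem (by simp) _

lemma rMap_shuffle {V W : Type u} (x : List V) (y : List W) :
    rMap (shuffle x y) = -shuffle x.tail y
        - (-1 : ℤ) ^ x.tail.length • shuffle x y.tail - dMap (shuffle x y) := by
  cases x with
  | nil => simp [shuffle_nil_left]
  | cons a xs =>
    cases y with
    | nil => simp [shuffle_nil_right]
    | cons b ys =>
      have h : shuffle xs (b :: ys) + (-1 : ℤ) ^ xs.length • shuffle (a :: xs) ys ∈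
          Finsupp.supported ℤ ℤ {s : List (V × W) | s ≠ []} :=
        Submodule.add_mem _ (shuffle_ne_nil _ _) (Submodule.smul_mem _ _ (shuffle_ne_nil _ _))
      rw [shuffle_cons_cons, dMap_consMap, add_assoc, map_add (consMap (a, b)), map_add rMap,
        rMap_consMap _ h, map_add rMap _ (_ + _)]
      split_ifs <;> simp [rList] <;> abel

lemma shuffleMap_rList_left {V W : Type u} (x : List V) (y : List W) :
    shuffleMap (rList x) (Finsupp.single y 1) =
      -shuffle x.tail y - shuffleMap (dList x) (Finsupp.single y 1) := by
  rcases x with _ | ⟨b, _ | ⟨c, t⟩⟩ <;> simp [rList, dList, shuffle_nil_left]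

lemma shuffleMap_rList_right {V W : Type u} (x : List V) (y : List W) :
    shuffleMap (Finsupp.single x 1) (rList y) =
      -shuffle x y.tail - shuffleMap (Finsupp.single x 1) (dList y) := by
  rcases y with _ | ⟨b, _ | ⟨c, t⟩⟩ <;> simp [rList, dList, shuffle_nil_right]

lemma dMap_shuffle {V W : Type u} (x : List V) (y : List W) :
    dMap (shuffle x y) = shuffleMap (dList x) (Finsupp.single y 1) +
      (-1 : ℤ) ^ x.tail.length • shuffleMap (Finsupp.single x 1) (dList y) := by
  induction hn : x.length + y.length using Nat.strong_induction_on generalizing x y with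
  | _ n ih =>
  cases x with
  | nil =>
    have : shuffleMap (Finsupp.single ([] : List V) 1) (dList y) = 0 := by
      have : shuffleMap (Finsupp.single ([] : List V) 1) = (0 : FormalSum W →ₗ[ℤ] _) := by
        ext y; simp [shuffle_nil_left]
      rw [this]; rfl
    rw [shuffle_nil_left, this]
    simp [dList]
  | cons a xs =>
    cases y with
    | nil =>
      have : shuffleMap.flip (Finsupp.single ([] : List W) 1) = (0 : FormalSum V →ₗ[ℤ] _) := by
        ext y; simp [shuffle_nil_right]
      have := LinearMap.congr_fun this (dList (a :: xs))
      simp at this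
      simp [shuffle_nil_right, dList] at this ⊢
      simp [this]
    | cons b ys =>
      have h1 := ih (xs.length + (b :: ys).length) (by subst hn; simp) xs (b :: ys) rfl
      have h2 := ih ((a :: xs).length + ys.length) (by subst hn; simp) (a :: xs) ys rfl
      have hr : rMap (if xs = [] ∧ ys = [] then Finsupp.single [] 1 else 0 : FormalSum (V × W)) = 0 := by
        split_ifs <;> simp [rList]
      have k1 := shuffleMap_consMap_left a b ys (xs.length - 1) (u := rList xs)
        (Finsupp.supported_mono (t := {s : List V | s.length = xs.length - 1 ∧ s ≠ []})
          (fun s (hs : s.length + 1 = xs.length ∧ s ≠ []) => ⟨by omega, hs.2⟩) (rList_mem xs))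
      have k2 := shuffleMap_consMap_right a b xs (u := rList ys)
        (Finsupp.supported_mono (fun s hs => hs.2) (rList_mem ys))
      rw [shuffleMap_rList_left] at k1
      rw [shuffleMap_rList_right] at k2
      change shuffleMap (dList (a :: xs)) _ = consMap (a, b) (_ + _ • shuffleMap (dList (a :: xs)) _) at k1
      change shuffleMap _ (dList (b :: ys)) = consMap (a, b) (shuffleMap _ (dList (b :: ys)) + _) at k2
      rw [k1, k2, shuffle_cons_cons, dMap_consMap, map_add rMap, map_add rMap, hr, map_smul rMap, rMap_shuffle,
        rMap_shuffle, h1, h2]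
      rw [← map_smul (consMap (a, b)), ← map_add (consMap (a, b))]
      congr 1
      cases xs with
      | nil =>
        have h0 : ∀ z : FormalSum W, shuffleMap (Finsupp.single ([] : List V) 1) z = 0 := by
          have : shuffleMap (Finsupp.single ([] : List V) 1) = (0 : FormalSum W →ₗ[ℤ] _) := by
            ext y; simp [shuffle_nil_left]
          intro z; rw [this]; rfl
        simp [shuffle_nil_left, dList, rList, h0]
      | cons c t =>
        simp only [List.tail_cons, List.length_cons, Nat.add_sub_cancel, pow_succ, zero_add,
          smul_sub, smul_add, smul_neg, smul_smul]
        have e : ((-1 : ℤ) ^ t.length) * ((-1 : ℤ) ^ t.length) = 1 := by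
          rw [← pow_add, ← two_mul, pow_mul]; simp
        rcases neg_one_pow_eq_or ℤ t.length with e | e <;> rw [e] <;> simp <;> abel

/-! ### Lengths -/

noncomputable def listLength {V : Type u} (G : SimpleGraph V) : List V → ℕ∞
  | [] => 0
  | [_] => 0
  | a :: b :: t => G.edist a b + listLength G (b :: t)

def IsGen {V : Type u} (G : SimpleGraph V) (l : ℕ) (s : List V) : Prop :=
  s.IsChain (· ≠ ·) ∧ listLength G s = l

/-- lists that are generators of length `l`, or are strictly shorter -/
def IsSub {V : Type u} (G : SimpleGraph V) (l : ℕ) (s : List V) : Prop :=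
  IsGen G l s ∨ listLength G s < l

open Classical in
noncomputable def proj {V : Type u} (G : SimpleGraph V) (l : ℕ) : FormalSum V →ₗ[ℤ] FormalSum V :=
  Finsupp.linearCombination ℤ fun s => if IsGen G l s then Finsupp.single s 1 else 0

lemma proj_of_gen {V : Type u} (G : SimpleGraph V) (l : ℕ) {s : List V} (h : IsGen G l s) (n : ℤ) :
    proj G l (Finsupp.single s n) = Finsupp.single s n := by
  simp [proj, h]

lemma proj_of_not {V : Type u} (G : SimpleGraph V) (l : ℕ) {s : List V} (h : ¬ IsGen G l s)
    (n : ℤ) : proj G l (Finsupp.single s n) = 0 := by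
  simp [proj, h]

lemma proj_eq_self {V : Type u} (G : SimpleGraph V) (l : ℕ) {z : FormalSum V}
    (hz : z ∈ Finsupp.supported ℤ ℤ {s | IsGen G l s}) : proj G l z = z :=
  eqOn_supported (proj G l) LinearMap.id (fun s hs => by simp [proj_of_gen G l hs]) hz

lemma proj_eq_zero {V : Type u} (G : SimpleGraph V) (l : ℕ) {z : FormalSum V}
    (hz : z ∈ Finsupp.supported ℤ ℤ {s | ¬ IsGen G l s}) : proj G l z = 0 :=
  eqOn_supported (proj G l) 0 (fun s hs => by simp [proj_of_not G l hs]) hz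

lemma not_isGen_of_lt {V : Type u} (G : SimpleGraph V) {l : ℕ} {s : List V}
    (h : listLength G s < l) : ¬ IsGen G l s := fun h' => by
  rw [h'.2] at h; exact lt_irrefl _ h

lemma proj_sub_mem {V : Type u} (G : SimpleGraph V) (l : ℕ) {z : FormalSum V}
    (hz : z ∈ Finsupp.supported ℤ ℤ {s | IsSub G l s}) :
    z - proj G l z ∈ Finsupp.supported ℤ ℤ {s | listLength G s < l} := by
  refine map_mem_supported (LinearMap.id - proj G l) ?_ hz
  rintro s (hs | hs)
  · simp [proj_of_gen G l hs]
  · simp only [LinearMap.sub_apply, proj_of_not G l (not_isGen_of_lt G hs)]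
    simpa using single_mem (A := {s | listLength G s < l}) hs 1

/-- a linear map that does not increase lengths may be applied before or after projecting -/
lemma proj_comp_proj {V W : Type u} (G : SimpleGraph V) (H : SimpleGraph W) (l m : ℕ)
    (f : FormalSum V →ₗ[ℤ] FormalSum W)
    (hf : ∀ s, listLength G s < l →
      f (Finsupp.single s 1) ∈ Finsupp.supported ℤ ℤ {t | listLength H t < m})
    {z : FormalSum V} (hz : z ∈ Finsupp.supported ℤ ℤ {s | IsSub G l s}) :
    proj H m (f (proj G l z)) = proj H m (f z) := by
  have := map_mem_supported f (A := {s | listLength G s < l}) hf (proj_sub_mem G l hz)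
  have := proj_eq_zero H m (Finsupp.supported_mono (fun s hs => not_isGen_of_lt H hs) this)
  rw [map_sub, map_sub, sub_eq_zero] at this
  exact this.symm

lemma edist_pos {V : Type u} (G : SimpleGraph V) {a b : V} (h : a ≠ b) : 0 < G.edist a b :=
  pos_iff_ne_zero.2 (fun h0 => h (SimpleGraph.edist_eq_zero_iff.1 h0))

lemma rList_length {V : Type u} (G : SimpleGraph V) (a : V) (x : List V) :
    rList x ∈ Finsupp.supported ℤ ℤ {s | listLength G (a :: s) ≤ listLength G (a :: x)} := by
  induction x generalizing a with
  | nil => simp [rList]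
  | cons b t ih =>
    cases t with
    | nil => simp [rList]
    | cons c t =>
      rw [rList]
      refine Submodule.sub_mem _ (Submodule.neg_mem _ (single_mem ?_ _)) ?_
      · simp only [Set.mem_ofPred_eq, listLength, ← add_assoc]
        gcongr
        exact SimpleGraph.edist_triangle
      · refine map_mem_supported (consMap b) ?_ (ih b)
        intro s hs
        rw [consMap_single]
        refine single_mem ?_ _
        simp only [Set.mem_ofPred_eq] at hs ⊢
        rw [listLength, listLength]
        gcongr

/-- deleting an entry keeps the entries distinct, or strictly shortens the tuple -/
lemma rList_isGen {V : Type u} (G : SimpleGraph V) (a : V) (x : List V) (l : ℕ)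
    (h : IsGen G l (a :: x)) :
    rList x ∈ Finsupp.supported ℤ ℤ {s | IsSub G l (a :: s)} := by
  induction x generalizing a l with
  | nil => simp [rList]
  | cons b t ih =>
    cases t with
    | nil => simp [rList]
    | cons c t =>
      obtain ⟨h1, h2⟩ := h
      rw [listLength] at h2
      obtain ⟨d, hd⟩ := ENat.ne_top_iff_exists.1
        (ne_top_of_le_ne_top (ENat.natCast_ne_top l) (h2 ▸ le_self_add) : G.edist a b ≠ ⊤)
      obtain ⟨m, hm⟩ := ENat.ne_top_iff_exists.1
        (ne_top_of_le_ne_top (ENat.natCast_ne_top l) (h2 ▸ le_add_self) :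
          listLength G (b :: c :: t) ≠ ⊤)
      have hl : d + m = l := by rw [← hd, ← hm] at h2; exact_mod_cast h2
      rw [List.isChain_cons_cons] at h1
      rw [rList]
      refine Submodule.sub_mem _ (Submodule.neg_mem _ (single_mem ?_ _)) ?_
      · have h3 := h1.2
        rw [List.isChain_cons_cons] at h3
        have hm' := hm
        rw [listLength] at hm'
        obtain ⟨e, he⟩ := ENat.ne_top_iff_exists.1
          (ne_top_of_le_ne_top (ENat.natCast_ne_top m) (hm' ▸ le_self_add) : G.edist b c ≠ ⊤)
        obtain ⟨n, hn⟩ := ENat.ne_top_iff_exists.1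
          (ne_top_of_le_ne_top (ENat.natCast_ne_top m) (hm' ▸ le_add_self) :
            listLength G (c :: t) ≠ ⊤)
        have htri : G.edist a c ≤ G.edist a b + G.edist b c := SimpleGraph.edist_triangle
        rw [← hd, ← he] at htri
        obtain ⟨f, hf⟩ := ENat.ne_top_iff_exists.1
          (ne_top_of_le_ne_top (ENat.natCast_ne_top (d + e)) (by exact_mod_cast htri) :
            G.edist a c ≠ ⊤)
        have hd0 := edist_pos G h1.1
        rw [← hd] at hd0
        have hd0 : 0 < d := by exact_mod_cast hd0
        rw [← hf] at htri
        have htri : f ≤ d + e := by exact_mod_cast htri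
        rw [← he, ← hn] at hm'
        have hm' : m = e + n := by exact_mod_cast hm'
        have hlen : listLength G (a :: c :: t) = ((f + n : ℕ) : ℕ∞) := by
          rw [listLength, ← hf, ← hn]; push_cast; rfl
        by_cases hac : a = c
        · right
          rw [hlen]
          subst hac
          simp at hf
          subst hf
          exact_mod_cast (by omega)
        · rcases lt_or_eq_of_le htri with hlt | heq
          · right
            rw [hlen]
            exact_mod_cast (by omega)
          · left
            refine ⟨List.isChain_cons_cons.2 ⟨hac, h3.2⟩, ?_⟩
            rw [hlen]
            exact_mod_cast (by omega)
      · refine map_mem_supported (consMap b) ?_ (ih b m ⟨h1.2, hm.symm⟩)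
        intro s hs
        rw [consMap_single]
        refine single_mem ?_ _
        rcases hs with ⟨hs1, hs2⟩ | hs
        · left
          refine ⟨List.isChain_cons_cons.2 ⟨h1.1, hs1⟩, ?_⟩
          rw [listLength, hs2, ← hd]
          exact_mod_cast hl
        · right
          rw [listLength, ← hd, ← hl]
          push_cast
          exact (ENat.add_lt_add_iff_left (ENat.natCast_ne_top d)).2 hs

lemma dList_length {V : Type u} (G : SimpleGraph V) (x : List V) :
    dList x ∈ Finsupp.supported ℤ ℤ {s | listLength G s ≤ listLength G x} := by
  cases x with
  | nil => simp [dList]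
  | cons a t =>
    refine map_mem_supported (consMap a) ?_ (rList_length G a t)
    intro s hs
    rw [consMap_single]
    exact single_mem (A := _) (s := a :: s) hs _

lemma dList_isSub {V : Type u} (G : SimpleGraph V) (x : List V) (l : ℕ) (h : IsGen G l x) :
    dList x ∈ Finsupp.supported ℤ ℤ {s | IsSub G l s} := by
  cases x with
  | nil => simp [dList]
  | cons a t =>
    refine map_mem_supported (consMap a) ?_ (rList_isGen G a t l h)
    intro s hs
    rw [consMap_single]
    exact single_mem (A := _) (s := a :: s) hs _

lemma shuffle_length {V W : Type u} (G : SimpleGraph V) (H : SimpleGraph W)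
    (a : V) (xs : List V) (b : W) (ys : List W) :
    shuffle (a :: xs) (b :: ys) ∈ Finsupp.supported ℤ ℤ {s | (∃ t, s = (a, b) :: t) ∧
      listLength (G □ H) s = listLength G (a :: xs) + listLength H (b :: ys) ∧
      ((a :: xs).IsChain (· ≠ ·) → (b :: ys).IsChain (· ≠ ·) → s.IsChain (· ≠ ·))} := by
  induction hn : xs.length + ys.length using Nat.strong_induction_on generalizing a xs b ys with
  | _ n ih =>
  rw [shuffle_cons_cons, map_add, map_add]
  refine Submodule.add_mem _ (Submodule.add_mem _ ?_ ?_) ?_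
  · split_ifs with h
    · obtain ⟨rfl, rfl⟩ := h
      rw [consMap_single]
      exact single_mem (by simp [listLength]) _
    · simp
  · cases xs with
    | nil => simp [shuffle_nil_left]
    | cons c t =>
      refine map_mem_supported (consMap (a, b)) ?_ (ih _ (by subst hn; simp) c t b ys rfl)
      rintro s ⟨⟨t', rfl⟩, h2, h3⟩
      rw [consMap_single]
      refine single_mem (Set.mem_ofPred_eq ▸ ⟨⟨_, rfl⟩, ?_, fun hx hy => ?_⟩) _
      · rw [listLength, h2, listLength]
        simp [add_assoc]
      · rw [List.isChain_cons_cons] at hx ⊢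
        exact ⟨by simp [hx.1], h3 hx.2 hy⟩
  · rw [map_smul]
    refine Submodule.smul_mem _ _ ?_
    cases ys with
    | nil => simp [shuffle_nil_right]
    | cons c t =>
      refine map_mem_supported (consMap (a, b)) ?_ (ih _ (by subst hn; simp) a xs c t rfl)
      rintro s ⟨⟨t', rfl⟩, h2, h3⟩
      rw [consMap_single]
      refine single_mem (Set.mem_ofPred_eq ▸ ⟨⟨_, rfl⟩, ?_, fun hx hy => ?_⟩) _
      · rw [listLength, h2]
        simp [listLength, add_left_comm]
      · rw [List.isChain_cons_cons] at hy ⊢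
        exact ⟨by simp [hy.1], h3 hx hy.2⟩


/-! ### Comparison of chains with formal sums of lists -/

lemma listLength_ofFn {V : Type u} (G : SimpleGraph V) {k : ℕ} (x : Fin (k + 1) → V) :
    listLength G (List.ofFn x) = tupleLength G x := by
  induction k with
  | zero => simp [tupleLength, listLength]
  | succ k ih =>
    have h := ih (fun i => x i.succ)
    rw [tupleLength] at h ⊢
    rw [Fin.sum_univ_succ, List.ofFn_succ, List.ofFn_succ, listLength]
    rw [List.ofFn_succ] at h
    rw [h]
    rfl

lemma isChain_ofFn {V : Type u} {k : ℕ} (x : Fin (k + 1) → V) :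
    (List.ofFn x).IsChain (· ≠ ·) ↔ ∀ i : Fin k, x i.castSucc ≠ x i.succ := by
  rw [List.isChain_ofFn]
  constructor
  · intro h i
    exact h i.1 (by omega)
  · intro h i hi
    exact h ⟨i, by omega⟩

lemma isGen_ofFn {V : Type u} (G : SimpleGraph V) (l : ℕ) {k : ℕ} (x : Fin (k + 1) → V) :
    IsGen G l (List.ofFn x) ↔ IsGenerator G l x := by
  rw [IsGen, IsGenerator, listLength_ofFn, isChain_ofFn]

noncomputable def toFormal {V : Type u} (G : SimpleGraph V) (k l : ℕ) :
    Chains G k l →ₗ[ℤ] FormalSum V :=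
  Finsupp.lmapDomain ℤ ℤ fun x => List.ofFn x.1

@[simp] lemma toFormal_single {V : Type u} (G : SimpleGraph V) (k l : ℕ)
    (x : {x : Fin (k + 1) → V // IsGenerator G l x}) (n : ℤ) :
    toFormal G k l (Finsupp.single x n) = Finsupp.single (List.ofFn x.1) n := by
  simp [toFormal]

lemma toFormal_injective {V : Type u} (G : SimpleGraph V) (k l : ℕ) :
    Function.Injective (toFormal G k l) :=
  Finsupp.mapDomain_injective fun _ _ h => Subtype.ext (List.ofFn_injective h)

lemma toFormal_mem {V : Type u} (G : SimpleGraph V) (k l : ℕ) (z : Chains G k l) :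
    toFormal G k l z ∈ Finsupp.supported ℤ ℤ
      {s | IsGen G l s ∧ s.length = k + 1} := by
  refine map_mem_supported (A := Set.univ) _ (fun x _ => ?_) (by simp)
  rw [toFormal_single]
  exact single_mem (A := {s | IsGen G l s ∧ s.length = k + 1})
    ⟨(isGen_ofFn G l x.1).2 x.2, by simp⟩ _

lemma toFormal_basisOrZero {V : Type u} (G : SimpleGraph V) (k l : ℕ) (x : Fin (k + 1) → V) :
    toFormal G k l (basisOrZero G k l x) = proj G l (Finsupp.single (List.ofFn x) 1) := by
  rw [basisOrZero]
  split_ifs with h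
  · rw [proj_of_gen G l ((isGen_ofFn G l x).2 h)]; simp
  · rw [proj_of_not G l (fun h' => h ((isGen_ofFn G l x).1 h'))]; simp

lemma rList_ofFn {V : Type u} {k : ℕ} (x : Fin (k + 1) → V) :
    rList (List.ofFn x) = ∑ i : Fin k, (-1 : ℤ) ^ (i.val + 1) •
      Finsupp.single (List.ofFn fun j => x (i.castSucc.succAbove j)) 1 := by
  induction k with
  | zero => simp [rList]
  | succ k ih =>
    have h := ih (fun i => x i.succ)
    rw [List.ofFn_succ, List.ofFn_succ, rList]
    rw [List.ofFn_succ] at h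
    rw [h, Fin.sum_univ_succ, map_sum, sub_eq_add_neg, ← Finset.sum_neg_distrib]
    congr 1
    · simp [List.ofFn_succ]
    · refine Finset.sum_congr rfl fun i _ => ?_
      rw [map_smul, consMap_single, ← neg_smul, List.ofFn_succ (f := fun j => x (i.succ.castSucc.succAbove j))]
      simp only [Fin.val_succ, pow_succ, mul_neg, mul_one, neg_neg]
      congr 4
      ext j
      rw [← Fin.succ_castSucc, Fin.succ_succAbove_succ]

lemma dList_ofFn {V : Type u} {k : ℕ} (x : Fin (k + 2) → V) :
    dList (List.ofFn x) = ∑ i : Fin k, (-1 : ℤ) ^ (i.val + 1) •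
      Finsupp.single (List.ofFn fun j => x (i.succ.castSucc.succAbove j)) 1 := by
  rw [List.ofFn_succ, dList, rList_ofFn, map_sum]
  refine Finset.sum_congr rfl fun i _ => ?_
  rw [map_smul, consMap_single, List.ofFn_succ (f := fun j => x (i.succ.castSucc.succAbove j))]
  congr 4
  ext j
  rw [← Fin.succ_castSucc, Fin.succ_succAbove_succ]

lemma toFormal_boundary {V : Type u} (G : SimpleGraph V) (k l : ℕ) (z : Chains G (k + 1) l) :
    toFormal G k l (boundary G k l z) = proj G l (dMap (toFormal G (k + 1) l z)) := by
  induction z using Finsupp.induction_linear with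
  | zero => simp
  | add f g hf hg => simp only [map_add, hf, hg]
  | single x n =>
    simp only [boundary, Finsupp.linearCombination_single, map_smul, map_sum,
      toFormal_basisOrZero, toFormal_single, dMap_single, dList_ofFn]

lemma dMap_toFormal_zero {V : Type u} (G : SimpleGraph V) (l : ℕ) (z : Chains G 0 l) :
    dMap (toFormal G 0 l z) = 0 := by
  induction z using Finsupp.induction_linear with
  | zero => simp
  | add f g hf hg => simp only [map_add, hf, hg, add_zero]
  | single x n => simp [dList, rList]

lemma dMap_isSub {V : Type u} (G : SimpleGraph V) (k l : ℕ) (z : Chains G k l) :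
    dMap (toFormal G k l z) ∈ Finsupp.supported ℤ ℤ {s | IsSub G l s} := by
  refine map_mem_supported dMap ?_ (toFormal_mem G k l z)
  intro s hs
  rw [dMap_single, one_smul]
  exact dList_isSub G s l hs.1

lemma boundary_boundary {V : Type u} (G : SimpleGraph V) (k l : ℕ) :
    boundary G k l ∘ₗ boundary G (k + 1) l = 0 := by
  ext1 z
  ext1
  apply toFormal_injective
  simp only [LinearMap.comp_apply]
  rw [toFormal_boundary, toFormal_boundary, proj_comp_proj G G l l dMap _ (dMap_isSub G _ l _),
    dMap_dMap]
  · simp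
  · intro s hs
    rw [dMap_single, one_smul]
    exact Finsupp.supported_mono (fun t ht => lt_of_le_of_lt ht hs) (dList_length G s)

/-! ### Induced maps -/

lemma GraphMap.edist_le {V W : Type u} {G : SimpleGraph V} {H : SimpleGraph W}
    (f : GraphMap G H) (x y : V) : H.edist (f.toFun x) (f.toFun y) ≤ G.edist x y := by
  have key : ∀ (x y : V) (w : G.Walk x y), H.edist (f.toFun x) (f.toFun y) ≤ w.length := by
    intro x y w
    induction w with
    | nil => simp
    | @cons u v w h p ih =>
      have h1 : H.edist (f.toFun u) (f.toFun v) ≤ 1 := by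
        rcases f.map_adj u v h with h | h
        · exact (SimpleGraph.edist_eq_one_iff_adj.2 h).le
        · rw [h]; simp
      calc H.edist (f.toFun u) (f.toFun w)
          ≤ H.edist (f.toFun u) (f.toFun v) + H.edist (f.toFun v) (f.toFun w) :=
            SimpleGraph.edist_triangle
        _ ≤ 1 + p.length := add_le_add h1 ih
        _ = _ := by simp [add_comm]
  exact le_iInf fun w => key x y w

noncomputable def mapFormal {V W : Type u} (f : V → W) : FormalSum V →ₗ[ℤ] FormalSum W :=
  Finsupp.lmapDomain ℤ ℤ (List.map f)

@[simp] lemma mapFormal_single {V W : Type u} (f : V → W) (s : List V) (n : ℤ) :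
    mapFormal f (Finsupp.single s n) = Finsupp.single (s.map f) n := by
  simp [mapFormal]

lemma mapFormal_consMap {V W : Type u} (f : V → W) (a : V) (z : FormalSum V) :
    mapFormal f (consMap a z) = consMap (f a) (mapFormal f z) := by
  induction z using Finsupp.induction_linear with
  | zero => simp
  | add f g hf hg => simp [hf, hg]
  | single s n => simp

lemma mapFormal_rList {V W : Type u} (f : V → W) (x : List V) :
    mapFormal f (rList x) = rList (x.map f) := by
  induction x with
  | nil => simp [rList]
  | cons b t ih =>
    cases t with
    | nil => simp [rList]
    | cons c t =>
      rw [rList, map_sub, map_neg, mapFormal_consMap, ih]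
      simp [rList]

lemma mapFormal_dMap {V W : Type u} (f : V → W) (z : FormalSum V) :
    mapFormal f (dMap z) = dMap (mapFormal f z) := by
  induction z using Finsupp.induction_linear with
  | zero => simp
  | add f g hf hg => simp only [map_add, hf, hg]
  | single s n =>
    cases s with
    | nil => simp [dList]
    | cons a t => simp [dList, mapFormal_consMap, mapFormal_rList]

lemma GraphMap.listLength_le {V W : Type u} {G : SimpleGraph V} {H : SimpleGraph W}
    (f : GraphMap G H) (x : List V) : listLength H (x.map f.toFun) ≤ listLength G x := by
  induction x with
  | nil => simp [listLength]
  | cons a t ih =>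
    cases t with
    | nil => simp [listLength]
    | cons b t =>
      simp only [List.map_cons, listLength] at ih ⊢
      exact add_le_add (f.edist_le a b) ih

lemma GraphMap.isSub {V W : Type u} {G : SimpleGraph V} {H : SimpleGraph W}
    (f : GraphMap G H) (l : ℕ) (x : List V) (h : IsGen G l x) : IsSub H l (x.map f.toFun) := by
  induction x generalizing l with
  | nil => exact Or.inl ⟨by simp, h.2⟩
  | cons a t ih =>
    cases t with
    | nil => exact Or.inl ⟨by simp, h.2⟩
    | cons b t =>
      obtain ⟨h1, h2⟩ := h
      rw [listLength] at h2
      obtain ⟨d, hd⟩ := ENat.ne_top_iff_exists.1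
        (ne_top_of_le_ne_top (ENat.natCast_ne_top l) (h2 ▸ le_self_add) : G.edist a b ≠ ⊤)
      obtain ⟨m, hm⟩ := ENat.ne_top_iff_exists.1
        (ne_top_of_le_ne_top (ENat.natCast_ne_top l) (h2 ▸ le_add_self) :
          listLength G (b :: t) ≠ ⊤)
      have hl : d + m = l := by rw [← hd, ← hm] at h2; exact_mod_cast h2
      rw [List.isChain_cons_cons] at h1
      have hle := f.edist_le a b
      rw [← hd] at hle
      obtain ⟨e, he⟩ := ENat.ne_top_iff_exists.1
        (ne_top_of_le_ne_top (ENat.natCast_ne_top d) hle)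
      rw [← he] at hle
      have hle : e ≤ d := by exact_mod_cast hle
      have hd0 := edist_pos G h1.1
      rw [← hd] at hd0
      have hd0 : 0 < d := by exact_mod_cast hd0
      have hlen := f.listLength_le (b :: t)
      rw [← hm] at hlen
      obtain ⟨n, hn⟩ := ENat.ne_top_iff_exists.1
        (ne_top_of_le_ne_top (ENat.natCast_ne_top m) hlen)
      rw [← hn] at hlen
      have hlen : n ≤ m := by exact_mod_cast hlen
      have htot : listLength H ((a :: b :: t).map f.toFun) = ((e + n : ℕ) : ℕ∞) := by
        simp only [List.map_cons, listLength] at hn ⊢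
        rw [← he, ← hn]; push_cast; rfl
      by_cases hc : e + n = l
      · left
        refine ⟨?_, by rw [htot, hc]⟩
        rcases ih m ⟨h1.2, hm.symm⟩ with h3 | h3
        · simp only [List.map_cons] at h3 ⊢
          refine List.isChain_cons_cons.2 ⟨fun h0 => ?_, h3.1⟩
          rw [h0] at he
          simp at he
          omega
        · rw [← hn] at h3
          have h3 : n < m := by exact_mod_cast h3
          omega
      · right
        rw [htot]
        exact_mod_cast (by omega)

lemma toFormal_inducedChains {V W : Type u} {G : SimpleGraph V} {H : SimpleGraph W}
    (f : GraphMap G H) (k l : ℕ) (z : Chains G k l) :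
    toFormal H k l (inducedChains f k l z) = proj H l (mapFormal f.toFun (toFormal G k l z)) := by
  induction z using Finsupp.induction_linear with
  | zero => simp
  | add f g hf hg => simp only [map_add, hf, hg]
  | single x n =>
    simp [inducedChains, toFormal_basisOrZero, List.map_ofFn, Function.comp_def, proj,
      -List.ofFn_succ]

lemma inducedChains_boundary {V W : Type u} {G : SimpleGraph V} {H : SimpleGraph W}
    (f : GraphMap G H) (k l : ℕ) (z : Chains G (k + 1) l) :
    inducedChains f k l (boundary G k l z) = boundary H k l (inducedChains f (k + 1) l z) := by
  apply toFormal_injective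
  rw [toFormal_boundary, toFormal_inducedChains, toFormal_inducedChains, toFormal_boundary,
    proj_comp_proj G H l l _ _ (dMap_isSub G _ l _), proj_comp_proj H H l l, mapFormal_dMap]
  · intro s hs
    rw [dMap_single, one_smul]
    exact Finsupp.supported_mono (fun t ht => lt_of_le_of_lt ht hs) (dList_length H s)
  · refine map_mem_supported _ ?_ (toFormal_mem G _ l z)
    intro s hs
    rw [mapFormal_single]
    exact single_mem (A := {s | IsSub H l s}) (f.isSub l s hs.1) _
  · intro s hs
    rw [mapFormal_single]
    exact single_mem (A := {s | listLength H s < l}) (lt_of_le_of_lt (f.listLength_le s) hs) _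

/-! ### The exterior product -/

lemma sum_paths_succ {α M : Type*} [Fintype α] [AddCommMonoid M]
    (R : α → α → Prop) (n : ℕ) (s : α) (F : (Fin (n + 2) → α) → M)
    [∀ σ : Fin (n + 2) → α, Decidable (σ 0 = s ∧ ∀ r : Fin (n + 1), R (σ r.castSucc) (σ r.succ))]
    [∀ (t : α) (τ : Fin (n + 1) → α),
      Decidable (τ 0 = t ∧ ∀ r : Fin n, R (τ r.castSucc) (τ r.succ))]
    [∀ t, Decidable (R s t)] :
    (∑ σ : Fin (n + 2) → α,
      if σ 0 = s ∧ ∀ r : Fin (n + 1), R (σ r.castSucc) (σ r.succ) then F σ else 0) =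
    ∑ t : α, if R s t then
      (∑ τ : Fin (n + 1) → α,
        if τ 0 = t ∧ ∀ r : Fin n, R (τ r.castSucc) (τ r.succ) then
          F (Fin.cons s τ : Fin (n + 2) → α) else 0)
      else 0 := by
  classical
  rw [← (Fin.consEquiv fun _ : Fin (n + 2) => α).sum_comp, Fintype.sum_prod_type]
  rw [Finset.sum_eq_single s]
  · have h1 : ∀ τ : Fin (n + 1) → α,
        ((Fin.consEquiv fun _ : Fin (n + 2) => α) (s, τ) 0 = s ∧ ∀ r : Fin (n + 1),
          R ((Fin.consEquiv fun _ : Fin (n + 2) => α) (s, τ) r.castSucc)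
            ((Fin.consEquiv fun _ : Fin (n + 2) => α) (s, τ) r.succ)) ↔
        (R s (τ 0) ∧ ∀ r : Fin n, R (τ r.castSucc) (τ r.succ)) := by
      intro τ
      simp [Fin.consEquiv, Fin.forall_fin_succ (n := n)]
    simp only [h1]
    have h2 : ∀ t : α, (if R s t then
      (∑ τ : Fin (n + 1) → α,
        if τ 0 = t ∧ ∀ r : Fin n, R (τ r.castSucc) (τ r.succ) then
          F (Fin.cons s τ : Fin (n + 2) → α) else 0)
      else 0) = ∑ τ : Fin (n + 1) → α, if t = τ 0 then
        (if R s (τ 0) ∧ ∀ r : Fin n, R (τ r.castSucc) (τ r.succ) then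
          F (Fin.cons s τ : Fin (n + 2) → α) else 0) else 0 := by
      intro t
      split_ifs with h
      · refine Finset.sum_congr rfl fun τ _ => ?_
        by_cases h3 : t = τ 0
        · subst h3; simp [h]
        · have : τ 0 ≠ t := fun h' => h3 h'.symm
          simp [h3, this]
      · symm
        refine Finset.sum_eq_zero fun τ _ => ?_
        split_ifs with h3 h4
        · subst h3; exact absurd h4.1 h
        · rfl
        · rfl
    simp only [h2]
    rw [Finset.sum_comm]
    simp [Fin.consEquiv]
  · intro t _ ht
    refine Finset.sum_eq_zero fun τ _ => ?_
    simp [Fin.consEquiv, ht]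
  · simp

lemma path_mono {p q n : ℕ} (σ : Fin (n + 1) → Fin (p + 1) × Fin (q + 1))
    (h : ∀ r : Fin n, IsStep (σ r.castSucc) (σ r.succ)) (r : Fin (n + 1)) :
    (σ 0).1 ≤ (σ r).1 ∧ (σ 0).2 ≤ (σ r).2 := by
  induction r using Fin.induction with
  | zero => simp
  | succ i ih =>
    rcases h i with h | h
    · exact ⟨ih.1.trans (by rw [Fin.le_def]; omega), h.2 ▸ ih.2⟩
    · exact ⟨h.1 ▸ ih.1, ih.2.trans (by rw [Fin.le_def]; omega)⟩

lemma pathArea_cons {p q n : ℕ} (s : Fin (p + 1) × Fin (q + 1))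
    (τ : Fin (n + 1) → Fin (p + 1) × Fin (q + 1)) (m : ℕ)
    (f : Fin m → Fin (p + 1) × Fin (q + 1)) (hf : Function.Injective f)
    (h : ∀ c : Fin (p + 1) × Fin (q + 1), ((∀ r, c.1 = (τ r).1 → c.2 < (τ r).2) ∧ c.1 = s.1 ∧
      s.2 ≤ c.2) ↔ ∃ i, f i = c) :
    pathArea τ = pathArea (Fin.cons s τ : Fin (n + 2) → Fin (p + 1) × Fin (q + 1)) + m := by
  classical
  have h1 := Finset.card_filter_add_card_filter_not (s := Finset.univ.filter
    fun c : Fin (p + 1) × Fin (q + 1) => ∀ r, c.1 = (τ r).1 → c.2 < (τ r).2)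
    (fun c => c.1 = s.1 → c.2 < s.2)
  rw [Finset.filter_filter, Finset.filter_filter] at h1
  have h2 : (Finset.univ.filter fun c : Fin (p + 1) × Fin (q + 1) =>
      (∀ r, c.1 = (τ r).1 → c.2 < (τ r).2) ∧ ¬ (c.1 = s.1 → c.2 < s.2)) =
      Finset.univ.map ⟨f, hf⟩ := by
    ext c
    have := h c
    simp only [Finset.mem_filter, Finset.mem_univ, true_and, Finset.mem_map,
      Function.Embedding.coeFn_mk]
    rw [← this]
    simp [not_lt]
  rw [h2, Finset.card_map, Finset.card_univ, Fintype.card_fin] at h1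
  rw [pathArea, pathArea, ← h1]
  congr 2
  ext c
  simp [Fin.forall_fin_succ (n := n + 1), and_comm]

lemma pathArea_cons_right {p q n : ℕ} (s : Fin (p + 1) × Fin (q + 1))
    (τ : Fin (n + 1) → Fin (p + 1) × Fin (q + 1))
    (h : ∀ r : Fin n, IsStep (τ r.castSucc) (τ r.succ))
    (h1 : (τ 0).1.val = s.1.val + 1) :
    pathArea τ =
      pathArea (Fin.cons s τ : Fin (n + 2) → Fin (p + 1) × Fin (q + 1)) + (q + 1 - s.2.val) := by
  refine pathArea_cons s τ _ (fun i => (s.1, ⟨s.2.val + i.val, by omega⟩)) ?_ ?_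
  · intro i j hij
    simp only [Prod.mk.injEq, Fin.mk.injEq, true_and] at hij
    exact Fin.ext (by omega)
  · intro c
    constructor
    · rintro ⟨-, h2, h3⟩
      rw [Fin.le_def] at h3
      refine ⟨⟨c.2.val - s.2.val, by omega⟩, Prod.ext h2.symm (Fin.ext ?_)⟩
      simp only
      omega
    · rintro ⟨i, rfl⟩
      refine ⟨fun r hr => ?_, rfl, by rw [Fin.le_def]; simp⟩
      have := (path_mono τ h r).1
      simp only at hr
      rw [← hr, Fin.le_def] at this
      omega

lemma pathArea_cons_up {p q n : ℕ} (s : Fin (p + 1) × Fin (q + 1))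
    (τ : Fin (n + 1) → Fin (p + 1) × Fin (q + 1))
    (h : ∀ r : Fin n, IsStep (τ r.castSucc) (τ r.succ))
    (h1 : (τ 0).1 = s.1) (h2 : (τ 0).2.val = s.2.val + 1) :
    pathArea τ =
      pathArea (Fin.cons s τ : Fin (n + 2) → Fin (p + 1) × Fin (q + 1)) + 1 := by
  refine pathArea_cons s τ 1 (fun _ => s) (fun i j _ => Subsingleton.elim _ _) ?_
  intro c
  constructor
  · rintro ⟨h3, h4, h5⟩
    have := h3 0 (by rw [h4, h1])
    rw [Fin.lt_def] at this
    rw [Fin.le_def] at h5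
    exact ⟨0, Prod.ext h4.symm (Fin.ext (by omega))⟩
  · rintro ⟨i, rfl⟩
    refine ⟨fun r _ => ?_, rfl, le_rfl⟩
    have := (path_mono τ h r).2
    rw [Fin.le_def] at this
    rw [Fin.lt_def]
    omega

lemma pathArea_const {p q : ℕ} (s : Fin (p + 1) × Fin (q + 1))
    (h : s.1.val + s.2.val = p + q) :
    pathArea (fun _ : Fin 1 => s) = p * (q + 1) + q := by
  classical
  have h1 := Finset.card_filter_add_card_filter_not
    (s := (Finset.univ : Finset (Fin (p + 1) × Fin (q + 1))))
    (fun c => c.1 = s.1 → c.2 < s.2)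
  have h2 : (Finset.univ.filter fun c : Fin (p + 1) × Fin (q + 1) =>
      ¬ (c.1 = s.1 → c.2 < s.2)) = {s} := by
    ext c
    simp only [Finset.mem_filter, Finset.mem_univ, true_and, Finset.mem_singleton,
      Classical.not_imp, not_lt, Fin.le_def]
    constructor
    · rintro ⟨h3, h4⟩
      exact Prod.ext h3 (Fin.ext (by omega))
    · rintro rfl
      exact ⟨rfl, le_rfl⟩
  rw [h2, Finset.card_singleton, Finset.card_univ, Fintype.card_prod, Fintype.card_fin,
    Fintype.card_fin] at h1
  have h3 : (p + 1) * (q + 1) = p * (q + 1) + q + 1 := by ring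
  rw [h3] at h1
  rw [pathArea, ← Nat.add_right_cancel h1]
  congr 2
  ext c
  simp

lemma drop_ofFn {V : Type u} {p : ℕ} (x : Fin (p + 1) → V) (i : Fin (p + 1)) :
    (List.ofFn x).drop i = x i :: (List.ofFn x).drop (i + 1) := by
  have h : i.val < (List.ofFn x).length := by rw [List.length_ofFn]; exact i.2
  rw [List.drop_eq_getElem_cons h, List.getElem_ofFn]

lemma neg_one_pow_eq_of_even {m n : ℕ} (h : Even (m + n)) : (-1 : ℤ) ^ m = (-1) ^ n := by
  rcases neg_one_pow_eq_or ℤ m with h1 | h1 <;> rcases neg_one_pow_eq_or ℤ n with h2 | h2 <;>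
    have h3 := h.neg_one_pow (α := ℤ) <;> rw [pow_add, h1, h2] at h3 <;> simp_all

open Classical in
lemma sum_paths {V W : Type u} {p q : ℕ} (x : Fin (p + 1) → V) (y : Fin (q + 1) → W) (n : ℕ)
    (s : Fin (p + 1) × Fin (q + 1)) (hn : n + s.1.val + s.2.val = p + q) :
    (∑ σ : Fin (n + 1) → Fin (p + 1) × Fin (q + 1),
      if σ 0 = s ∧ ∀ r : Fin n, IsStep (σ r.castSucc) (σ r.succ) then
        (-1 : ℤ) ^ pathArea σ • Finsupp.single (List.ofFn fun r => (x (σ r).1, y (σ r).2)) (1 : ℤ)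
        else 0) =
    (-1 : ℤ) ^ (s.1.val * (q + 1) + s.2.val * (p - s.1.val + 1)) •
      shuffle ((List.ofFn x).drop s.1) ((List.ofFn y).drop s.2) := by
  induction n generalizing s with
  | zero =>
    have h1 : s.1.val = p := by omega
    have h2 : s.2.val = q := by omega
    rw [Finset.sum_eq_single (fun _ => s)]
    · rw [drop_ofFn, drop_ofFn, pathArea_const s (by omega), h1, h2,
        List.drop_eq_nil_of_le (as := List.ofFn x) (by simp),
        List.drop_eq_nil_of_le (as := List.ofFn y) (by simp), shuffle_cons_cons]
      simp [shuffle_nil_left, shuffle_nil_right]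
    · intro σ _ hσ
      rw [if_neg]
      rintro ⟨h3, -⟩
      exact hσ (funext fun i => by rw [show i = 0 from Fin.ext (by omega), h3])
    · simp
  | succ n ih =>
    rw [sum_paths_succ]
    have key : ∀ (t : Fin (p + 1) × Fin (q + 1)) (e : ℕ), n + t.1.val + t.2.val = p + q →
        (∀ τ : Fin (n + 1) → Fin (p + 1) × Fin (q + 1), τ 0 = t →
          (∀ r : Fin n, IsStep (τ r.castSucc) (τ r.succ)) →
          pathArea τ = pathArea (Fin.cons s τ : Fin (n + 2) → Fin (p + 1) × Fin (q + 1)) + e) →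
        (∑ τ : Fin (n + 1) → Fin (p + 1) × Fin (q + 1),
          if τ 0 = t ∧ ∀ r : Fin n, IsStep (τ r.castSucc) (τ r.succ) then
          (-1 : ℤ) ^ pathArea (Fin.cons s τ : Fin (n + 2) → Fin (p + 1) × Fin (q + 1)) •
            Finsupp.single (List.ofFn fun r =>
              (x ((Fin.cons s τ : Fin (n + 2) → Fin (p + 1) × Fin (q + 1)) r).1,
                y ((Fin.cons s τ : Fin (n + 2) → Fin (p + 1) × Fin (q + 1)) r).2)) (1 : ℤ)
          else 0) =
        (-1 : ℤ) ^ (e + (t.1.val * (q + 1) + t.2.val * (p - t.1.val + 1))) •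
          consMap (x s.1, y s.2)
            (shuffle ((List.ofFn x).drop t.1) ((List.ofFn y).drop t.2)) := by
      intro t e ht he
      have := congrArg (fun z => (-1 : ℤ) ^ e • consMap (x s.1, y s.2) z) (ih t ht)
      simp only [map_smul, smul_smul, ← pow_add] at this
      rw [← this, map_sum, Finset.smul_sum]
      refine Finset.sum_congr rfl fun τ _ => ?_
      split_ifs with h
      · rw [map_smul, consMap_single, smul_smul, ← pow_add, he τ h.1 h.2,
          List.ofFn_succ (f := fun r : Fin (n + 2) =>
              (x ((Fin.cons s τ : Fin (n + 2) → Fin (p + 1) × Fin (q + 1)) r).1,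
                y ((Fin.cons s τ : Fin (n + 2) → Fin (p + 1) × Fin (q + 1)) r).2))]
        simp only [Fin.cons_zero, Fin.cons_succ]
        rw [neg_one_pow_eq_of_even (m := pathArea (Fin.cons s τ))]
        exact ⟨pathArea (Fin.cons s τ : Fin (n + 2) → _) + e, by ring⟩
      · simp
    have hsplit : ∀ F : Fin (p + 1) × Fin (q + 1) → FormalSum (V × W),
        (∑ t, if IsStep s t then F t else 0) =
          (if h : s.1.val < p then F (⟨s.1.val + 1, by omega⟩, s.2) else 0) +
          (if h : s.2.val < q then F (s.1, ⟨s.2.val + 1, by omega⟩) else 0) := by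
      intro F
      have h1 : ∀ t, (if IsStep s t then F t else 0) =
          (if t.1.val = s.1.val + 1 ∧ t.2 = s.2 then F t else 0) +
          (if t.1 = s.1 ∧ t.2.val = s.2.val + 1 then F t else 0) := by
        intro t
        rw [IsStep]
        by_cases h1 : t.1.val = s.1.val + 1 ∧ t.2 = s.2
        · have : ¬ (t.1 = s.1 ∧ t.2.val = s.2.val + 1) := by
            rintro ⟨h2, -⟩; rw [h2] at h1; omega
          simp [h1]
        · simp [h1]
      simp only [h1, Finset.sum_add_distrib]
      congr 1
      · split_ifs with h
        · rw [Finset.sum_eq_single (⟨s.1.val + 1, by omega⟩, s.2)]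
          · simp
          · rintro t - ht
            rw [if_neg]
            rintro ⟨h2, h3⟩
            exact ht (Prod.ext (Fin.ext h2) h3)
          · simp
        · refine Finset.sum_eq_zero fun t _ => if_neg ?_
          rintro ⟨h2, h3⟩
          omega
      · split_ifs with h
        · rw [Finset.sum_eq_single (s.1, ⟨s.2.val + 1, by omega⟩)]
          · simp
          · rintro t - ht
            rw [if_neg]
            rintro ⟨h2, h3⟩
            exact ht (Prod.ext h2 (Fin.ext h3))
          · simp
        · refine Finset.sum_eq_zero fun t _ => if_neg ?_
          rintro ⟨h2, h3⟩
          omega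
    rw [hsplit, drop_ofFn x, drop_ofFn y, shuffle_cons_cons, ← drop_ofFn x, ← drop_ofFn y, if_neg,
      zero_add, map_add, map_smul,
      smul_add, smul_smul, ← pow_add]
    · congr 1
      · split_ifs with h
        · rw [key _ (q + 1 - s.2.val) (by simp; omega)]
          · simp only
            rw [neg_one_pow_eq_of_even]
            obtain ⟨c, hc⟩ : ∃ c, p - s.1.val = c + 1 := ⟨p - s.1.val - 1, by omega⟩
            obtain ⟨d, hd⟩ : ∃ d, q + 1 - s.2.val = d := ⟨_, rfl⟩
            have hq : q + 1 = d + s.2.val := by omega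
            rw [hd, show p - (s.1.val + 1) = c by omega, hc]
            exact ⟨d + s.1.val * (q + 1) + s.2.val * (c + 1) + s.2.val, by linarith⟩
          · intro τ h1 h2
            exact pathArea_cons_right s τ h2 (by rw [h1])
        · rw [List.drop_eq_nil_of_le (as := List.ofFn x) (by simp; omega)]
          simp [shuffle_nil_left]
      · split_ifs with h
        · rw [key _ 1 (by simp; omega)]
          · simp only
            rw [neg_one_pow_eq_of_even]
            rw [List.length_drop, List.length_ofFn]
            obtain ⟨c, hc⟩ : ∃ c, p - s.1.val = c := ⟨_, rfl⟩
            rw [show p + 1 - (s.1.val + 1) = c by omega, hc]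
            exact ⟨s.1.val * (q + 1) + s.2.val * (c + 1) + c + 1, by ring⟩
          · intro τ h1 h2
            exact pathArea_cons_up s τ h2 (by rw [h1]) (by rw [h1])
        · rw [List.drop_eq_nil_of_le (as := List.ofFn y) (by simp; omega)]
          simp [shuffle_nil_right]
    · rintro ⟨h1, h2⟩
      rw [List.drop_eq_nil_iff, List.length_ofFn] at h1 h2
      omega

lemma toFormal_exteriorChains {V W : Type u} (G : SimpleGraph V) (H : SimpleGraph W)
    (p a q b n l : ℕ) (hn : p + q = n) (x : Chains G p a) (y : Chains H q b) :
    toFormal (G □ H) n l (exteriorChains G H p a q b n l x y) =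
      proj (G □ H) l (shuffleMap (toFormal G p a x) (toFormal H q b y)) := by
  classical
  induction x using Finsupp.induction_linear with
  | zero => simp
  | add f g hf hg => simp only [map_add, hf, hg, LinearMap.add_apply]
  | single x i =>
  induction y using Finsupp.induction_linear with
  | zero => simp
  | add f g hf hg => simp only [map_add, hf, hg]
  | single y j =>
  have h := sum_paths x.1 y.1 n (0, 0) (by simp; omega)
  simp only [Fin.val_zero, zero_mul, add_zero, pow_zero, one_smul, List.drop_zero] at h
  rw [toFormal_single, toFormal_single, shuffleMap_single, ← h]
  simp only [exteriorChains, Finsupp.lift_apply, Finsupp.sum_single_index, zero_smul,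
    LinearMap.smul_apply, Finsupp.linearCombination_single, map_smul, map_sum,
    toFormal_basisOrZero, latticePaths, Finset.sum_filter, apply_ite, map_zero, mul_smul]

lemma shuffle_mem {V W : Type u} (G : SimpleGraph V) (H : SimpleGraph W) (a b l : ℕ)
    (hl : a + b = l) (x : List V) (y : List W) (hx : IsGen G a x) (hy : IsGen H b y) :
    shuffle x y ∈ Finsupp.supported ℤ ℤ {s | IsGen (G □ H) l s} := by
  cases x with
  | nil => simp [shuffle_nil_left]
  | cons c xs =>
  cases y with
  | nil => simp [shuffle_nil_right]
  | cons d ys =>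
  refine Finsupp.supported_mono ?_ (shuffle_length G H c xs d ys)
  rintro s ⟨_, h1, h2⟩
  exact ⟨h2 hx.1 hy.1, by rw [h1, hx.2, hy.2, ← hl]; push_cast; rfl⟩

lemma shuffle_lt {V W : Type u} (G : SimpleGraph V) (H : SimpleGraph W) (l : ℕ)
    (x : List V) (y : List W) (h : listLength G x + listLength H y < l) :
    shuffle x y ∈ Finsupp.supported ℤ ℤ {s | listLength (G □ H) s < l} := by
  cases x with
  | nil => simp [shuffle_nil_left]
  | cons c xs =>
  cases y with
  | nil => simp [shuffle_nil_right]
  | cons d ys =>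
  refine Finsupp.supported_mono ?_ (shuffle_length G H c xs d ys)
  rintro s ⟨_, h1, h2⟩
  rw [Set.mem_ofPred_eq, h1]
  exact h

/-- `proj (dMap ..)`, the boundary of a chain read as a formal sum -/
noncomputable def formalBoundary {V : Type u} (G : SimpleGraph V) (k l : ℕ) :
    Chains G k l →ₗ[ℤ] FormalSum V := proj G l ∘ₗ dMap ∘ₗ toFormal G k l

lemma shuffleMap_mem {V W : Type u} (G : SimpleGraph V) (H : SimpleGraph W) (p a q b l : ℕ)
    (hl : a + b = l) (x : Chains G p a) (y : Chains H q b) :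
    shuffleMap (toFormal G p a x) (toFormal H q b y) ∈
      Finsupp.supported ℤ ℤ {s | IsGen (G □ H) l s} := by
  refine map_mem_supported (shuffleMap.flip (toFormal H q b y)) ?_ (toFormal_mem G p a x)
  intro s hs
  refine map_mem_supported (shuffleMap (Finsupp.single s 1)) ?_ (toFormal_mem H q b y)
  intro t ht
  rw [shuffleMap_single, mul_one, one_smul]
  exact shuffle_mem G H a b l hl s t hs.1 ht.1

lemma dMap_shuffleMap {V W : Type u} (G : SimpleGraph V) (H : SimpleGraph W) (p a q b : ℕ)
    (x : Chains G p a) (y : Chains H q b) :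
    dMap (shuffleMap (toFormal G p a x) (toFormal H q b y)) =
      shuffleMap (dMap (toFormal G p a x)) (toFormal H q b y) +
        (-1 : ℤ) ^ p • shuffleMap (toFormal G p a x) (dMap (toFormal H q b y)) := by
  refine eqOn_supported (dMap ∘ₗ shuffleMap.flip (toFormal H q b y))
    (shuffleMap.flip (toFormal H q b y) ∘ₗ dMap +
      (-1 : ℤ) ^ p • shuffleMap.flip (dMap (toFormal H q b y))) ?_ (toFormal_mem G p a x)
  intro s hs
  refine eqOn_supported (dMap ∘ₗ shuffleMap (Finsupp.single s 1))
    (shuffleMap (dMap (Finsupp.single s 1)) +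
      (-1 : ℤ) ^ p • shuffleMap (Finsupp.single s 1) ∘ₗ dMap) ?_ (toFormal_mem H q b y)
  intro t ht
  have h1 : s.tail.length = p := by simp [hs.2]
  simp [dMap_shuffle, h1]

lemma proj_shuffleMap_left {V W : Type u} (G : SimpleGraph V) (H : SimpleGraph W) (a q b l : ℕ)
    (hl : a + b = l) {z : FormalSum V} (hz : z ∈ Finsupp.supported ℤ ℤ {s | IsSub G a s})
    (y : Chains H q b) :
    proj (G □ H) l (shuffleMap (proj G a z) (toFormal H q b y)) =
      proj (G □ H) l (shuffleMap z (toFormal H q b y)) := by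
  refine proj_comp_proj G (G □ H) a l (shuffleMap.flip (toFormal H q b y)) ?_ hz
  intro s hs
  refine map_mem_supported (shuffleMap (Finsupp.single s 1)) ?_ (toFormal_mem H q b y)
  intro t ht
  rw [shuffleMap_single, mul_one, one_smul]
  refine shuffle_lt G H l s t ?_
  rw [ht.1.2, ← hl]
  push_cast
  exact (ENat.add_lt_add_iff_right (ENat.natCast_ne_top b)).2 hs

lemma proj_shuffleMap_right {V W : Type u} (G : SimpleGraph V) (H : SimpleGraph W) (p a b l : ℕ)
    (hl : a + b = l) {z : FormalSum W} (hz : z ∈ Finsupp.supported ℤ ℤ {s | IsSub H b s})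
    (x : Chains G p a) :
    proj (G □ H) l (shuffleMap (toFormal G p a x) (proj H b z)) =
      proj (G □ H) l (shuffleMap (toFormal G p a x) z) := by
  refine proj_comp_proj H (G □ H) b l (shuffleMap (toFormal G p a x)) ?_ hz
  intro t ht
  refine map_mem_supported (shuffleMap.flip (Finsupp.single t 1)) ?_ (toFormal_mem G p a x)
  intro s hs
  rw [LinearMap.flip_apply, shuffleMap_single, mul_one, one_smul]
  refine shuffle_lt G H l s t ?_
  rw [hs.1.2, ← hl]
  push_cast
  exact (ENat.add_lt_add_iff_left (ENat.natCast_ne_top a)).2 ht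

lemma formalBoundary_succ {V : Type u} (G : SimpleGraph V) (k l : ℕ) (z : Chains G (k + 1) l) :
    formalBoundary G (k + 1) l z = toFormal G k l (boundary G k l z) :=
  (toFormal_boundary G k l z).symm

lemma formalBoundary_zero {V : Type u} (G : SimpleGraph V) (l : ℕ) (z : Chains G 0 l) :
    formalBoundary G 0 l z = 0 := by
  simp [formalBoundary, dMap_toFormal_zero]

lemma formalBoundary_exteriorChains {V W : Type u} (G : SimpleGraph V) (H : SimpleGraph W)
    (p a q b n l : ℕ) (hn : p + q = n) (hl : a + b = l) (x : Chains G p a) (y : Chains H q b) :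
    formalBoundary (G □ H) n l (exteriorChains G H p a q b n l x y) =
      proj (G □ H) l (shuffleMap (formalBoundary G p a x) (toFormal H q b y)) +
        (-1 : ℤ) ^ p •
          proj (G □ H) l (shuffleMap (toFormal G p a x) (formalBoundary H q b y)) := by
  simp only [formalBoundary, LinearMap.comp_apply]
  rw [toFormal_exteriorChains G H p a q b n l hn,
    proj_eq_self _ _ (shuffleMap_mem G H p a q b l hl x y), dMap_shuffleMap, map_add, map_smul,
    proj_shuffleMap_left G H a q b l hl (dMap_isSub G p a x),
    proj_shuffleMap_right G H p a b l hl (dMap_isSub H q b y)]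

/-- the exterior product is a chain map -/
lemma boundary_exteriorChains {V W : Type u} (G : SimpleGraph V) (H : SimpleGraph W)
    (p a q b n l : ℕ) (hn : p + q = n) (hl : a + b = l)
    (x : Chains G (p + 1) a) (y : Chains H (q + 1) b) :
    boundary (G □ H) (n + 1) l (exteriorChains G H (p + 1) a (q + 1) b (n + 2) l x y) =
      exteriorChains G H p a (q + 1) b (n + 1) l (boundary G p a x) y +
        (-1 : ℤ) ^ (p + 1) •
          exteriorChains G H (p + 1) a q b (n + 1) l x (boundary H q b y) := by
  apply toFormal_injective
  rw [← formalBoundary_succ, formalBoundary_exteriorChains G H _ _ _ _ _ _ (by omega) hl, map_add,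
    map_smul, toFormal_exteriorChains G H _ _ _ _ _ _ (by omega),
    toFormal_exteriorChains G H _ _ _ _ _ _ (by omega), formalBoundary_succ, formalBoundary_succ]

/-! ### Magnitude homology -/

/-- The magnitude chain complex `MC_{*,l}(G)`. -/
noncomputable def magnitudeComplex {V : Type u} (G : SimpleGraph V) (l : ℕ) :
    ChainComplex (ModuleCat.{u} ℤ) ℕ :=
  ChainComplex.of (fun k => ModuleCat.of ℤ (Chains G k l))
    (fun k => ModuleCat.ofHom (boundary G k l)) fun k => by
      rw [← ModuleCat.ofHom_comp, boundary_boundary]; rfl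

/-- The magnitude homology group `MH_{k,l}(G)`. -/
noncomputable abbrev MH {V : Type u} (G : SimpleGraph V) (k l : ℕ) : ModuleCat.{u} ℤ :=
  (magnitudeComplex G l).homology k

lemma magnitudeComplex_d {V : Type u} (G : SimpleGraph V) (k l : ℕ) :
    (magnitudeComplex G l).d (k + 1) k = ModuleCat.ofHom (boundary G k l) :=
  ChainComplex.of_d (X := fun k => ModuleCat.of ℤ (Chains G k l)) (fun k => ModuleCat.ofHom (boundary G k l)) k

/-- The induced chain map `f_#`. -/
noncomputable def inducedChainMap {V W : Type u} {G : SimpleGraph V} {H : SimpleGraph W}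
    (f : GraphMap G H) (l : ℕ) : magnitudeComplex G l ⟶ magnitudeComplex H l :=
  ChainComplex.ofHom (fun k => ModuleCat.ofHom (inducedChains f k l)) fun k => by
    rw [magnitudeComplex_d, magnitudeComplex_d]
    ext1
    ext1 z
    exact (inducedChains_boundary f k l z).symm

/-- The induced map in homology `f_*`. -/
noncomputable def inducedHomology {V W : Type u} {G : SimpleGraph V} {H : SimpleGraph W}
    (f : GraphMap G H) (k l : ℕ) : MH G k l ⟶ MH H k l :=
  HomologicalComplex.homologyMap (inducedChainMap f l) k

/-- The map of graphs `f □ g`. -/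
def GraphMap.boxProd {V W V' W' : Type u} {G : SimpleGraph V} {H : SimpleGraph W}
    {G' : SimpleGraph V'} {H' : SimpleGraph W'} (f : GraphMap G G') (g : GraphMap H H') :
    GraphMap (G □ H) (G' □ H') where
  toFun v := (f.toFun v.1, g.toFun v.2)
  map_adj x y h := by
    rw [SimpleGraph.boxProd_adj] at h
    rcases h with ⟨h1, h2⟩ | ⟨h1, h2⟩
    · rcases f.map_adj _ _ h1 with h | h
      · exact Or.inl (SimpleGraph.boxProd_adj.2 (Or.inl ⟨h, by rw [h2]⟩))
      · exact Or.inr (by rw [h, h2])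
    · rcases g.map_adj _ _ h1 with h | h
      · exact Or.inl (SimpleGraph.boxProd_adj.2 (Or.inr ⟨h, by rw [h2]⟩))
      · exact Or.inr (by rw [h, h2])

/-! ### Tensor products, Tor and direct sums of modules -/

/-- The tensor product of two modules. -/
noncomputable abbrev tensorObj {R : Type} [CommRing R] (A B : ModuleCat.{u} R) : ModuleCat.{u} R :=
  ModuleCat.of R (A ⊗[R] B)

/-- The map `f ⊗ g`. -/
noncomputable abbrev tensorMap {R : Type} [CommRing R] {A A' B B' : ModuleCat.{u} R}
    (f : A ⟶ A') (g : B ⟶ B') : tensorObj A B ⟶ tensorObj A' B' :=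
  ModuleCat.ofHom (TensorProduct.map f.hom g.hom)

/-- The functor `A ⊗ -`. -/
noncomputable def tensorFunctor {R : Type} [CommRing R] (A : ModuleCat.{u} R) :
    ModuleCat.{u} R ⥤ ModuleCat.{u} R where
  obj B := tensorObj A B
  map g := tensorMap (𝟙 A) g
  map_id B := by ext1; exact TensorProduct.map_id
  map_comp f g := by
    ext1
    exact TensorProduct.map_comp (LinearMap.id : A →ₗ[R] A) g.hom (LinearMap.id : A →ₗ[R] A) f.hom

instance tensorFunctor_additive {R : Type} [CommRing R] (A : ModuleCat.{u} R) :
    (tensorFunctor A).Additive where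
  map_add {B C f g} := by ext1; exact TensorProduct.map_add_right _ _ _

/-- The natural transformation `A ⊗ - ⟶ A' ⊗ -` given by a map `f : A ⟶ A'`. -/
noncomputable def tensorFunctorMap {R : Type} [CommRing R] {A A' : ModuleCat.{u} R} (f : A ⟶ A') :
    tensorFunctor A ⟶ tensorFunctor A' where
  app B := tensorMap f (𝟙 B)
  naturality B C g := by
    ext1
    refine TensorProduct.ext' fun x y => ?_
    rfl

/-- `Tor₁(A, B)`, the first left derived functor of `A ⊗ -` applied to `B`.
This is the definition of Mathlib's `Tor`, which needs the ring and the modules to be in the same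
universe. -/
noncomputable def torObj {R : Type} [CommRing R] (A B : ModuleCat.{u} R) : ModuleCat.{u} R :=
  ((tensorFunctor A).leftDerived 1).obj B

/-- The map `Tor₁(f, g)`. -/
noncomputable def torMap {R : Type} [CommRing R] {A A' B B' : ModuleCat.{u} R}
    (f : A ⟶ A') (g : B ⟶ B') : torObj A B ⟶ torObj A' B' :=
  (NatTrans.leftDerived (tensorFunctorMap f) 1).app B ≫ ((tensorFunctor A').leftDerived 1).map g

/-- The direct sum of a family of modules. -/
noncomputable abbrev sumObj {R : Type} [CommRing R] {ι : Type} (M : ι → ModuleCat.{u} R) :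
    ModuleCat.{u} R :=
  ModuleCat.of R (⨁ i, M i)

/-- The map between direct sums given by a family of maps. -/
noncomputable abbrev sumMap {R : Type} [CommRing R] {ι : Type} {M N : ι → ModuleCat.{u} R}
    (f : ∀ i, M i ⟶ N i) : sumObj M ⟶ sumObj N :=
  ModuleCat.ofHom (DirectSum.lmap fun i => (f i).hom)

/-- The map out of a direct sum with the given components. -/
noncomputable abbrev sumDesc {R : Type} [CommRing R] {ι : Type} [DecidableEq ι]
    {M : ι → ModuleCat.{u} R} {N : ModuleCat.{u} R} (f : ∀ i, M i ⟶ N) : sumObj M ⟶ N :=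
  ModuleCat.ofHom (DirectSum.toModule R ι N fun i => (f i).hom)

/-! ### Bilinear maps on homology -/

/-- The cycles of degree `n`. -/
noncomputable abbrev cyclesOf {R : Type} [CommRing R] (K : ChainComplex (ModuleCat.{u} R) ℕ)
    (n : ℕ) : Submodule R (K.X n) :=
  LinearMap.ker (K.sc n).g.hom

/-- The class of a cycle in homology; see `classOf_eq`. -/
noncomputable def classOf {R : Type} [CommRing R] (K : ChainComplex (ModuleCat.{u} R) ℕ) (n : ℕ) :
    cyclesOf K n →ₗ[R] K.homology n :=
  (K.sc n).moduleCatHomologyIso.inv.hom ∘ₗ (LinearMap.range (K.sc n).moduleCatToCycles).mkQ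

/-- `classOf` is the projection from cycles to homology. -/
lemma classOf_eq {R : Type} [CommRing R] (K : ChainComplex (ModuleCat.{u} R) ℕ) (n : ℕ)
    (z : K.cycles n) (w : cyclesOf K n) (h : (K.iCycles n).hom z = w.1) :
    classOf K n w = (K.homologyπ n).hom z := by
  have h1 : (K.sc n).moduleCatCyclesIso.inv.hom w = z := by
    apply (ModuleCat.mono_iff_injective (K.iCycles n)).1 inferInstance
    have h2 := ConcreteCategory.congr_hom (K.sc n).moduleCatCyclesIso_inv_iCycles w
    exact h2.trans h.symm
  have h3 := ConcreteCategory.congr_hom (K.sc n).moduleCatCyclesIso_inv_π w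
  rw [← h1]
  exact h3.symm

lemma classOf_surjective {R : Type} [CommRing R] (K : ChainComplex (ModuleCat.{u} R) ℕ) (n : ℕ) :
    Function.Surjective (classOf K n) := by
  intro x
  obtain ⟨y, hy⟩ := (LinearMap.range (K.sc n).moduleCatToCycles).mkQ_surjective
    ((K.sc n).moduleCatHomologyIso.hom.hom x)
  refine ⟨y, ?_⟩
  refine (congrArg (K.sc n).moduleCatHomologyIso.inv.hom hy).trans ?_
  exact ConcreteCategory.congr_hom (K.sc n).moduleCatHomologyIso.hom_inv_id x

lemma mem_cyclesOf_iff {R : Type} [CommRing R] (K : ChainComplex (ModuleCat.{u} R) ℕ) (n m : ℕ)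
    (hm : (ComplexShape.down ℕ).next n = m) (z : K.X n) :
    z ∈ cyclesOf K n ↔ (K.d n m).hom z = 0 := by
  subst hm
  rfl

lemma classOf_eq_zero_iff {R : Type} [CommRing R] (K : ChainComplex (ModuleCat.{u} R) ℕ) (n : ℕ)
    (z : cyclesOf K n) :
    classOf K n z = 0 ↔ ∃ c : K.X (n + 1), (K.d (n + 1) n).hom c = z.1 := by
  have hinj : Function.Injective (K.sc n).moduleCatHomologyIso.inv.hom :=
    (ModuleCat.mono_iff_injective _).1 inferInstance
  have h1 : classOf K n z = 0 ↔ z ∈ LinearMap.range (K.sc n).moduleCatToCycles := by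
    exact (map_eq_zero_iff (K.sc n).moduleCatHomologyIso.inv.hom hinj).trans
      (Submodule.Quotient.mk_eq_zero _)
  rw [h1]
  have h2 : ∀ m, (ComplexShape.down ℕ).prev n = m →
      (z ∈ LinearMap.range (K.sc n).moduleCatToCycles ↔ ∃ c : K.X m, (K.d m n).hom c = z.1) := by
    rintro m rfl
    exact ⟨fun ⟨c, hc⟩ => ⟨c, congrArg Subtype.val hc⟩, fun ⟨c, hc⟩ => ⟨c, Subtype.ext hc⟩⟩
  exact h2 (n + 1) (ChainComplex.prev ℕ n)

/-- A linear map on cycles that vanishes on boundaries, as a map on homology. -/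
noncomputable def homologyLift {R : Type} [CommRing R] (K : ChainComplex (ModuleCat.{u} R) ℕ)
    (n : ℕ) {P : Type u} [AddCommGroup P] [Module R P] (f : cyclesOf K n →ₗ[R] P)
    (hf : ∀ z, (∃ c : K.X (n + 1), (K.d (n + 1) n).hom c = z.1) → f z = 0) :
    K.homology n →ₗ[R] P :=
  (LinearMap.ker (classOf K n)).liftQ f (fun z hz => hf z ((classOf_eq_zero_iff K n z).1 hz)) ∘ₗ
    ((classOf K n).quotKerEquivOfSurjective (classOf_surjective K n)).symm.toLinearMap

lemma homologyLift_classOf {R : Type} [CommRing R] (K : ChainComplex (ModuleCat.{u} R) ℕ)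
    (n : ℕ) {P : Type u} [AddCommGroup P] [Module R P] (f : cyclesOf K n →ₗ[R] P)
    (hf : ∀ z, (∃ c : K.X (n + 1), (K.d (n + 1) n).hom c = z.1) → f z = 0) (z : cyclesOf K n) :
    homologyLift K n f hf (classOf K n z) = f z := by
  rw [homologyLift, LinearMap.comp_apply]
  have : ((classOf K n).quotKerEquivOfSurjective (classOf_surjective K n)).symm
      (classOf K n z) = Submodule.Quotient.mk z := by
    rw [LinearEquiv.symm_apply_eq]; rfl
  erw [this]
  rfl

/-- A bilinear map on chains that sends a pair of cycles to a cycle, and to a boundary as soon as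
one of the two is a boundary. -/
structure IsCyclePairing {R : Type} [CommRing R] {K L M : ChainComplex (ModuleCat.{u} R) ℕ}
    {p q n : ℕ} (μ : K.X p →ₗ[R] L.X q →ₗ[R] M.X n) : Prop where
  cycle : ∀ a ∈ cyclesOf K p, ∀ b ∈ cyclesOf L q, μ a b ∈ cyclesOf M n
  left : ∀ c, ∀ b ∈ cyclesOf L q,
    ∃ e, (M.d (n + 1) n).hom e = μ ((K.d (p + 1) p).hom c) b
  right : ∀ a ∈ cyclesOf K p, ∀ c,
    ∃ e, (M.d (n + 1) n).hom e = μ a ((L.d (q + 1) q).hom c)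

/-- The map `b ↦ [μ a b]` on homology, for a cycle `a`. -/
noncomputable def pairingRight {R : Type} [CommRing R]
    {K L M : ChainComplex (ModuleCat.{u} R) ℕ} {p q n : ℕ}
    (μ : K.X p →ₗ[R] L.X q →ₗ[R] M.X n) (h : IsCyclePairing μ) (a : cyclesOf K p) :
    L.homology q →ₗ[R] M.homology n :=
  homologyLift L q
    (classOf M n ∘ₗ LinearMap.codRestrict (cyclesOf M n) (μ a.1 ∘ₗ (cyclesOf L q).subtype)
      fun b => h.cycle a.1 a.2 b.1 b.2)
    (fun z ⟨c, hc⟩ => by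
      obtain ⟨e, he⟩ := h.right a.1 a.2 c
      exact (classOf_eq_zero_iff M n _).2 ⟨e, he.trans (congrArg (μ a.1) hc)⟩)

lemma pairingRight_classOf {R : Type} [CommRing R]
    {K L M : ChainComplex (ModuleCat.{u} R) ℕ} {p q n : ℕ}
    (μ : K.X p →ₗ[R] L.X q →ₗ[R] M.X n) (h : IsCyclePairing μ) (a : cyclesOf K p)
    (b : cyclesOf L q) :
    pairingRight μ h a (classOf L q b) = classOf M n ⟨μ a.1 b.1, h.cycle a.1 a.2 b.1 b.2⟩ :=
  homologyLift_classOf _ _ _ _ _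

/-- `pairingRight` as a linear map in the cycle `a`. -/
noncomputable def pairingCycles {R : Type} [CommRing R]
    {K L M : ChainComplex (ModuleCat.{u} R) ℕ} {p q n : ℕ}
    (μ : K.X p →ₗ[R] L.X q →ₗ[R] M.X n) (h : IsCyclePairing μ) :
    cyclesOf K p →ₗ[R] L.homology q →ₗ[R] M.homology n where
  toFun := pairingRight μ h
  map_add' a a' := by
    refine LinearMap.ext fun y => ?_
    obtain ⟨b, rfl⟩ := classOf_surjective L q y
    rw [LinearMap.add_apply, pairingRight_classOf, pairingRight_classOf, pairingRight_classOf,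
      ← map_add]
    exact congrArg (classOf M n) (Subtype.ext (LinearMap.congr_fun (map_add μ a.1 a'.1) b.1))
  map_smul' r a := by
    refine LinearMap.ext fun y => ?_
    obtain ⟨b, rfl⟩ := classOf_surjective L q y
    rw [RingHom.id_apply, LinearMap.smul_apply, pairingRight_classOf, pairingRight_classOf,
      ← map_smul]
    exact congrArg (classOf M n) (Subtype.ext (LinearMap.congr_fun (map_smul μ r a.1) b.1))

lemma pairingCycles_boundary {R : Type} [CommRing R]
    {K L M : ChainComplex (ModuleCat.{u} R) ℕ} {p q n : ℕ}
    (μ : K.X p →ₗ[R] L.X q →ₗ[R] M.X n) (h : IsCyclePairing μ) (z : cyclesOf K p)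
    (hz : ∃ c : K.X (p + 1), (K.d (p + 1) p).hom c = z.1) : pairingCycles μ h z = 0 := by
  obtain ⟨c, hc⟩ := hz
  refine LinearMap.ext fun y => ?_
  obtain ⟨b, rfl⟩ := classOf_surjective L q y
  obtain ⟨e, he⟩ := h.left c b.1 b.2
  refine (pairingRight_classOf μ h z b).trans ?_
  rw [LinearMap.zero_apply, classOf_eq_zero_iff]
  exact ⟨e, he.trans (congrArg (fun t => μ t b.1) hc)⟩

/-- The induced map `[a] ⊗ [b] ↦ [μ a b]` on homology. -/
noncomputable def homologyPairing {R : Type} [CommRing R]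
    {K L M : ChainComplex (ModuleCat.{u} R) ℕ} {p q n : ℕ}
    (μ : K.X p →ₗ[R] L.X q →ₗ[R] M.X n) (h : IsCyclePairing μ) :
    tensorObj (K.homology p) (L.homology q) ⟶ M.homology n :=
  ModuleCat.ofHom (TensorProduct.lift
    (homologyLift K p (pairingCycles μ h) (pairingCycles_boundary μ h)))

lemma homologyPairing_classOf {R : Type} [CommRing R]
    {K L M : ChainComplex (ModuleCat.{u} R) ℕ} {p q n : ℕ}
    (μ : K.X p →ₗ[R] L.X q →ₗ[R] M.X n) (h : IsCyclePairing μ)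
    (a : cyclesOf K p) (b : cyclesOf L q) :
    (homologyPairing μ h).hom (classOf K p a ⊗ₜ[R] classOf L q b) =
      classOf M n ⟨μ a.1 b.1, h.cycle a.1 a.2 b.1 b.2⟩ := by
  have h1 := homologyLift_classOf K p (pairingCycles μ h) (pairingCycles_boundary μ h) a
  exact (LinearMap.congr_fun h1 (classOf L q b)).trans (pairingRight_classOf μ h a b)

/-! ### The exterior product in homology -/

lemma mem_cyclesOf_magnitudeComplex {V : Type u} (G : SimpleGraph V) (k l : ℕ)
    (z : (magnitudeComplex G l).X k) :
    z ∈ cyclesOf (magnitudeComplex G l) k ↔ formalBoundary G k l z = 0 := by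
  cases k with
  | zero =>
    refine (mem_cyclesOf_iff _ 0 0 (by simp) z).trans ?_
    refine iff_of_true ?_ (formalBoundary_zero G l z)
    rw [HomologicalComplex.shape _ 0 0 (by simp)]
    rfl
  | succ k =>
    refine (mem_cyclesOf_iff _ (k + 1) k (by simp) z).trans ?_
    rw [magnitudeComplex_d]
    exact (map_eq_zero_iff (toFormal G k l) (toFormal_injective G k l)).symm.trans
      (iff_of_eq (congrArg (fun t => t = 0) (formalBoundary_succ G k l z).symm))

lemma exteriorChains_cycle {V W : Type u} (G : SimpleGraph V) (H : SimpleGraph W)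
    (p a q b n l : ℕ) (hn : p + q = n) (hl : a + b = l) (x : Chains G p a) (y : Chains H q b)
    (hx : formalBoundary G p a x = 0) (hy : formalBoundary H q b y = 0) :
    formalBoundary (G □ H) n l (exteriorChains G H p a q b n l x y) = 0 := by
  rw [formalBoundary_exteriorChains G H p a q b n l hn hl, hx, hy]
  simp

lemma exteriorChains_left {V W : Type u} (G : SimpleGraph V) (H : SimpleGraph W)
    (p a q b n l : ℕ) (hn : p + q = n) (hl : a + b = l) (x : Chains G (p + 1) a)
    (y : Chains H q b) (hy : formalBoundary H q b y = 0) :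
    boundary (G □ H) n l (exteriorChains G H (p + 1) a q b (n + 1) l x y) =
      exteriorChains G H p a q b n l (boundary G p a x) y := by
  apply toFormal_injective
  rw [← formalBoundary_succ,
    formalBoundary_exteriorChains G H (p + 1) a q b (n + 1) l (by omega) hl, hy,
    toFormal_exteriorChains G H p a q b n l hn, formalBoundary_succ]
  simp

lemma exteriorChains_right {V W : Type u} (G : SimpleGraph V) (H : SimpleGraph W)
    (p a q b n l : ℕ) (hn : p + q = n) (hl : a + b = l) (x : Chains G p a)
    (y : Chains H (q + 1) b) (hx : formalBoundary G p a x = 0) :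
    boundary (G □ H) n l ((-1 : ℤ) ^ p • exteriorChains G H p a (q + 1) b (n + 1) l x y) =
      exteriorChains G H p a q b n l x (boundary H q b y) := by
  apply toFormal_injective
  rw [← formalBoundary_succ, map_smul,
    formalBoundary_exteriorChains G H p a (q + 1) b (n + 1) l (by omega) hl, hx,
    toFormal_exteriorChains G H p a q b n l hn, formalBoundary_succ, map_zero,
    LinearMap.zero_apply, map_zero, zero_add, smul_smul, ← mul_pow]
  simp

lemma isCyclePairing_exteriorChains {V W : Type u} (G : SimpleGraph V) (H : SimpleGraph W)
    (p a q b n l : ℕ) (hn : p + q = n) (hl : a + b = l) :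
    IsCyclePairing (K := magnitudeComplex G a) (L := magnitudeComplex H b)
      (M := magnitudeComplex (G □ H) l) (exteriorChains G H p a q b n l) where
  cycle x hx y hy :=
    (mem_cyclesOf_magnitudeComplex _ _ _ _).2 (exteriorChains_cycle G H p a q b n l hn hl x y
      ((mem_cyclesOf_magnitudeComplex _ _ _ _).1 hx) ((mem_cyclesOf_magnitudeComplex _ _ _ _).1 hy))
  left c y hy := by
    refine ⟨exteriorChains G H (p + 1) a q b (n + 1) l c y, ?_⟩
    rw [magnitudeComplex_d, magnitudeComplex_d]
    exact exteriorChains_left G H p a q b n l hn hl c y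
      ((mem_cyclesOf_magnitudeComplex _ _ _ _).1 hy)
  right x hx c := by
    refine ⟨(-1 : ℤ) ^ p • exteriorChains G H p a (q + 1) b (n + 1) l x c, ?_⟩
    rw [magnitudeComplex_d, magnitudeComplex_d]
    exact exteriorChains_right G H p a q b n l hn hl x c
      ((mem_cyclesOf_magnitudeComplex _ _ _ _).1 hx)

/-- The component `MH_{p,a}(G) ⊗ MH_{q,b}(H) ⟶ MH_{p+q,a+b}(G □ H)` of the exterior product in
homology, induced by the exterior product of chains; see `exteriorComponent_classOf`. -/
noncomputable def exteriorComponent {V W : Type u} (G : SimpleGraph V) (H : SimpleGraph W)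
    {p a q b k l : ℕ} (hk : p + q = k) (hl : a + b = l) :
    tensorObj (MH G p a) (MH H q b) ⟶ MH (G □ H) k l :=
  homologyPairing _ (isCyclePairing_exteriorChains G H p a q b k l hk hl)

/-- The exterior product of the classes of two cycles is the class of their exterior product. -/
lemma exteriorComponent_classOf {V W : Type u} (G : SimpleGraph V) (H : SimpleGraph W)
    {p a q b k l : ℕ} (hk : p + q = k) (hl : a + b = l)
    (x : cyclesOf (magnitudeComplex G a) p) (y : cyclesOf (magnitudeComplex H b) q) :
    (exteriorComponent G H hk hl).hom
        (classOf (magnitudeComplex G a) p x ⊗ₜ[ℤ] classOf (magnitudeComplex H b) q y) =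
      classOf (magnitudeComplex (G □ H) l) k ⟨exteriorChains G H p a q b k l x.1 y.1,
        (isCyclePairing_exteriorChains G H p a q b k l hk hl).cycle x.1 x.2 y.1 y.2⟩ :=
  homologyPairing_classOf _ (isCyclePairing_exteriorChains G H p a q b k l hk hl) x y

/-- The pairs of bidegrees `((k₁, l₁), (k₂, l₂))` with `k₁ + k₂ = k` and `l₁ + l₂ = l`. -/
abbrev Bidegrees (k l : ℕ) : Type :=
  {d : (ℕ × ℕ) × (ℕ × ℕ) // d.1.1 + d.2.1 = k ∧ d.1.2 + d.2.2 = l}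

/-- The pairs of bidegrees `((k₁, l₁), (k₂, l₂))` with `k₁ + k₂ = k - 1` and `l₁ + l₂ = l`. -/
abbrev TorBidegrees (k l : ℕ) : Type :=
  {d : (ℕ × ℕ) × (ℕ × ℕ) // d.1.1 + d.2.1 + 1 = k ∧ d.1.2 + d.2.2 = l}

/-- The part of bidegree `(k, l)` of `MH(G) ⊗ MH(H)`. -/
noncomputable def tensorMH {V W : Type u} (G : SimpleGraph V) (H : SimpleGraph W) (k l : ℕ) :
    ModuleCat.{u} ℤ :=
  sumObj fun d : Bidegrees k l => tensorObj (MH G d.1.1.1 d.1.1.2) (MH H d.1.2.1 d.1.2.2)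

/-- The map `f_* ⊗ g_*` in bidegree `(k, l)`. -/
noncomputable def tensorMHMap {V W V' W' : Type u} {G : SimpleGraph V} {H : SimpleGraph W}
    {G' : SimpleGraph V'} {H' : SimpleGraph W'} (f : GraphMap G G') (g : GraphMap H H')
    (k l : ℕ) : tensorMH G H k l ⟶ tensorMH G' H' k l :=
  sumMap fun d : Bidegrees k l =>
    tensorMap (inducedHomology f d.1.1.1 d.1.1.2) (inducedHomology g d.1.2.1 d.1.2.2)

/-- The part of bidegree `(k, l)` of `Tor(MH_{*-1,*}(G), MH_{*,*}(H))`. -/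
noncomputable def torMH {V W : Type u} (G : SimpleGraph V) (H : SimpleGraph W) (k l : ℕ) :
    ModuleCat.{u} ℤ :=
  sumObj fun d : TorBidegrees k l => torObj (MH G d.1.1.1 d.1.1.2) (MH H d.1.2.1 d.1.2.2)

/-- The map `Tor(f_*, g_*)` in bidegree `(k, l)`. -/
noncomputable def torMHMap {V W V' W' : Type u} {G : SimpleGraph V} {H : SimpleGraph W}
    {G' : SimpleGraph V'} {H' : SimpleGraph W'} (f : GraphMap G G') (g : GraphMap H H')
    (k l : ℕ) : torMH G H k l ⟶ torMH G' H' k l :=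
  sumMap fun d : TorBidegrees k l =>
    torMap (inducedHomology f d.1.1.1 d.1.1.2) (inducedHomology g d.1.2.1 d.1.2.2)

/-- The exterior product in homology, in bidegree `(k, l)`. -/
noncomputable def exteriorProduct {V W : Type u} (G : SimpleGraph V) (H : SimpleGraph W)
    (k l : ℕ) : tensorMH G H k l ⟶ MH (G □ H) k l :=
  sumDesc fun d : Bidegrees k l => exteriorComponent G H d.2.1 d.2.2

end MagnitudeHomology

open CategoryTheory MagnitudeHomology

/-!
The Künneth sequence has a topological part, an Eilenberg–Zilber theorem for magnitude chains, and
an algebraic part, the Künneth theorem for complexes of finitely generated free modules over a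
principal ideal domain.

**Eilenberg–Zilber.** Magnitude chains are a subquotient of the complex of *all* formal sums of
lists of vertices with the differential `fullList` of a simplex, which deletes any entry, the first
and the last one included. This complex is filtered by the length, and has the degenerate
subcomplex of lists with two equal neighbours. Modulo degenerate and shorter lists, the full
differential is the magnitude differential, because deleting an end of a list without repetitions
makes it shorter (`fromFormal_fullList`). On lists, the shuffle product `∇` and the
Alexander–Whitney map `AW`, which takes `((x₀, y₀), …, (x_k, y_k))` to
`∑ᵢ (x₀, …, xᵢ) ⊗ (yᵢ, …, y_k)`, commute with the full differentials
(`fullMap_shuffle`, `tensorFullMap_alexanderWhitneyList`). Modulo degenerate lists, `AW ∘ ∇` is the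
identity (`alexanderWhitney_shuffle`). The recursion `H (z :: s) = z :: (∇ AW (z :: s) - H s)`
defines a homotopy from the identity to `∇ ∘ AW` (`fullMap_homotopyList`). All these maps are
compatible with the length, which is additive for `G □ H`, and so they pass to magnitude chains:
`alexanderWhitneyChains_boundary`, `alexanderWhitneyChains_exteriorChains`,
`exists_boundary_eq_sum_exteriorTensor_sub`.

**Künneth.** The properties that are used are collected in `IsEilenbergZilber`. For a complex `K` of
finitely generated free modules, the cycles `Z` have a complement `C` in the chains, and
`0 ⟶ B_q ⟶ Z_q ⟶ H_q ⟶ 0` is a free resolution. Hence `Tor₁(H_p(K), H_q(L))` is the kernel of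
`H_p(K) ⊗ B_q(L) ⟶ H_p(K) ⊗ Z_q(L)` (`kerToTor_bijective`). If `z` is a cycle with components
`z_{p,q}` under the Alexander–Whitney map, then `(class ⊗ d) z_{p,q+1}` lies in this kernel; this
defines the second map of the sequence (`IsEilenbergZilber.connecting`). It is natural, because
two choices of `C` change `class` by a map that vanishes on cycles, and `d ⊗ d` kills `z_{p,q+1}`
(`torMap_torComponent`). It is surjective, because an element of the kernel can be lifted to chains
and completed to a cycle (`IsEilenbergZilber.connecting_surjective`). A component of a cycle has no
part in `C ⊗ C`, and if the image in `Tor₁` vanishes, then its parts in `Z ⊗ C` and `C ⊗ Z` can be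
removed by a boundary (`IsCoproduct.exists_boundary`); a sum of products of cycles remains, which
gives exactness in the middle. Finally, `AW` followed by `class ⊗ class` is a retraction of `□`
(`IsEilenbergZilber.product_retraction`), so that `□` is injective and the sequence splits. The
torsion term vanishes after tensoring with `ℚ`, and if one of the homologies is torsion-free, hence
`□` is an isomorphism in these cases.
-/

open CategoryTheory

namespace MagnitudeHomology

open scoped TensorProduct DirectSum

/-! ### The full differential on formal sums of lists -/

/-- The differential of the augmented complex of the full simplex on `V`: the alternating sum of
*all* the lists obtained by deleting one entry. In contrast with `dList`, the first and the last
entry are deleted too, and the boundary of `[a]` is the empty list. -/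
noncomputable def fullList {V : Type u} : List V → FormalSum V
  | [] => 0
  | a :: c => Finsupp.single c 1 - consMap a (fullList c)

/-- The linear extension of `fullList`. -/
noncomputable def fullMap {V : Type u} : FormalSum V →ₗ[ℤ] FormalSum V :=
  Finsupp.linearCombination ℤ fullList

@[simp] lemma fullMap_single {V : Type u} (s : List V) (n : ℤ) :
    fullMap (Finsupp.single s n) = n • fullList s := by
  simp [fullMap]

lemma fullMap_consMap {V : Type u} (a : V) (z : FormalSum V) :
    fullMap (consMap a z) = z - consMap a (fullMap z) := by
  induction z using Finsupp.induction_linear with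
  | zero => simp
  | add f g hf hg => simp only [map_add, hf, hg]; abel
  | single s n => simp [fullList, smul_sub]

lemma mapFormal_fullMap {V W : Type u} (f : V → W) (z : FormalSum V) :
    mapFormal f (fullMap z) = fullMap (mapFormal f z) := by
  induction z using Finsupp.induction_linear with
  | zero => simp
  | add f g hf hg => simp only [map_add, hf, hg]
  | single s n =>
    simp only [fullMap_single, mapFormal_single, map_smul]
    congr 1
    induction s with
    | nil => simp [fullList]
    | cons a t ih => simp [fullList, mapFormal_consMap, ih]

lemma fullList_length_mem {V : Type u} (x : List V) :
    fullList x ∈ Finsupp.supported ℤ ℤ {s : List V | s.length + 1 = x.length} := by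
  induction x with
  | nil => simp [fullList]
  | cons a t ih =>
    rw [fullList]
    refine Submodule.sub_mem _ (single_mem (by simp) _) (map_mem_supported (consMap a) ?_ ih)
    intro s hs
    rw [consMap_single]
    exact single_mem (by simpa using hs) _

/-- The projection of formal sums to the multiples of the empty list. -/
noncomputable def nilPart {V : Type u} : FormalSum V →ₗ[ℤ] FormalSum V :=
  Finsupp.lsingle [] ∘ₗ Finsupp.lapply []

lemma nilPart_single_nil {V : Type u} :
    nilPart (Finsupp.single ([] : List V) (1 : ℤ)) = Finsupp.single [] 1 := by
  simp [nilPart]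

lemma nilPart_single_cons {V : Type u} (a : V) (s : List V) (n : ℤ) :
    nilPart (Finsupp.single (a :: s) n) = 0 := by
  simp [nilPart]

lemma nilPart_consMap {V : Type u} (a : V) (z : FormalSum V) : nilPart (consMap a z) = 0 := by
  induction z using Finsupp.induction_linear with
  | zero => simp
  | add f g hf hg => simp only [map_add, hf, hg, add_zero]
  | single s n => rw [consMap_single, nilPart_single_cons]

lemma nilPart_fullList {V : Type u} (x : List V) :
    nilPart (fullList x) = if x.length = 1 then Finsupp.single ([] : List V) (1 : ℤ) else 0 := by
  rcases x with _ | ⟨a, _ | ⟨b, t⟩⟩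
  · simp [fullList]
  · simp [fullList, nilPart_single_nil]
  · rw [fullList, map_sub, nilPart_single_cons, nilPart_consMap]
    simp

/-! ### The shuffle product and the full differential -/

lemma shuffleMap_consMap_single {V W : Type u} (a : V) (b : W) (ys : List W) (m : ℕ)
    {z : FormalSum V} (hz : z ∈ Finsupp.supported ℤ ℤ {s : List V | s.length = m}) :
    shuffleMap (consMap a z) (Finsupp.single (b :: ys) 1) =
      consMap (a, b) ((if m = 0 ∧ ys = [] then (z []) • Finsupp.single [] 1 else 0) +
        shuffleMap z (Finsupp.single (b :: ys) 1) +
        (-1 : ℤ) ^ m • shuffleMap (consMap a z) (Finsupp.single ys 1)) := by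
  refine eqOn_supported (shuffleMap.flip (Finsupp.single (b :: ys) 1) ∘ₗ consMap a)
    (consMap (a, b) ∘ₗ ((if m = 0 ∧ ys = [] then
        (Finsupp.lapply []).smulRight (Finsupp.single [] 1) else 0) +
      shuffleMap.flip (Finsupp.single (b :: ys) 1) +
        (-1 : ℤ) ^ m • shuffleMap.flip (Finsupp.single ys 1) ∘ₗ consMap a)) ?_ hz |>.trans ?_
  · rintro s rfl
    by_cases h : s = [] ∧ ys = []
    · obtain ⟨rfl, rfl⟩ := h
      simp [shuffle_cons_cons]
    · simp [shuffle_cons_cons, h]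
  · split_ifs <;> simp

lemma shuffleMap_single_consMap {V W : Type u} (a : V) (b : W) (xs : List V) (m : ℕ)
    {z : FormalSum W} (hz : z ∈ Finsupp.supported ℤ ℤ {s : List W | s.length = m}) :
    shuffleMap (Finsupp.single (a :: xs) 1) (consMap b z) =
      consMap (a, b) ((if xs = [] ∧ m = 0 then (z []) • Finsupp.single [] 1 else 0) +
        shuffleMap (Finsupp.single xs 1) (consMap b z) +
        (-1 : ℤ) ^ xs.length • shuffleMap (Finsupp.single (a :: xs) 1) z) := by
  refine eqOn_supported (shuffleMap (Finsupp.single (a :: xs) 1) ∘ₗ consMap b)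
    (consMap (a, b) ∘ₗ ((if xs = [] ∧ m = 0 then
        (Finsupp.lapply []).smulRight (Finsupp.single [] 1) else 0) +
      shuffleMap (Finsupp.single xs 1) ∘ₗ consMap b +
        (-1 : ℤ) ^ xs.length • shuffleMap (Finsupp.single (a :: xs) 1))) ?_ hz |>.trans ?_
  · rintro s rfl
    by_cases h : xs = [] ∧ s = []
    · obtain ⟨rfl, rfl⟩ := h
      simp [shuffle_cons_cons]
    · simp [shuffle_cons_cons, h]
  · split_ifs <;> simp

lemma shuffleMap_single_nil_left {V W : Type u} (z : FormalSum W) :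
    shuffleMap (Finsupp.single ([] : List V) 1) z = 0 := by
  have : shuffleMap (Finsupp.single ([] : List V) 1) = (0 : FormalSum W →ₗ[ℤ] _) := by
    ext y; simp [shuffle_nil_left]
  rw [this]; rfl

lemma shuffleMap_single_nil_right {V W : Type u} (z : FormalSum V) :
    shuffleMap z (Finsupp.single ([] : List W) 1) = 0 := by
  have : shuffleMap.flip (Finsupp.single ([] : List W) 1) = (0 : FormalSum V →ₗ[ℤ] _) := by
    ext y; simp [shuffle_nil_right]
  exact LinearMap.congr_fun this z

lemma fullList_nil_apply {V : Type u} (x : List V) :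
    (fullList x) [] = if x.length = 1 then 1 else 0 := by
  have h := DFunLike.congr_fun (nilPart_fullList x) []
  simp only [nilPart, LinearMap.comp_apply, Finsupp.lsingle_apply, Finsupp.lapply_apply,
    Finsupp.single_eq_same] at h
  rw [h]
  split_ifs <;> simp

/-- The Leibniz rule for the shuffle product and the full differential. The last term appears
because the boundary of a list with one entry is the empty list. -/
lemma fullMap_shuffle {V W : Type u} (x : List V) (y : List W) :
    fullMap (shuffle x y) = shuffleMap (fullList x) (Finsupp.single y 1) +
      (-1 : ℤ) ^ (x.length + 1) • shuffleMap (Finsupp.single x 1) (fullList y) +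
      if x.length = 1 ∧ y.length = 1 then Finsupp.single [] 1 else 0 := by
  induction hn : x.length + y.length using Nat.strong_induction_on generalizing x y with
  | _ n ih =>
  rcases x with _ | ⟨a, xs⟩
  · simp [shuffle_nil_left, shuffleMap_single_nil_left, fullList]
  rcases y with _ | ⟨b, ys⟩
  · simp [shuffle_nil_right, shuffleMap_single_nil_right, fullList]
  have h1 := ih (xs.length + (b :: ys).length) (by subst hn; simp) xs (b :: ys) rfl
  have h2 := ih ((a :: xs).length + ys.length) (by subst hn; simp) (a :: xs) ys rfl
  have k1 := shuffleMap_consMap_single a b ys (xs.length - 1) (z := fullList xs)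
    (Finsupp.supported_mono (t := {s : List V | s.length = xs.length - 1})
      (fun s (hs : s.length + 1 = xs.length) => show s.length = xs.length - 1 by omega)
      (fullList_length_mem xs))
  have k2 := shuffleMap_single_consMap a b xs (ys.length - 1) (z := fullList ys)
    (Finsupp.supported_mono (t := {s : List W | s.length = ys.length - 1})
      (fun s (hs : s.length + 1 = ys.length) => show s.length = ys.length - 1 by omega)
      (fullList_length_mem ys))
  have e1 : fullList (a :: xs) = Finsupp.single xs 1 - consMap a (fullList xs) := rfl
  have e2 : fullList (b :: ys) = Finsupp.single ys 1 - consMap b (fullList ys) := rfl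
  rw [e2] at h1
  rw [e1] at h2
  -- The empty list, which appears in `shuffle [a] [b]` behind `(a, b)`, has no boundary.
  have hnil : ∀ (P : Prop) [Decidable P], fullMap (if P then
      Finsupp.single ([] : List (V × W)) 1 else 0) = 0 := by
    intro P _
    split_ifs <;> simp [fullList]
  rw [shuffle_cons_cons, fullMap_consMap, map_add fullMap, map_add fullMap,
    hnil, map_smul fullMap, h1, h2, e1, e2, map_sub shuffleMap,
    LinearMap.sub_apply, LinearMap.sub_apply, map_sub (shuffleMap (Finsupp.single (a :: xs) 1)),
    map_sub (shuffleMap (Finsupp.single xs 1)),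
    k1, k2]
  rcases xs with _ | ⟨c, xs⟩ <;> rcases ys with _ | ⟨d, ys⟩
  · simp [fullList, shuffle_nil_left, shuffle_nil_right]
  · simp [fullList_nil_apply, shuffle_nil_left, shuffleMap_single_nil_left,
      show fullList ([] : List V) = 0 from rfl]
    split_ifs <;> abel
  · simp [fullList_nil_apply, shuffle_nil_right, shuffleMap_single_nil_right,
      show fullList ([] : List W) = 0 from rfl]
    split_ifs <;> abel
  · rcases neg_one_pow_eq_or ℤ xs.length with e | e <;>
      simp [pow_succ, e] <;> abel

/-! ### Sums of tensors of lists -/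

/-- The tensors of formal sums that only involve the pairs of lists in `S`. -/
noncomputable def pairSpan {V W : Type u} (S : Set (List V × List W)) :
    Submodule ℤ (FormalSum V ⊗[ℤ] FormalSum W) :=
  Submodule.span ℤ ((fun p => Finsupp.single p.1 1 ⊗ₜ[ℤ] Finsupp.single p.2 1) '' S)

lemma tmul_mem_pairSpan {V W : Type u} {S : Set (List V × List W)} {x : List V} {y : List W}
    (h : (x, y) ∈ S) :
    (Finsupp.single x 1 ⊗ₜ[ℤ] Finsupp.single y 1 : FormalSum V ⊗[ℤ] FormalSum W) ∈ pairSpan S :=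
  Submodule.subset_span ⟨(x, y), h, rfl⟩

lemma eqOn_pairSpan {V W : Type u} {M : Type*} [AddCommGroup M] {S : Set (List V × List W)}
    (f g : FormalSum V ⊗[ℤ] FormalSum W →ₗ[ℤ] M)
    (h : ∀ x y, (x, y) ∈ S → f (Finsupp.single x 1 ⊗ₜ Finsupp.single y 1) =
      g (Finsupp.single x 1 ⊗ₜ Finsupp.single y 1))
    {z : FormalSum V ⊗[ℤ] FormalSum W} (hz : z ∈ pairSpan S) : f z = g z := by
  refine LinearMap.eqOn_span (f := f) (g := g) ?_ hz
  rintro _ ⟨⟨x, y⟩, hs, rfl⟩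
  exact h x y hs

lemma map_mem_of_mem_pairSpan {V W : Type u} {M : Type*} [AddCommGroup M]
    {S : Set (List V × List W)} {N : Submodule ℤ M} (f : FormalSum V ⊗[ℤ] FormalSum W →ₗ[ℤ] M)
    (h : ∀ x y, (x, y) ∈ S → f (Finsupp.single x 1 ⊗ₜ Finsupp.single y 1) ∈ N)
    {z : FormalSum V ⊗[ℤ] FormalSum W} (hz : z ∈ pairSpan S) : f z ∈ N := by
  have : pairSpan S ≤ N.comap f := by
    rw [pairSpan, Submodule.span_le]
    rintro _ ⟨⟨x, y⟩, hs, rfl⟩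
    exact h x y hs
  exact this hz

lemma pairSpan_mono {V W : Type u} {S T : Set (List V × List W)} (h : S ⊆ T) :
    pairSpan S ≤ pairSpan T :=
  Submodule.span_mono (Set.image_mono h)

/-- The sign `(-1)ᵏ` on tuples `(x₀, …, x_k)`. -/
noncomputable def signMap {V : Type u} : FormalSum V →ₗ[ℤ] FormalSum V :=
  Finsupp.linearCombination ℤ fun x => (-1 : ℤ) ^ (x.length + 1) • Finsupp.single x 1

@[simp] lemma signMap_single {V : Type u} (x : List V) :
    signMap (Finsupp.single x 1) = (-1 : ℤ) ^ (x.length + 1) • Finsupp.single x 1 := by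
  simp [signMap]

/-- The differential of the tensor product of the full complexes. -/
noncomputable def tensorFullMap {V W : Type u} :
    FormalSum V ⊗[ℤ] FormalSum W →ₗ[ℤ] FormalSum V ⊗[ℤ] FormalSum W :=
  TensorProduct.map fullMap LinearMap.id + TensorProduct.map signMap fullMap

lemma tensorFullMap_tmul {V W : Type u} (u : FormalSum V) (v : FormalSum W) :
    tensorFullMap (u ⊗ₜ v) = fullMap u ⊗ₜ[ℤ] v + signMap u ⊗ₜ[ℤ] fullMap v := rfl

/-- Prefixing a vertex to the left factor of a tensor. -/
noncomputable def consLeft {V W : Type u} (a : V) :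
    FormalSum V ⊗[ℤ] FormalSum W →ₗ[ℤ] FormalSum V ⊗[ℤ] FormalSum W :=
  TensorProduct.map (consMap a) LinearMap.id

@[simp] lemma consLeft_tmul {V W : Type u} (a : V) (u : FormalSum V) (v : FormalSum W) :
    consLeft a (u ⊗ₜ v) = consMap a u ⊗ₜ[ℤ] v := rfl

lemma signMap_consMap {V : Type u} (a : V) (z : FormalSum V) :
    signMap (consMap a z) = -consMap a (signMap z) := by
  refine LinearMap.congr_fun (f := signMap ∘ₗ consMap a) (g := -(consMap a ∘ₗ signMap)) ?_ z
  ext x : 2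
  simp [pow_succ]

lemma tensorFullMap_consLeft {V W : Type u} (a : V) (t : FormalSum V ⊗[ℤ] FormalSum W) :
    tensorFullMap (consLeft a t) = t - consLeft a (tensorFullMap t) := by
  induction t with
  | zero => simp
  | add x y hx hy => simp only [map_add, hx, hy]; abel
  | tmul u v =>
    simp only [tensorFullMap_tmul, consLeft_tmul, fullMap_consMap, signMap_consMap,
      TensorProduct.sub_tmul,
      TensorProduct.neg_tmul, map_add]
    abel

/-- The shuffle product as a map on the tensor product. -/
noncomputable def shuffleTensor {V W : Type u} :
    FormalSum V ⊗[ℤ] FormalSum W →ₗ[ℤ] FormalSum (V × W) :=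
  TensorProduct.lift shuffleMap

@[simp] lemma shuffleTensor_tmul {V W : Type u} (u : FormalSum V) (v : FormalSum W) :
    shuffleTensor (u ⊗ₜ v) = shuffleMap u v := rfl

/-! ### The Alexander–Whitney map -/

/-- The Alexander–Whitney map: the sum of the tensors `(x₀, …, x_i) ⊗ (y_i, …, y_k)`. -/
noncomputable def alexanderWhitneyList {V W : Type u} :
    List (V × W) → FormalSum V ⊗[ℤ] FormalSum W
  | [] => 0
  | z :: s => Finsupp.single [z.1] 1 ⊗ₜ Finsupp.single (z.2 :: s.map Prod.snd) 1 +
      consLeft z.1 (alexanderWhitneyList s)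

/-- The linear extension of `alexanderWhitneyList`. -/
noncomputable def alexanderWhitney {V W : Type u} :
    FormalSum (V × W) →ₗ[ℤ] FormalSum V ⊗[ℤ] FormalSum W :=
  Finsupp.linearCombination ℤ alexanderWhitneyList

@[simp] lemma alexanderWhitney_single {V W : Type u} (s : List (V × W)) (n : ℤ) :
    alexanderWhitney (Finsupp.single s n) = n • alexanderWhitneyList s := by
  simp [alexanderWhitney]

lemma alexanderWhitney_consMap {V W : Type u} (z : V × W) (u : FormalSum (V × W)) :
    alexanderWhitney (consMap z u) =
      Finsupp.single [z.1] 1 ⊗ₜ consMap z.2 (mapFormal Prod.snd u) +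
        consLeft z.1 (alexanderWhitney u) := by
  induction u using Finsupp.induction_linear with
  | zero => simp
  | add f g hf hg => simp only [map_add, hf, hg, TensorProduct.tmul_add]; abel
  | single s n =>
    rw [← mul_one n, ← smul_eq_mul, ← Finsupp.smul_single]
    simp only [map_smul, consMap_single, alexanderWhitney_single, mapFormal_single, one_smul,
      alexanderWhitneyList, TensorProduct.tmul_smul, smul_add]

/-- The Alexander–Whitney map commutes with the full differentials up to the two terms in which
one factor is the empty list. -/
lemma tensorFullMap_alexanderWhitneyList {V W : Type u} (s : List (V × W)) :
    tensorFullMap (alexanderWhitneyList s) = alexanderWhitney (fullList s) +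
      Finsupp.single [] 1 ⊗ₜ Finsupp.single (s.map Prod.snd) 1 +
      (-1 : ℤ) ^ (s.length + 1) • Finsupp.single (s.map Prod.fst) 1 ⊗ₜ Finsupp.single [] 1 := by
  induction s with
  | nil => simp [alexanderWhitneyList, fullList]
  | cons z s ih =>
    have h : mapFormal Prod.snd (fullList s) = fullList (s.map Prod.snd) := by
      have := mapFormal_fullMap Prod.snd (Finsupp.single s 1)
      simpa using this
    rw [alexanderWhitneyList, map_add, tensorFullMap_consLeft, ih, fullList, map_sub,
      alexanderWhitney_consMap, h]
    simp only [tensorFullMap_tmul, fullMap_single, signMap_single, fullList, one_smul, map_zero,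
      sub_zero, alexanderWhitney_single, map_add, consLeft_tmul, consMap_single, List.map_cons,
      List.length_cons, List.length_nil, TensorProduct.tmul_sub, map_smul,
      ← TensorProduct.smul_tmul', pow_succ]
    simp
    abel

lemma alexanderWhitneyList_length_mem {V W : Type u} (s : List (V × W)) :
    alexanderWhitneyList s ∈ pairSpan {p : List V × List W |
      p.1 ≠ [] ∧ p.2 ≠ [] ∧ p.1.length + p.2.length = s.length + 1} := by
  induction s with
  | nil => simp [alexanderWhitneyList]
  | cons z s ih =>
    refine Submodule.add_mem _ (tmul_mem_pairSpan (by simp [add_comm, add_left_comm])) ?_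
    refine map_mem_of_mem_pairSpan (consLeft z.1) (fun x y h => ?_) ih
    rw [consLeft_tmul, consMap_single]
    obtain ⟨-, h2, h3⟩ := h
    exact tmul_mem_pairSpan ⟨by simp, h2, by simp at h3 ⊢; omega⟩

/-- The composite of the Alexander–Whitney map and the shuffle product, extended by the identity
of the empty list, is a chain map. -/
lemma fullMap_shuffleTensor_alexanderWhitney {V W : Type u} (u : FormalSum (V × W)) :
    fullMap (shuffleTensor (alexanderWhitney u)) =
      shuffleTensor (alexanderWhitney (fullMap u)) + nilPart (fullMap u) := by
  refine LinearMap.congr_fun (f := fullMap ∘ₗ shuffleTensor ∘ₗ alexanderWhitney)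
    (g := shuffleTensor ∘ₗ alexanderWhitney ∘ₗ fullMap + nilPart ∘ₗ fullMap) ?_ u
  ext s : 2
  simp only [LinearMap.comp_apply, Finsupp.lsingle_apply, alexanderWhitney_single, one_smul,
    LinearMap.add_apply, fullMap_single, nilPart_fullList]
  rcases s with _ | ⟨z, _ | ⟨w, s⟩⟩
  · simp [alexanderWhitneyList, fullList]
  · simp [alexanderWhitneyList, fullList, shuffle_cons_cons, shuffle_nil_left, shuffle_nil_right]
  · have h1 : fullMap (shuffleTensor (alexanderWhitneyList (z :: w :: s))) =
        shuffleTensor (tensorFullMap (alexanderWhitneyList (z :: w :: s))) := by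
      refine eqOn_pairSpan (fullMap ∘ₗ shuffleTensor) (shuffleTensor ∘ₗ tensorFullMap)
        (fun x y h => ?_) (alexanderWhitneyList_length_mem (z :: w :: s))
      obtain ⟨-, -, h⟩ := h
      have : ¬ (x.length = 1 ∧ y.length = 1) := by simp at h; omega
      simp [tensorFullMap_tmul, fullMap_shuffle, this, -Finsupp.smul_single]
    rw [h1, tensorFullMap_alexanderWhitneyList]
    simp only [map_add, map_smul, shuffleTensor_tmul, shuffleMap_single_nil_left,
      shuffleMap_single_nil_right]
    simp

/-! ### The homotopy -/

/-- The homotopy between the identity and the shuffle product of the Alexander–Whitney map. It is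
defined by recursion: all terms in the value at `z :: s` begin with `z`. -/
noncomputable def homotopyList {V W : Type u} : List (V × W) → FormalSum (V × W)
  | [] => 0
  | z :: s => consMap z (shuffleTensor (alexanderWhitneyList (z :: s)) - homotopyList s)

/-- The linear extension of `homotopyList`. -/
noncomputable def homotopyMap {V W : Type u} : FormalSum (V × W) →ₗ[ℤ] FormalSum (V × W) :=
  Finsupp.linearCombination ℤ homotopyList

@[simp] lemma homotopyMap_single {V W : Type u} (s : List (V × W)) (n : ℤ) :
    homotopyMap (Finsupp.single s n) = n • homotopyList s := by
  simp [homotopyMap]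

lemma homotopyMap_consMap {V W : Type u} (z : V × W) (u : FormalSum (V × W)) :
    homotopyMap (consMap z u) =
      consMap z (shuffleTensor (alexanderWhitney (consMap z u)) - homotopyMap u) := by
  refine LinearMap.congr_fun (f := homotopyMap ∘ₗ consMap z)
    (g := consMap z ∘ₗ (shuffleTensor ∘ₗ alexanderWhitney ∘ₗ consMap z - homotopyMap)) ?_ u
  ext s : 2
  simp [homotopyList]

/-- The homotopy formula, with `nilPart` as correction in degree `-1`. It holds because prefixing
`z` is a contraction of the full complex: the boundary of `z :: u` is `u - z :: ∂u`, and the shuffle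
product of the Alexander–Whitney map commutes with `∂`. -/
lemma fullMap_homotopyList {V W : Type u} (s : List (V × W)) :
    fullMap (homotopyList s) + homotopyMap (fullList s) =
      shuffleTensor (alexanderWhitneyList s) - Finsupp.single s 1 +
        nilPart (Finsupp.single s 1) := by
  induction s with
  | nil => simp [homotopyList, fullList, alexanderWhitneyList, nilPart_single_nil]
  | cons z s ih =>
    have h1 := fullMap_shuffleTensor_alexanderWhitney (Finsupp.single (z :: s) (1 : ℤ))
    simp only [alexanderWhitney_single, one_smul, fullMap_single, fullList, map_sub,
      nilPart_consMap, sub_zero] at h1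
    rw [homotopyList, fullMap_consMap, map_sub fullMap, h1, fullList, map_sub homotopyMap,
      homotopyMap_consMap, nilPart_single_cons, homotopyMap_single, one_smul]
    have h2 := congrArg (consMap z) ih
    simp only [map_add, map_sub, consMap_single] at h2 ⊢
    rw [← sub_eq_zero] at h2 ⊢
    refine Eq.trans ?_ h2
    abel

/-! ### Lengths and repetitions -/

lemma listLength_cons_le_cons_cons {V : Type u} (G : SimpleGraph V) (a b : V) (c : List V) :
    listLength G (a :: c) ≤ listLength G (a :: b :: c) := by
  cases c with
  | nil => simp [listLength]
  | cons e t =>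
    simp only [listLength, ← add_assoc]
    gcongr
    exact SimpleGraph.edist_triangle

lemma listLength_le_cons {V : Type u} (G : SimpleGraph V) (a : V) (c : List V) :
    listLength G c ≤ listLength G (a :: c) := by
  cases c with
  | nil => simp [listLength]
  | cons e t => rw [listLength]; exact le_add_self

lemma consMap_mem_supported {V : Type u} {S T : Set (List V)} (a : V)
    (h : ∀ s ∈ S, a :: s ∈ T) {z : FormalSum V} (hz : z ∈ Finsupp.supported ℤ ℤ S) :
    consMap a z ∈ Finsupp.supported ℤ ℤ T :=
  map_mem_supported _ (fun s hs => by rw [consMap_single]; exact single_mem (h s hs) _) hz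

lemma consLeft_mem_pairSpan {V W : Type u} {S T : Set (List V × List W)} (a : V)
    (h : ∀ p ∈ S, (a :: p.1, p.2) ∈ T) {z : FormalSum V ⊗[ℤ] FormalSum W} (hz : z ∈ pairSpan S) :
    consLeft a z ∈ pairSpan T :=
  map_mem_of_mem_pairSpan _ (fun x y hs => by
    rw [consLeft_tmul, consMap_single]; exact tmul_mem_pairSpan (h _ hs)) hz

lemma single_tmul_mem_pairSpan {V W : Type u} {S : Set (List W)} {T : Set (List V × List W)}
    (x : List V) (h : ∀ y ∈ S, (x, y) ∈ T) {z : FormalSum W} (hz : z ∈ Finsupp.supported ℤ ℤ S) :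
    (Finsupp.single x 1 ⊗ₜ[ℤ] z : FormalSum V ⊗[ℤ] FormalSum W) ∈ pairSpan T := by
  have h1 : Finsupp.supported ℤ ℤ S ≤
      (pairSpan T).comap (TensorProduct.mk ℤ (FormalSum V) (FormalSum W) (Finsupp.single x 1)) := by
    rw [Finsupp.supported_eq_span_single, Submodule.span_le]
    rintro _ ⟨y, hy, rfl⟩
    exact tmul_mem_pairSpan (h y hy)
  exact h1 hz

lemma fullList_length_cons_mem {V : Type u} (G : SimpleGraph V) (a : V) (x : List V) :
    fullList x ∈ Finsupp.supported ℤ ℤ {s | listLength G (a :: s) ≤ listLength G (a :: x)} := by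
  induction x generalizing a with
  | nil => simp [fullList]
  | cons b c ih =>
    refine Submodule.sub_mem _ (single_mem
      (A := {s | listLength G (a :: s) ≤ listLength G (a :: b :: c)})
      (listLength_cons_le_cons_cons G a b c) _)
      (consMap_mem_supported b (fun s hs => ?_) (ih b))
    simp only [Set.mem_ofPred_eq, listLength] at hs ⊢
    gcongr

/-- Deleting an entry does not increase the length. -/
lemma fullList_listLength_mem {V : Type u} (G : SimpleGraph V) (x : List V) :
    fullList x ∈ Finsupp.supported ℤ ℤ {s | listLength G s ≤ listLength G x} := by
  cases x with
  | nil => simp [fullList]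
  | cons a c =>
    exact Submodule.sub_mem _ (single_mem
      (A := {s | listLength G s ≤ listLength G (a :: c)}) (listLength_le_cons G a c) _)
      (consMap_mem_supported a (fun s hs => hs) (fullList_length_cons_mem G a c))

lemma not_isChain_cons {V : Type u} (a : V) {s : List V} (h : ¬ s.IsChain (· ≠ ·)) :
    ¬ (a :: s).IsChain (· ≠ ·) := by
  cases s with
  | nil => simp at h
  | cons b t => exact fun h' => h (List.isChain_cons_cons.1 h').2

lemma not_isChain_cons_self {V : Type u} (a : V) (s : List V) :
    ¬ (a :: a :: s).IsChain (· ≠ ·) :=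
  fun h => (List.isChain_cons_cons.1 h).1 rfl

lemma not_isChain_cons_iff {V : Type u} (a : V) (s : List V) :
    ¬ (a :: s).IsChain (· ≠ ·) ↔ ¬ s.IsChain (· ≠ ·) ∨ ∃ t, s = a :: t := by
  constructor
  · intro h
    by_contra! h'
    refine h ?_
    cases s with
    | nil => simp
    | cons b t => exact List.isChain_cons_cons.2 ⟨fun hab => h'.2 t (by rw [hab]), h'.1⟩
  · rintro (h | ⟨t, rfl⟩)
    · exact not_isChain_cons a h
    · exact not_isChain_cons_self a t

lemma not_isChain_map {V W : Type u} (f : V → W) {s : List V} (h : ¬ s.IsChain (· ≠ ·)) :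
    ¬ (s.map f).IsChain (· ≠ ·) := fun h' =>
  h (((List.isChain_map f).1 h').imp fun _ _ hab e => hab (congrArg f e))

/-- The full differential preserves the sums of lists with two equal neighbours. -/
lemma fullList_not_isChain_mem {V : Type u} (x : List V) (h : ¬ x.IsChain (· ≠ ·)) :
    fullList x ∈ Finsupp.supported ℤ ℤ {s | ¬ s.IsChain (· ≠ ·)} := by
  induction x with
  | nil => simp at h
  | cons a t ih =>
    rcases (not_isChain_cons_iff a t).1 h with h | ⟨t, rfl⟩
    · exact Submodule.sub_mem _ (single_mem h _)
        (consMap_mem_supported a (fun s hs => not_isChain_cons a hs) (ih h))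
    · have e : fullList (a :: a :: t) = consMap a (consMap a (fullList t)) := by
        simp [fullList]
      rw [e]
      refine consMap_mem_supported a (S := {s | ∃ t, s = a :: t}) ?_
        (consMap_mem_supported a (S := Set.univ) (T := {s | ∃ t, s = a :: t})
          (fun s _ => ⟨s, rfl⟩) (by simp))
      rintro _ ⟨s, rfl⟩
      exact not_isChain_cons_self a s

/-- The right factor of `(x₀, …, x_i) ⊗ (y_i, …, y_k)` is not too long even with `y₀` put in front
of it. The induction on the list needs this stronger bound. -/
lemma alexanderWhitneyList_listLength_cons_mem {V W : Type u} (G : SimpleGraph V)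
    (H : SimpleGraph W) (z : V × W) (s : List (V × W)) :
    alexanderWhitneyList (z :: s) ∈ pairSpan {p | (∃ x, p.1 = z.1 :: x) ∧ p.2 ≠ [] ∧
      p.1.length + p.2.length = s.length + 2 ∧ listLength G p.1 +
        listLength H (z.2 :: p.2) ≤ listLength (G □ H) (z :: s)} := by
  have hsnd : ∀ (z : V × W) (s : List (V × W)),
      listLength H (z.2 :: s.map Prod.snd) ≤ listLength (G □ H) (z :: s) := by
    intro z s
    induction s generalizing z with
    | nil => simp [listLength]
    | cons w s ih =>
      rw [List.map_cons, listLength, listLength]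
      exact add_le_add (by simp) (ih w)
  induction s generalizing z with
  | nil =>
    rw [alexanderWhitneyList]
    exact Submodule.add_mem _ (tmul_mem_pairSpan (by simp [listLength]))
      (by simp [alexanderWhitneyList])
  | cons w s ih =>
    rw [alexanderWhitneyList]
    refine Submodule.add_mem _ (tmul_mem_pairSpan
        ⟨⟨_, rfl⟩, by simp, by simp [add_comm, add_left_comm], ?_⟩)
      (consLeft_mem_pairSpan z.1 ?_ (ih w))
    · have := hsnd z (w :: s)
      simpa [listLength] using this
    · rintro ⟨x, y⟩ ⟨⟨x', rfl⟩, hy, hk, h⟩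
      refine ⟨⟨_, rfl⟩, hy, by simp at hk ⊢; omega, ?_⟩
      obtain ⟨b, y, rfl⟩ := List.exists_cons_of_ne_nil hy
      simp only [listLength] at h ⊢
      have ht : H.edist z.2 b ≤ H.edist z.2 w.2 + H.edist w.2 b := SimpleGraph.edist_triangle
      calc G.edist z.1 w.1 + listLength G (w.1 :: x') + (H.edist z.2 b + listLength H (b :: y))
          ≤ G.edist z.1 w.1 + listLength G (w.1 :: x') +
            (H.edist z.2 w.2 + H.edist w.2 b + listLength H (b :: y)) := by gcongr
        _ = (G.edist z.1 w.1 + H.edist z.2 w.2) +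
            (listLength G (w.1 :: x') + (H.edist w.2 b + listLength H (b :: y))) := by abel
        _ ≤ (G □ H).edist z w + listLength (G □ H) (w :: s) := by
            refine add_le_add ?_ h
            simp

/-- The tensors in the Alexander–Whitney map are not longer than the list that they come from. -/
lemma alexanderWhitneyList_listLength_mem {V W : Type u} (G : SimpleGraph V)
    (H : SimpleGraph W) (s : List (V × W)) :
    alexanderWhitneyList s ∈ pairSpan {p | p.1 ≠ [] ∧ p.2 ≠ [] ∧
      p.1.length + p.2.length = s.length + 1 ∧
      listLength G p.1 + listLength H p.2 ≤ listLength (G □ H) s} := by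
  cases s with
  | nil => simp [alexanderWhitneyList]
  | cons z s =>
    refine pairSpan_mono ?_ (alexanderWhitneyList_listLength_cons_mem G H z s)
    rintro ⟨_, y⟩ ⟨⟨x, rfl⟩, hy, hk, h⟩
    exact ⟨by simp, hy, by simpa using hk,
      (add_le_add le_rfl (listLength_le_cons H z.2 y)).trans h⟩

lemma shuffle_cons_cons_mem {V W : Type u} (a : V) (xs : List V) (b : W) (ys : List W) :
    shuffle (a :: xs) (b :: ys) ∈ Finsupp.supported ℤ ℤ {s | ∃ t, s = (a, b) :: t} :=
  Finsupp.supported_mono (fun _ hs => hs.1) (shuffle_length ⊥ ⊥ a xs b ys)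

/-- The shuffle product of degenerate lists is degenerate. -/
lemma shuffle_not_isChain_mem {V W : Type u} (x : List V) (y : List W)
    (h : ¬ x.IsChain (· ≠ ·) ∨ ¬ y.IsChain (· ≠ ·)) :
    shuffle x y ∈ Finsupp.supported ℤ ℤ {s | ¬ s.IsChain (· ≠ ·)} := by
  induction hn : x.length + y.length using Nat.strong_induction_on generalizing x y with
  | _ n ih =>
  rcases x with _ | ⟨a, xs⟩
  · simp [shuffle_nil_left]
  rcases y with _ | ⟨b, ys⟩
  · simp [shuffle_nil_right]
  have hstart : ∀ xs ys, consMap (a, b) (shuffle (a :: xs) (b :: ys)) ∈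
      Finsupp.supported ℤ ℤ {s : List (V × W) | ¬ s.IsChain (· ≠ ·)} := fun xs ys => by
    refine consMap_mem_supported _ ?_ (shuffle_cons_cons_mem a xs b ys)
    rintro _ ⟨t, rfl⟩
    exact not_isChain_cons_self _ _
  have hcons : ∀ x y, (¬ x.IsChain (· ≠ ·) ∨ ¬ y.IsChain (· ≠ ·)) →
      x.length + y.length < n → consMap (a, b) (shuffle x y) ∈
      Finsupp.supported ℤ ℤ {s : List (V × W) | ¬ s.IsChain (· ≠ ·)} := fun x y hxy hl =>
    consMap_mem_supported _ (fun s hs => not_isChain_cons _ hs) (ih _ hl x y hxy rfl)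
  simp only [List.length_cons] at hn
  rw [shuffle_cons_cons, map_add, map_add, map_smul]
  refine Submodule.add_mem _ (Submodule.add_mem _ ?_ ?_) (Submodule.smul_mem _ _ ?_)
  · rw [if_neg]
    · simp
    · rintro ⟨rfl, rfl⟩
      simp at h
  · rcases h with h | h
    · rcases (not_isChain_cons_iff a xs).1 h with h | ⟨t, rfl⟩
      · exact hcons _ _ (Or.inl h) (by simp; omega)
      · exact hstart _ _
    · exact hcons _ _ (Or.inr h) (by simp; omega)
  · rcases h with h | h
    · exact hcons _ _ (Or.inl h) (by simp; omega)
    · rcases (not_isChain_cons_iff b ys).1 h with h | ⟨t, rfl⟩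
      · exact hcons _ _ (Or.inr h) (by simp; omega)
      · exact hstart _ _

lemma shuffleTensor_alexanderWhitneyList_listLength_cons_mem {V W : Type u} (G : SimpleGraph V)
    (H : SimpleGraph W) (z : V × W) (s : List (V × W)) :
    shuffleTensor (alexanderWhitneyList (z :: s)) ∈ Finsupp.supported ℤ ℤ
      {t | listLength (G □ H) (z :: t) ≤ listLength (G □ H) (z :: s)} := by
  refine map_mem_of_mem_pairSpan shuffleTensor (fun x y hxy => ?_)
    (alexanderWhitneyList_listLength_cons_mem G H z s)
  obtain ⟨⟨x, rfl⟩, hy, -, h⟩ := hxy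
  obtain ⟨b, y, rfl⟩ := List.exists_cons_of_ne_nil hy
  rw [shuffleTensor_tmul, shuffleMap_single, mul_one, one_smul]
  refine Finsupp.supported_mono ?_ (shuffle_length G H z.1 x b y)
  rintro _ ⟨⟨t, rfl⟩, h1, -⟩
  simp only [Set.mem_ofPred_eq]
  refine le_trans (le_of_eq ?_) h
  rw [listLength, h1, listLength]
  simp
  abel

lemma homotopyList_listLength_cons_mem {V W : Type u} (G : SimpleGraph V)
    (H : SimpleGraph W) (z : V × W) (s : List (V × W)) :
    homotopyList s ∈ Finsupp.supported ℤ ℤ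
      {t | listLength (G □ H) (z :: t) ≤ listLength (G □ H) (z :: s)} := by
  induction s generalizing z with
  | nil => simp [homotopyList]
  | cons w s ih =>
    refine consMap_mem_supported w (fun t ht => ?_) (Submodule.sub_mem _
      (shuffleTensor_alexanderWhitneyList_listLength_cons_mem G H w s) (ih w))
    simp only [Set.mem_ofPred_eq, listLength] at ht ⊢
    gcongr

/-- The homotopy does not increase lengths. -/
lemma homotopyList_listLength_mem {V W : Type u} (G : SimpleGraph V)
    (H : SimpleGraph W) (s : List (V × W)) :
    homotopyList s ∈ Finsupp.supported ℤ ℤ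
      {t | listLength (G □ H) t ≤ listLength (G □ H) s} := by
  cases s with
  | nil => simp [homotopyList]
  | cons w s =>
    exact consMap_mem_supported w (fun t ht => ht) (Submodule.sub_mem _
      (shuffleTensor_alexanderWhitneyList_listLength_cons_mem G H w s)
      (homotopyList_listLength_cons_mem G H w s))

/-! ### The Alexander–Whitney map is a left inverse of the shuffle product -/

lemma mapFormal_snd_shuffle_singleton {V W : Type u} (a : V) (y : List W) (hy : y ≠ []) :
    mapFormal (Prod.snd : V × W → W) (shuffle [a] y) = Finsupp.single y 1 := by
  induction y with
  | nil => exact absurd rfl hy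
  | cons b ys ih =>
    rw [shuffle_cons_cons, mapFormal_consMap]
    cases ys with
    | nil => simp [shuffle_nil_left, shuffle_nil_right]
    | cons c ys => simp [shuffle_nil_left, ih]

lemma mapFormal_snd_shuffle_mem {V W : Type u} (x : List V) (b : W) (ys : List W) :
    mapFormal (Prod.snd : V × W → W) (shuffle x (b :: ys)) ∈
      Finsupp.supported ℤ ℤ {s | ∃ t, s = b :: t} := by
  cases x with
  | nil => simp [shuffle_nil_left]
  | cons a xs =>
    refine map_mem_supported _ ?_ (shuffle_cons_cons_mem a xs b ys)
    rintro _ ⟨t, rfl⟩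
    rw [mapFormal_single]
    exact single_mem (A := {s | ∃ t, s = b :: t}) ⟨_, rfl⟩ _

/-- A path that moves in the first direction has two equal neighbours in its second projection. -/
lemma mapFormal_snd_shuffle_not_isChain_mem {V W : Type u} (a c : V) (xs : List V) (y : List W) :
    mapFormal (Prod.snd : V × W → W) (shuffle (a :: c :: xs) y) ∈
      Finsupp.supported ℤ ℤ {s | ¬ s.IsChain (· ≠ ·)} := by
  induction y with
  | nil => simp [shuffle_nil_right]
  | cons b ys ih =>
    rw [shuffle_cons_cons, mapFormal_consMap, if_neg (by simp), zero_add, map_add, map_add,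
      map_smul, map_smul]
    refine Submodule.add_mem _ (consMap_mem_supported _ ?_ (mapFormal_snd_shuffle_mem _ _ _))
      (Submodule.smul_mem _ _ (consMap_mem_supported _ (fun s hs => not_isChain_cons _ hs) ih))
    rintro _ ⟨t, rfl⟩
    exact not_isChain_cons_self _ _

/-- The Alexander–Whitney map takes the shuffle product of `x` and `y` to `x ⊗ y`, up to tensors in
which one of the lists has two equal neighbours. -/
lemma alexanderWhitney_shuffle {V W : Type u} (x : List V) (y : List W) (hx : x ≠ [])
    (hy : y ≠ []) : alexanderWhitney (shuffle x y) - Finsupp.single x 1 ⊗ₜ Finsupp.single y 1 ∈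
      pairSpan {p | ¬ p.1.IsChain (· ≠ ·) ∨ ¬ p.2.IsChain (· ≠ ·)} := by
  induction hn : x.length + y.length using Nat.strong_induction_on generalizing x y with
  | _ n ih =>
  obtain ⟨a, xs, rfl⟩ := List.exists_cons_of_ne_nil hx
  obtain ⟨b, ys, rfl⟩ := List.exists_cons_of_ne_nil hy
  set D : Submodule ℤ (FormalSum V ⊗[ℤ] FormalSum W) :=
    pairSpan {p | ¬ p.1.IsChain (· ≠ ·) ∨ ¬ p.2.IsChain (· ≠ ·)} with hD
  have hcons : ∀ {t}, t ∈ D → consLeft a t ∈ D := fun ht => by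
    refine consLeft_mem_pairSpan a ?_ ht
    rintro p (hp | hp)
    · exact Or.inl (not_isChain_cons _ hp)
    · exact Or.inr hp
  -- the path starts in the second direction, so that the left factor begins with `a, a`
  have hleft : ys ≠ [] → consLeft a (alexanderWhitney (shuffle (a :: xs) ys)) ∈ D := fun hys => by
    have h1 := hcons (ih _ (by simp at hn ⊢; omega) (a :: xs) ys (by simp) hys rfl)
    rw [map_sub, consLeft_tmul, consMap_single] at h1
    exact (Submodule.sub_mem_iff_left _
      (tmul_mem_pairSpan (Or.inl (not_isChain_cons_self a xs)))).1 h1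
  -- the path starts in the first direction, so that the right factor begins with `b, b`
  have hright : (Finsupp.single [a] 1 ⊗ₜ
      consMap b (mapFormal (Prod.snd : V × W → W) (shuffle xs (b :: ys))) :
      FormalSum V ⊗[ℤ] FormalSum W) ∈ D := by
    refine single_tmul_mem_pairSpan (S := {s | ¬ s.IsChain (· ≠ ·)}) _ (fun y h => Or.inr h) ?_
    refine consMap_mem_supported _ ?_ (mapFormal_snd_shuffle_mem xs b ys)
    rintro _ ⟨t, rfl⟩
    exact not_isChain_cons_self _ _
  have hmain : xs ≠ [] → consLeft a (alexanderWhitney (shuffle xs (b :: ys))) -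
      Finsupp.single (a :: xs) 1 ⊗ₜ Finsupp.single (b :: ys) 1 ∈ D := fun hxs => by
    have h1 := hcons (ih _ (by simp at hn ⊢; omega) xs (b :: ys) hxs (by simp) rfl)
    rwa [map_sub, consLeft_tmul, consMap_single] at h1
  rw [shuffle_cons_cons, alexanderWhitney_consMap]
  rcases xs with _ | ⟨c, xs⟩ <;> rcases ys with _ | ⟨d, ys⟩
  · simp [shuffle_nil_left, shuffle_nil_right, alexanderWhitneyList]
  · have := hleft (by simp)
    simpa [shuffle_nil_left, mapFormal_snd_shuffle_singleton] using this
  · have := Submodule.add_mem _ hright (hmain (by simp))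
    simpa [shuffle_nil_right, add_sub_assoc] using this
  · have h1 : (Finsupp.single [a] 1 ⊗ₜ consMap b (mapFormal (Prod.snd : V × W → W)
        (shuffle (a :: c :: xs) (d :: ys))) : FormalSum V ⊗[ℤ] FormalSum W) ∈ D :=
      single_tmul_mem_pairSpan (S := {s | ¬ s.IsChain (· ≠ ·)}) _ (fun y h => Or.inr h)
        (consMap_mem_supported _ (fun s hs => not_isChain_cons _ hs)
          (mapFormal_snd_shuffle_not_isChain_mem a c xs (d :: ys)))
    have := Submodule.add_mem _ (Submodule.add_mem _ hright (hmain (by simp)))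
      (Submodule.smul_mem _ ((-1 : ℤ) ^ (c :: xs).length)
        (Submodule.add_mem _ h1 (hleft (by simp))))
    simp only [reduceCtorEq, false_and, if_false, zero_add, map_add, map_smul,
      TensorProduct.tmul_add, TensorProduct.tmul_smul]
    convert this using 1
    rw [smul_add]
    abel

/-! ### Naturality -/

lemma mapFormal_shuffle {V W V' W' : Type u} (f : V → V') (g : W → W') (x : List V) (y : List W) :
    mapFormal (Prod.map f g) (shuffle x y) = shuffle (x.map f) (y.map g) := by
  induction hn : x.length + y.length using Nat.strong_induction_on generalizing x y with
  | _ n ih =>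
  rcases x with _ | ⟨a, xs⟩
  · simp [shuffle_nil_left]
  rcases y with _ | ⟨b, ys⟩
  · simp [shuffle_nil_right]
  simp only [List.length_cons] at hn
  rw [shuffle_cons_cons, mapFormal_consMap, map_add (mapFormal _),
    map_add (mapFormal _), map_smul (mapFormal _),
    ih _ (by simp; omega) xs (b :: ys) rfl, ih _ (by simp; omega) (a :: xs) ys rfl, List.map_cons,
    List.map_cons, shuffle_cons_cons]
  congr 3
  · simp only [List.map_eq_nil_iff, apply_ite (mapFormal (Prod.map f g)), mapFormal_single,
      List.map_nil, map_zero]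
  · simp

lemma alexanderWhitney_mapFormal {V W V' W' : Type u} (f : V → V') (g : W → W')
    (z : FormalSum (V × W)) :
    alexanderWhitney (mapFormal (Prod.map f g) z) =
      TensorProduct.map (mapFormal f) (mapFormal g) (alexanderWhitney z) := by
  have hcons : ∀ (a : V) (t : FormalSum V ⊗[ℤ] FormalSum W),
      TensorProduct.map (mapFormal f) (mapFormal g) (consLeft a t) =
        consLeft (f a) (TensorProduct.map (mapFormal f) (mapFormal g) t) := by
    intro a t
    induction t with
    | zero => simp
    | add x y hx hy => simp only [map_add, hx, hy]
    | tmul u v => simp [mapFormal_consMap]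
  have hlist : ∀ s : List (V × W), alexanderWhitneyList (s.map (Prod.map f g)) =
      TensorProduct.map (mapFormal f) (mapFormal g) (alexanderWhitneyList s) := by
    intro s
    induction s with
    | nil => simp [alexanderWhitneyList]
    | cons z s ih =>
      rw [List.map_cons, alexanderWhitneyList, alexanderWhitneyList, map_add, hcons, ← ih]
      simp [Function.comp_def]
  induction z using Finsupp.induction_linear with
  | zero => simp
  | add u v hu hv => simp only [map_add, hu, hv]
  | single s n => simp [hlist]

/-! ### From formal sums of lists to chains -/

/-- The chain in `MC_{k,l}(G)` given by a formal sum of lists: the lists that are not generators of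
`MC_{k,l}(G)` are replaced by `0`. -/
noncomputable def fromFormal {V : Type u} (G : SimpleGraph V) (k l : ℕ) :
    FormalSum V →ₗ[ℤ] Chains G k l :=
  Finsupp.linearCombination ℤ fun s =>
    if h : s.length = k + 1 then basisOrZero G k l fun i => s.get (i.cast h.symm) else 0

lemma fromFormal_ofFn {V : Type u} (G : SimpleGraph V) (k l : ℕ) (x : Fin (k + 1) → V) :
    fromFormal G k l (Finsupp.single (List.ofFn x) 1) = basisOrZero G k l x := by
  rw [fromFormal, Finsupp.linearCombination_single, one_smul, dif_pos (by simp)]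
  congr 1
  ext i
  simp [-List.ofFn_succ]

@[simp] lemma fromFormal_toFormal {V : Type u} (G : SimpleGraph V) (k l : ℕ) (z : Chains G k l) :
    fromFormal G k l (toFormal G k l z) = z := by
  refine LinearMap.congr_fun (f := fromFormal G k l ∘ₗ toFormal G k l) (g := LinearMap.id) ?_ z
  ext1 x
  ext1
  simp only [LinearMap.comp_apply, Finsupp.lsingle_apply, toFormal_single, fromFormal_ofFn,
    LinearMap.id_apply, basisOrZero]
  rw [dif_pos x.2]

lemma fromFormal_of_length_ne {V : Type u} (G : SimpleGraph V) {k : ℕ} (l : ℕ) {s : List V}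
    (h : s.length ≠ k + 1) : fromFormal G k l (Finsupp.single s 1) = 0 := by
  simp [fromFormal, h]

lemma exists_ofFn_eq {V : Type u} {k : ℕ} {s : List V} (h : s.length = k + 1) :
    ∃ x : Fin (k + 1) → V, List.ofFn x = s :=
  ⟨fun i => s.get (i.cast h.symm), List.ext_get (by simp [h]) (by simp [-List.ofFn_succ])⟩

lemma fromFormal_of_not_isGen {V : Type u} (G : SimpleGraph V) (k : ℕ) {l : ℕ} {s : List V}
    (h : ¬ IsGen G l s) : fromFormal G k l (Finsupp.single s 1) = 0 := by
  by_cases hs : s.length = k + 1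
  · obtain ⟨x, rfl⟩ := exists_ofFn_eq hs
    rw [fromFormal_ofFn, basisOrZero, dif_neg (fun h' => h ((isGen_ofFn G l x).2 h'))]
  · exact fromFormal_of_length_ne G l hs

lemma toFormal_fromFormal {V : Type u} (G : SimpleGraph V) (k l : ℕ) {s : List V}
    (h : IsGen G l s) (hs : s.length = k + 1) :
    toFormal G k l (fromFormal G k l (Finsupp.single s 1)) = Finsupp.single s 1 := by
  obtain ⟨x, rfl⟩ := exists_ofFn_eq hs
  rw [fromFormal_ofFn, toFormal_basisOrZero, proj_of_gen G l h]

lemma fromFormal_proj {V : Type u} (G : SimpleGraph V) (k l : ℕ) (z : FormalSum V) :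
    fromFormal G k l (proj G l z) = fromFormal G k l z := by
  refine LinearMap.congr_fun (f := fromFormal G k l ∘ₗ proj G l) (g := fromFormal G k l) ?_ z
  ext1 s
  ext1
  simp only [LinearMap.comp_apply, Finsupp.lsingle_apply]
  by_cases h : IsGen G l s
  · rw [proj_of_gen G l h]
  · rw [proj_of_not G l h, map_zero, fromFormal_of_not_isGen G k h]

lemma fromFormal_eq_zero {V : Type u} (G : SimpleGraph V) (k l : ℕ) {z : FormalSum V}
    (hz : z ∈ Finsupp.supported ℤ ℤ {s | ¬ IsGen G l s}) : fromFormal G k l z = 0 :=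
  eqOn_supported (fromFormal G k l) 0 (fun _ hs => fromFormal_of_not_isGen G k hs) hz

lemma not_isGen_of_not_isChain {V : Type u} (G : SimpleGraph V) (l : ℕ) {s : List V}
    (h : ¬ s.IsChain (· ≠ ·)) : ¬ IsGen G l s := fun h' => h h'.1

lemma fromFormal_toFormal_of_ne {V : Type u} (G : SimpleGraph V) {k l k' l' : ℕ}
    (h : ¬ (k = k' ∧ l = l')) (z : Chains G k l) : fromFormal G k' l' (toFormal G k l z) = 0 := by
  refine eqOn_supported (fromFormal G k' l') 0 (fun s hs => ?_) (toFormal_mem G k l z)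
  by_cases hk : k = k'
  · subst hk
    refine fromFormal_of_not_isGen G k fun h' => h ⟨rfl, ?_⟩
    have := hs.1.2.symm.trans h'.2
    exact_mod_cast this
  · exact fromFormal_of_length_ne G l' (by rw [hs.2]; omega)

/-! ### The boundary and the full differential -/

/-- The full differential is the sum of the differential that keeps the first and the last entry,
and of the two terms in which one of these is deleted. -/
lemma fullList_cons {V : Type u} (a : V) (c : List V) (hc : c ≠ []) :
    fullList (a :: c) = Finsupp.single c 1 + dList (a :: c) +
      (-1 : ℤ) ^ c.length • Finsupp.single (a :: c).dropLast 1 := by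
  induction c generalizing a with
  | nil => exact absurd rfl hc
  | cons b t ih =>
    cases t with
    | nil => simp [fullList, dList, rList, sub_eq_add_neg]
    | cons e t =>
      have h1 := ih b (by simp)
      have h2 : dList (a :: b :: e :: t) = consMap a (rList (b :: e :: t)) := rfl
      have h3 : dList (b :: e :: t) = consMap b (rList (e :: t)) := rfl
      rw [fullList, h1, h2, rList, h3, List.dropLast_cons_cons, List.length_cons (as := e :: t)]
      simp only [map_sub, map_neg, map_add, map_smul, consMap_single, pow_succ, mul_neg, mul_one,
        neg_smul]
      abel

/-- Deleting the last entry of a list without repetitions makes it shorter. -/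
lemma listLength_dropLast_lt {V : Type u} (G : SimpleGraph V) (a b : V) (c : List V)
    (h : (a :: b :: c).IsChain (· ≠ ·)) (hl : listLength G (a :: b :: c) ≠ ⊤) :
    listLength G (a :: b :: c).dropLast < listLength G (a :: b :: c) := by
  induction c generalizing a b with
  | nil =>
    have := edist_pos G (List.isChain_cons_cons.1 h).1
    simpa [listLength] using this
  | cons e t ih =>
    rw [listLength] at hl ⊢
    rw [List.dropLast_cons_cons, List.dropLast_cons_cons, listLength, ← List.dropLast_cons_cons]
    have hl := WithTop.add_ne_top.1 hl
    exact (ENat.add_lt_add_iff_left hl.1).2 (ih b e (List.isChain_cons_cons.1 h).2 hl.2)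

lemma listLength_tail_lt {V : Type u} (G : SimpleGraph V) (a b : V) (c : List V)
    (h : (a :: b :: c).IsChain (· ≠ ·)) (hl : listLength G (a :: b :: c) ≠ ⊤) :
    listLength G (b :: c) < listLength G (a :: b :: c) := by
  have := edist_pos G (List.isChain_cons_cons.1 h).1
  rw [listLength] at hl ⊢
  have h2 := (ENat.add_lt_add_iff_right (WithTop.add_ne_top.1 hl).2).2 this
  rwa [zero_add] at h2

/-- On chains of length `l`, the boundary and the full differential agree modulo shorter lists. -/
lemma dMap_sub_fullMap_mem {V : Type u} (G : SimpleGraph V) (k l : ℕ) (z : Chains G (k + 1) l) :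
    toFormal G k l (boundary G k l z) - fullMap (toFormal G (k + 1) l z) ∈
      Finsupp.supported ℤ ℤ {s | listLength G s < l} := by
  rw [toFormal_boundary]
  refine map_mem_supported (proj G l ∘ₗ dMap - fullMap) ?_ (toFormal_mem G (k + 1) l z)
  rintro s ⟨hs, hk⟩
  obtain ⟨a, s, rfl⟩ := List.exists_cons_of_length_eq_add_one hk
  obtain ⟨b, c, rfl⟩ := List.exists_cons_of_length_eq_add_one (by simpa using hk)
  have hl : listLength G (a :: b :: c) ≠ ⊤ := by rw [hs.2]; simp
  have h1 := proj_sub_mem G l (dList_isSub G _ l hs)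
  have h2 := listLength_tail_lt G a b c hs.1 hl
  have h3 := listLength_dropLast_lt G a b c hs.1 hl
  rw [hs.2] at h2 h3
  simp only [LinearMap.sub_apply, LinearMap.comp_apply, dMap_single, fullMap_single, one_smul]
  rw [fullList_cons a _ (by simp)]
  have e : ∀ P D A B : FormalSum V, P - (A + D + B) = -(D - P) - A - B := by
    intros; abel
  rw [e]
  exact Submodule.sub_mem _ (Submodule.sub_mem _ (Submodule.neg_mem _ h1)
    (single_mem (A := {s | listLength G s < l}) h2 _))
    (Submodule.smul_mem _ _ (single_mem (A := {s | listLength G s < l}) h3 _))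

lemma fullMap_toFormal_mem_of_formalBoundary {V : Type u} (G : SimpleGraph V) (k l : ℕ)
    (z : Chains G k l) (hz : formalBoundary G k l z = 0) :
    fullMap (toFormal G k l z) ∈ Finsupp.supported ℤ ℤ {s | s = [] ∨ listLength G s < l} := by
  cases k with
  | zero =>
    refine map_mem_supported fullMap ?_ (toFormal_mem G 0 l z)
    rintro s ⟨-, hs⟩
    rw [fullMap_single, one_smul]
    refine Finsupp.supported_mono ?_ (fullList_length_mem s)
    intro t ht
    simp only [Set.mem_ofPred_eq, hs] at ht
    exact Or.inl (List.length_eq_zero_iff.1 (by omega))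
  | succ k =>
    rw [formalBoundary_succ] at hz
    have := dMap_sub_fullMap_mem G k l z
    rw [hz, zero_sub, Submodule.neg_mem_iff] at this
    exact Finsupp.supported_mono (fun s hs => Or.inr hs) this

/-- The full differential induces the boundary of chains, on lists that are not too long. -/
lemma fromFormal_fullList {V : Type u} (G : SimpleGraph V) (k l : ℕ) (s : List V)
    (hs : listLength G s ≤ l) : fromFormal G k l (fullList s) =
      boundary G k l (fromFormal G (k + 1) l (Finsupp.single s 1)) := by
  by_cases hk : s.length = k + 1 + 1
  · by_cases h : IsGen G l s
    · have h1 := dMap_sub_fullMap_mem G k l (fromFormal G (k + 1) l (Finsupp.single s 1))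
      rw [toFormal_fromFormal G (k + 1) l h hk, fullMap_single, one_smul] at h1
      have h2 := fromFormal_eq_zero G k l
        (Finsupp.supported_mono (fun s hs => not_isGen_of_lt G hs) h1)
      rw [map_sub, fromFormal_toFormal, sub_eq_zero] at h2
      exact h2.symm
    · rw [fromFormal_of_not_isGen G (k + 1) h, map_zero]
      refine fromFormal_eq_zero G k l ?_
      by_cases hc : s.IsChain (· ≠ ·)
      · have hlt : listLength G s < l := lt_of_le_of_ne hs fun h' => h ⟨hc, h'⟩
        exact Finsupp.supported_mono (fun t ht => not_isGen_of_lt G (lt_of_le_of_lt ht hlt))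
          (fullList_listLength_mem G s)
      · exact Finsupp.supported_mono (fun t ht => not_isGen_of_not_isChain G l ht)
          (fullList_not_isChain_mem s hc)
  · rw [fromFormal_of_length_ne G l hk, map_zero]
    refine eqOn_supported (fromFormal G k l) 0 (fun t ht => ?_) (fullList_length_mem s)
    exact fromFormal_of_length_ne G l (by simp only [Set.mem_ofPred_eq] at ht; omega)

lemma fromFormal_fullMap {V : Type u} (G : SimpleGraph V) (k l : ℕ) {z : FormalSum V}
    (hz : z ∈ Finsupp.supported ℤ ℤ {s | listLength G s ≤ l}) :
    fromFormal G k l (fullMap z) = boundary G k l (fromFormal G (k + 1) l z) :=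
  eqOn_supported (fromFormal G k l ∘ₗ fullMap) (boundary G k l ∘ₗ fromFormal G (k + 1) l)
    (fun s hs => by simpa using fromFormal_fullList G k l s hs) hz

/-- On lists of length at most `l`, applying a map of graphs to all entries induces the map `f_#`:
maps of graphs do not increase lengths and preserve repetitions. -/
lemma fromFormal_map {V W : Type u} {G : SimpleGraph V} {H : SimpleGraph W} (f : GraphMap G H)
    (k l : ℕ) (s : List V) (hs : listLength G s ≤ l) :
    fromFormal H k l (Finsupp.single (s.map f.toFun) 1) =
      inducedChains f k l (fromFormal G k l (Finsupp.single s 1)) := by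
  by_cases hk : s.length = k + 1
  · by_cases h : IsGen G l s
    · obtain ⟨x, rfl⟩ := exists_ofFn_eq hk
      have hx := (isGen_ofFn G l x).1 h
      rw [fromFormal_ofFn, List.map_ofFn, fromFormal_ofFn, basisOrZero, basisOrZero, dif_pos hx]
      simp [inducedChains, basisOrZero, Function.comp_def]
    · rw [fromFormal_of_not_isGen G k h, map_zero]
      refine fromFormal_of_not_isGen H k fun h' => h ?_
      have h1 : listLength G s = l := le_antisymm hs (h'.2 ▸ f.listLength_le s)
      exact ⟨by_contra fun hc => not_isChain_map _ hc h'.1, h1⟩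
  · rw [fromFormal_of_length_ne G l hk, map_zero, fromFormal_of_length_ne H l (by simpa using hk)]

lemma fromFormal_mapFormal {V W : Type u} {G : SimpleGraph V} {H : SimpleGraph W}
    (f : GraphMap G H) (k l : ℕ) {z : FormalSum V}
    (hz : z ∈ Finsupp.supported ℤ ℤ {s | listLength G s ≤ l}) :
    fromFormal H k l (mapFormal f.toFun z) = inducedChains f k l (fromFormal G k l z) :=
  eqOn_supported (fromFormal H k l ∘ₗ mapFormal f.toFun) (inducedChains f k l ∘ₗ fromFormal G k l)
    (fun s hs => by simpa using fromFormal_map f k l s hs) hz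

/-! ### The exterior product and the Alexander–Whitney map on chains -/

lemma listLength_le_of_isGen {V : Type u} (G : SimpleGraph V) (l : ℕ) {z : FormalSum V}
    (hz : z ∈ Finsupp.supported ℤ ℤ {s | IsGen G l s}) :
    z ∈ Finsupp.supported ℤ ℤ {s | listLength G s ≤ l} :=
  Finsupp.supported_mono (fun _ hs => hs.2.le) hz

lemma exteriorChains_eq_fromFormal {V W : Type u} (G : SimpleGraph V) (H : SimpleGraph W)
    {p a q b n l : ℕ} (hn : p + q = n) (x : Chains G p a) (y : Chains H q b) :
    exteriorChains G H p a q b n l x y =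
      fromFormal (G □ H) n l (shuffleMap (toFormal G p a x) (toFormal H q b y)) := by
  rw [← fromFormal_proj, ← toFormal_exteriorChains G H p a q b n l hn, fromFormal_toFormal]

/-- The exterior product commutes with induced maps. -/
lemma inducedChains_exteriorChains {V W V' W' : Type u} {G : SimpleGraph V} {H : SimpleGraph W}
    {G' : SimpleGraph V'} {H' : SimpleGraph W'} (f : GraphMap G G') (g : GraphMap H H')
    {p a q b n l : ℕ} (hn : p + q = n) (hl : a + b = l) (x : Chains G p a) (y : Chains H q b) :
    inducedChains (f.boxProd g) n l (exteriorChains G H p a q b n l x y) =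
      exteriorChains G' H' p a q b n l (inducedChains f p a x) (inducedChains g q b y) := by
  rw [exteriorChains_eq_fromFormal G H hn, exteriorChains_eq_fromFormal G' H' hn,
    ← fromFormal_mapFormal (f.boxProd g) n l
      (listLength_le_of_isGen _ _ (shuffleMap_mem G H p a q b l hl x y)),
    toFormal_inducedChains, toFormal_inducedChains]
  refine eqOn_supported
    (fromFormal (G' □ H') n l ∘ₗ mapFormal (f.boxProd g).toFun ∘ₗ
      shuffleMap.flip (toFormal H q b y))
    (fromFormal (G' □ H') n l ∘ₗ shuffleMap.flip (proj H' b (mapFormal g.toFun (toFormal H q b y)))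
      ∘ₗ proj G' a ∘ₗ mapFormal f.toFun) (fun s hs => ?_) (toFormal_mem G p a x)
  refine eqOn_supported
    (fromFormal (G' □ H') n l ∘ₗ mapFormal (f.boxProd g).toFun ∘ₗ
      shuffleMap (Finsupp.single s 1))
    (fromFormal (G' □ H') n l ∘ₗ shuffleMap (proj G' a (mapFormal f.toFun (Finsupp.single s 1)))
      ∘ₗ proj H' b ∘ₗ mapFormal g.toFun) (fun t ht => ?_) (toFormal_mem H q b y)
  have hmap : mapFormal (f.boxProd g).toFun (shuffle s t) =
      shuffle (s.map f.toFun) (t.map g.toFun) := mapFormal_shuffle f.toFun g.toFun s t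
  simp only [LinearMap.comp_apply, shuffleMap_single, mul_one, one_smul, mapFormal_single, hmap]
  have hs1 := f.isSub a s hs.1
  have ht1 := g.isSub b t ht.1
  by_cases h1 : IsGen G' a (s.map f.toFun)
  · by_cases h2 : IsGen H' b (t.map g.toFun)
    · rw [proj_of_gen _ _ h1, proj_of_gen _ _ h2, shuffleMap_single, mul_one, one_smul]
    · rw [proj_of_not _ _ h2, map_zero, map_zero]
      refine fromFormal_eq_zero _ _ _ (Finsupp.supported_mono (fun u hu => not_isGen_of_lt _ hu)
        (shuffle_lt G' H' l _ _ ?_))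
      rw [h1.2, ← hl]
      push_cast
      exact (ENat.add_lt_add_iff_left (ENat.natCast_ne_top a)).2 (ht1.resolve_left h2)
  · rw [proj_of_not _ _ h1, map_zero, LinearMap.zero_apply, map_zero]
    refine fromFormal_eq_zero _ _ _ (Finsupp.supported_mono (fun u hu => not_isGen_of_lt _ hu)
      (shuffle_lt G' H' l _ _ ?_))
    have h3 : listLength H' (t.map g.toFun) ≤ b := ht.1.2 ▸ g.listLength_le t
    have h4 := hs1.resolve_left h1
    rw [← hl]
    push_cast
    exact lt_of_le_of_lt (add_le_add le_rfl h3)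
      ((ENat.add_lt_add_iff_right (ENat.natCast_ne_top b)).2 h4)

/-- The tensor product of two of the projections `fromFormal`. -/
noncomputable def tensorFromFormal {V W : Type u} (G : SimpleGraph V) (H : SimpleGraph W)
    (p a q b : ℕ) : FormalSum V ⊗[ℤ] FormalSum W →ₗ[ℤ] Chains G p a ⊗[ℤ] Chains H q b :=
  TensorProduct.map (fromFormal G p a) (fromFormal H q b)

lemma tensorFromFormal_tmul {V W : Type u} (G : SimpleGraph V) (H : SimpleGraph W)
    (p a q b : ℕ) (u : FormalSum V) (v : FormalSum W) :
    tensorFromFormal G H p a q b (u ⊗ₜ v) = fromFormal G p a u ⊗ₜ[ℤ] fromFormal H q b v := rfl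

/-- The component `MC_{n,l}(G □ H) ⟶ MC_{p,a}(G) ⊗ MC_{q,b}(H)` of the Alexander–Whitney map. It is
used for `n = p + q` and `l = a + b`. -/
noncomputable def alexanderWhitneyChains {V W : Type u} (G : SimpleGraph V) (H : SimpleGraph W)
    (p a q b n l : ℕ) : Chains (G □ H) n l →ₗ[ℤ] Chains G p a ⊗[ℤ] Chains H q b :=
  tensorFromFormal G H p a q b ∘ₗ alexanderWhitney ∘ₗ
    toFormal (G □ H) n l

lemma alexanderWhitneyChains_apply {V W : Type u} (G : SimpleGraph V) (H : SimpleGraph W)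
    (p a q b n l : ℕ) (z : Chains (G □ H) n l) :
    alexanderWhitneyChains G H p a q b n l z =
      tensorFromFormal G H p a q b (alexanderWhitney (toFormal (G □ H) n l z)) := rfl

lemma lt_or_lt_of_add_lt {a b : ℕ} {c d : ℕ∞} (h : c + d < ((a + b : ℕ) : ℕ∞)) :
    c < a ∨ d < b := by
  by_contra! h'
  push_cast at h
  exact absurd (add_le_add h'.1 h'.2) (not_le.2 h)

lemma le_or_lt_of_add_le {a b : ℕ} {c d : ℕ∞} (h : c + d ≤ ((a + b : ℕ) : ℕ∞)) :
    (c ≤ a ∧ d ≤ b) ∨ c < a ∨ d < b := by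
  by_contra! h'
  obtain ⟨h1, h2, h3⟩ := h'
  have h4 : c ≤ a := by
    by_contra! h5
    refine absurd h (not_le.2 ?_)
    push_cast
    exact lt_of_lt_of_le ((ENat.add_lt_add_iff_right (ENat.natCast_ne_top b)).2 h5)
      (add_le_add le_rfl h3)
  have h5 := h1 h4
  refine absurd h (not_le.2 ?_)
  push_cast
  exact lt_of_lt_of_le ((ENat.add_lt_add_iff_left (ENat.natCast_ne_top a)).2 h5)
      (add_le_add h2 le_rfl)

lemma tensorFromFormal_eq_zero {V W : Type u} (G : SimpleGraph V) (H : SimpleGraph W)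
    (p a q b : ℕ) {t : FormalSum V ⊗[ℤ] FormalSum W}
    (ht : t ∈ pairSpan {s | ¬ IsGen G a s.1 ∨ ¬ IsGen H b s.2}) :
    tensorFromFormal G H p a q b t = 0 := by
  refine eqOn_pairSpan (tensorFromFormal G H p a q b) 0 (fun x y h => ?_) ht
  rw [tensorFromFormal_tmul]
  rcases h with h | h
  · rw [fromFormal_of_not_isGen G p h, TensorProduct.zero_tmul]; rfl
  · rw [fromFormal_of_not_isGen H q h, TensorProduct.tmul_zero]; rfl

lemma alexanderWhitney_mem_of_supported {V W : Type u} {S : Set (List (V × W))}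
    {T : Set (List V × List W)} (h : ∀ s ∈ S, alexanderWhitneyList s ∈ pairSpan T)
    {z : FormalSum (V × W)} (hz : z ∈ Finsupp.supported ℤ ℤ S) :
    alexanderWhitney z ∈ pairSpan T := by
  have h1 : Finsupp.supported ℤ ℤ S ≤ (pairSpan T).comap alexanderWhitney := by
    rw [Finsupp.supported_eq_span_single, Submodule.span_le]
    rintro _ ⟨s, hs, rfl⟩
    simp only [SetLike.mem_coe, Submodule.mem_comap, alexanderWhitney_single, one_smul]
    exact h s hs
  exact h1 hz

lemma alexanderWhitney_toFormal_mem {V W : Type u} (G : SimpleGraph V) (H : SimpleGraph W)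
    (n l : ℕ) (z : Chains (G □ H) n l) : alexanderWhitney (toFormal (G □ H) n l z) ∈
      pairSpan {p : List V × List W | p.1 ≠ [] ∧ p.2 ≠ [] ∧
        p.1.length + p.2.length = n + 2 ∧ listLength G p.1 + listLength H p.2 ≤ l} := by
  refine alexanderWhitney_mem_of_supported (fun s hs => ?_) (toFormal_mem _ _ _ z)
  have := alexanderWhitneyList_listLength_mem G H s
  rwa [hs.2, hs.1.2] at this

lemma tensorFromFormal_alexanderWhitney_of_lt {V W : Type u} (G : SimpleGraph V)
    (H : SimpleGraph W) (p a q b l : ℕ) (hl : a + b = l) {z : FormalSum (V × W)}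
    (hz : z ∈ Finsupp.supported ℤ ℤ {s | listLength (G □ H) s < l}) :
    tensorFromFormal G H p a q b (alexanderWhitney z) = 0 := by
  subst hl
  refine tensorFromFormal_eq_zero G H p a q b (alexanderWhitney_mem_of_supported ?_ hz)
  intro s hs
  refine pairSpan_mono ?_ (alexanderWhitneyList_listLength_mem G H s)
  rintro x ⟨-, -, -, hx⟩
  rcases lt_or_lt_of_add_lt (lt_of_le_of_lt hx hs) with h | h
  · exact Or.inl (not_isGen_of_lt G h)
  · exact Or.inr (not_isGen_of_lt H h)

/-- The two terms of `tensorFullMap_alexanderWhitneyList` with an empty factor do not contribute to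
chains, so that the Alexander–Whitney map commutes with the full differentials. -/
lemma tensorFromFormal_alexanderWhitney_fullMap {V W : Type u} (G : SimpleGraph V)
    (H : SimpleGraph W) (p a q b : ℕ) (z : FormalSum (V × W)) :
    tensorFromFormal G H p a q b (alexanderWhitney (fullMap z)) =
      tensorFromFormal G H p a q b (tensorFullMap (alexanderWhitney z)) := by
  induction z using Finsupp.induction_linear with
  | zero => simp
  | add u v hu hv => simp only [map_add, hu, hv]
  | single s n =>
    simp only [fullMap_single, alexanderWhitney_single, map_smul,
      tensorFullMap_alexanderWhitneyList, map_add, tensorFromFormal_tmul]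
    rw [fromFormal_of_length_ne G a (s := []) (by simp),
      fromFormal_of_length_ne H b (s := []) (by simp)]
    simp

/-- The Alexander–Whitney map is a chain map. -/
lemma alexanderWhitneyChains_boundary {V W : Type u} (G : SimpleGraph V) (H : SimpleGraph W)
    (p a q b n l : ℕ) (hl : a + b = l) (z : Chains (G □ H) (n + 1) l) :
    alexanderWhitneyChains G H p a q b n l (boundary (G □ H) n l z) =
      TensorProduct.map (boundary G p a) LinearMap.id
        (alexanderWhitneyChains G H (p + 1) a q b (n + 1) l z) +
      (-1 : ℤ) ^ p • TensorProduct.map LinearMap.id (boundary H q b)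
        (alexanderWhitneyChains G H p a (q + 1) b (n + 1) l z) := by
  have h1 := tensorFromFormal_alexanderWhitney_of_lt G H p a q b l hl
    (dMap_sub_fullMap_mem (G □ H) n l z)
  rw [map_sub, map_sub, sub_eq_zero, tensorFromFormal_alexanderWhitney_fullMap] at h1
  rw [alexanderWhitneyChains_apply, h1]
  subst hl
  refine eqOn_pairSpan (tensorFromFormal G H p a q b ∘ₗ tensorFullMap)
    (TensorProduct.map (boundary G p a) LinearMap.id ∘ₗ tensorFromFormal G H (p + 1) a q b +
      (-1 : ℤ) ^ p • TensorProduct.map LinearMap.id (boundary H q b) ∘ₗ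
        tensorFromFormal G H p a (q + 1) b) (fun x y hxy => ?_)
    (alexanderWhitney_toFormal_mem G H (n + 1) (a + b) z)
  obtain ⟨-, -, -, hxy⟩ := hxy
  change tensorFromFormal G H p a q b
      (tensorFullMap (Finsupp.single x 1 ⊗ₜ[ℤ] Finsupp.single y 1)) =
    boundary G p a (fromFormal G (p + 1) a (Finsupp.single x 1)) ⊗ₜ[ℤ]
      fromFormal H q b (Finsupp.single y 1) +
    (-1 : ℤ) ^ p • fromFormal G p a (Finsupp.single x 1) ⊗ₜ[ℤ]
      boundary H q b (fromFormal H (q + 1) b (Finsupp.single y 1))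
  have hsign : fromFormal G p a (signMap (Finsupp.single x 1)) =
      (-1 : ℤ) ^ p • fromFormal G p a (Finsupp.single x 1) := by
    rw [signMap_single, map_smul]
    by_cases h : x.length = p + 1
    · rw [h, pow_succ, pow_succ]
      simp
    · rw [fromFormal_of_length_ne G a h, smul_zero, smul_zero]
  have hlt : ∀ {U : Type u} (K : SimpleGraph U) (k c : ℕ) (s : List U), listLength K s < c →
      fromFormal K k c (Finsupp.single s 1) = 0 ∧ fromFormal K k c (fullList s) = 0 := by
    intro U K k c s hs
    exact ⟨fromFormal_of_not_isGen K k (not_isGen_of_lt K hs), fromFormal_eq_zero K k c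
      (Finsupp.supported_mono (fun t ht => not_isGen_of_lt K (lt_of_le_of_lt ht hs))
        (fullList_listLength_mem K s))⟩
  rw [tensorFullMap_tmul, map_add, tensorFromFormal_tmul, tensorFromFormal_tmul, hsign,
    fullMap_single, fullMap_single, one_smul, one_smul, TensorProduct.smul_tmul']
  rcases le_or_lt_of_add_le hxy with ⟨h1, h2⟩ | h | h
  · rw [fromFormal_fullList G p a x h1, fromFormal_fullList H q b y h2]
  · rw [(hlt G p a x h).1, (hlt G p a x h).2, (hlt G (p + 1) a x h).1]
    simp
  · rw [(hlt H q b y h).1, (hlt H q b y h).2, (hlt H (q + 1) b y h).1]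
    simp

/-- The Alexander–Whitney map commutes with induced maps. -/
lemma alexanderWhitneyChains_inducedChains {V W V' W' : Type u} {G : SimpleGraph V}
    {H : SimpleGraph W} {G' : SimpleGraph V'} {H' : SimpleGraph W'} (f : GraphMap G G')
    (g : GraphMap H H') (p a q b n l : ℕ) (hl : a + b = l) (z : Chains (G □ H) n l) :
    alexanderWhitneyChains G' H' p a q b n l (inducedChains (f.boxProd g) n l z) =
      TensorProduct.map (inducedChains f p a) (inducedChains g q b)
        (alexanderWhitneyChains G H p a q b n l z) := by
  have hsub : mapFormal (f.boxProd g).toFun (toFormal (G □ H) n l z) ∈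
      Finsupp.supported ℤ ℤ {s | IsSub (G' □ H') l s} := by
    refine map_mem_supported _ (fun s hs => ?_) (toFormal_mem _ _ _ z)
    rw [mapFormal_single]
    exact single_mem (A := {s | IsSub (G' □ H') l s}) ((f.boxProd g).isSub l s hs.1) _
  have h1 := tensorFromFormal_alexanderWhitney_of_lt G' H' p a q b l hl
    (proj_sub_mem (G' □ H') l hsub)
  rw [map_sub, map_sub, sub_eq_zero] at h1
  have h2 := alexanderWhitney_mapFormal f.toFun g.toFun (toFormal (G □ H) n l z)
  rw [alexanderWhitneyChains_apply, toFormal_inducedChains, ← h1]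
  refine (congrArg (tensorFromFormal G' H' p a q b) h2).trans ?_
  subst hl
  refine eqOn_pairSpan (tensorFromFormal G' H' p a q b ∘ₗ
      TensorProduct.map (mapFormal f.toFun) (mapFormal g.toFun))
    (TensorProduct.map (inducedChains f p a) (inducedChains g q b) ∘ₗ
      tensorFromFormal G H p a q b) (fun x y hxy => ?_)
    (alexanderWhitney_toFormal_mem G H n (a + b) z)
  obtain ⟨-, -, -, hxy⟩ := hxy
  change fromFormal G' p a (mapFormal f.toFun (Finsupp.single x 1)) ⊗ₜ[ℤ]
      fromFormal H' q b (mapFormal g.toFun (Finsupp.single y 1)) =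
    inducedChains f p a (fromFormal G p a (Finsupp.single x 1)) ⊗ₜ[ℤ]
      inducedChains g q b (fromFormal H q b (Finsupp.single y 1))
  have hlt : ∀ {U U' : Type u} {K : SimpleGraph U} {K' : SimpleGraph U'} (e : GraphMap K K')
      (k c : ℕ) (s : List U), listLength K s < c → fromFormal K k c (Finsupp.single s 1) = 0 ∧
        fromFormal K' k c (Finsupp.single (s.map e.toFun) 1) = 0 := by
    intro U U' K K' e k c s hs
    exact ⟨fromFormal_of_not_isGen K k (not_isGen_of_lt K hs),
      fromFormal_of_not_isGen K' k (not_isGen_of_lt K' (lt_of_le_of_lt (e.listLength_le s) hs))⟩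
  rw [mapFormal_single, mapFormal_single]
  rcases le_or_lt_of_add_le hxy with ⟨h1, h2⟩ | h | h
  · rw [fromFormal_map f p a x h1, fromFormal_map g q b y h2]
  · rw [(hlt f p a x h).1, (hlt f p a x h).2]
    simp
  · rw [(hlt g q b y h).1, (hlt g q b y h).2]
    simp

lemma alexanderWhitneyChains_exteriorChains_eq {V W : Type u} (G : SimpleGraph V)
    (H : SimpleGraph W) {p a q b n l : ℕ} (hn : p + q = n) (hl : a + b = l) (p' a' q' b' : ℕ)
    (x : Chains G p a) (y : Chains H q b) :
    alexanderWhitneyChains G H p' a' q' b' n l (exteriorChains G H p a q b n l x y) =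
      fromFormal G p' a' (toFormal G p a x) ⊗ₜ fromFormal H q' b' (toFormal H q b y) := by
  rw [alexanderWhitneyChains_apply, toFormal_exteriorChains G H p a q b n l hn,
    proj_eq_self _ _ (shuffleMap_mem G H p a q b l hl x y)]
  refine eqOn_supported
    (tensorFromFormal G H p' a' q' b' ∘ₗ alexanderWhitney ∘ₗ shuffleMap.flip (toFormal H q b y))
    (((TensorProduct.mk ℤ _ _).flip (fromFormal H q' b' (toFormal H q b y))) ∘ₗ
      fromFormal G p' a') (fun s hs => ?_) (toFormal_mem G p a x)
  refine eqOn_supported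
    (tensorFromFormal G H p' a' q' b' ∘ₗ alexanderWhitney ∘ₗ shuffleMap (Finsupp.single s 1))
    (TensorProduct.mk ℤ _ _ (fromFormal G p' a' (Finsupp.single s 1)) ∘ₗ
      fromFormal H q' b') (fun t ht => ?_) (toFormal_mem H q b y)
  change tensorFromFormal G H p' a' q' b'
      (alexanderWhitney (shuffleMap (Finsupp.single s 1) (Finsupp.single t 1))) =
    tensorFromFormal G H p' a' q' b' (Finsupp.single s 1 ⊗ₜ Finsupp.single t 1)
  rw [shuffleMap_single, mul_one, one_smul, ← sub_eq_zero, ← map_sub]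
  refine tensorFromFormal_eq_zero G H p' a' q' b' (pairSpan_mono ?_ (alexanderWhitney_shuffle s t
    (fun h => by simp [h] at hs) (fun h => by simp [h] at ht)))
  rintro z (hz | hz)
  · exact Or.inl (not_isGen_of_not_isChain G a' hz)
  · exact Or.inr (not_isGen_of_not_isChain H b' hz)

/-- The Alexander–Whitney map is a left inverse of the exterior product. -/
lemma alexanderWhitneyChains_exteriorChains {V W : Type u} (G : SimpleGraph V)
    (H : SimpleGraph W) {p a q b n l : ℕ} (hn : p + q = n) (hl : a + b = l)
    (x : Chains G p a) (y : Chains H q b) :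
    alexanderWhitneyChains G H p a q b n l (exteriorChains G H p a q b n l x y) = x ⊗ₜ y := by
  rw [alexanderWhitneyChains_exteriorChains_eq G H hn hl, fromFormal_toFormal, fromFormal_toFormal]

/-- The exterior product only has one non-zero component under the Alexander–Whitney map. -/
lemma alexanderWhitneyChains_exteriorChains_of_ne {V W : Type u} (G : SimpleGraph V)
    (H : SimpleGraph W) {p a q b n l : ℕ} (hn : p + q = n) (hl : a + b = l) (p' a' q' b' : ℕ)
    (h : ¬ (p = p' ∧ a = a')) (x : Chains G p a) (y : Chains H q b) :
    alexanderWhitneyChains G H p' a' q' b' n l (exteriorChains G H p a q b n l x y) = 0 := by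
  rw [alexanderWhitneyChains_exteriorChains_eq G H hn hl, fromFormal_toFormal_of_ne G h,
    TensorProduct.zero_tmul]

/-! ### The exterior product is surjective up to boundaries -/

instance {k l : ℕ} : Finite (Bidegrees k l) := by
  refine Finite.of_injective (β := (Fin (k + 1) × Fin (l + 1)) × (Fin (k + 1) × Fin (l + 1)))
    (fun d => ((⟨d.1.1.1, by have := d.2.1; omega⟩, ⟨d.1.1.2, by have := d.2.2; omega⟩),
      (⟨d.1.2.1, by have := d.2.1; omega⟩, ⟨d.1.2.2, by have := d.2.2; omega⟩))) ?_
  rintro ⟨⟨⟨p, a⟩, ⟨q, b⟩⟩, h⟩ ⟨⟨⟨p', a'⟩, ⟨q', b'⟩⟩, h'⟩ e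
  simp only [Prod.mk.injEq, Fin.mk.injEq] at e
  obtain ⟨⟨rfl, rfl⟩, rfl, rfl⟩ := e
  rfl

noncomputable instance {k l : ℕ} : Fintype (Bidegrees k l) := Fintype.ofFinite _

/-- The exterior product of chains, as a map on the tensor product. -/
noncomputable def exteriorTensor {V W : Type u} (G : SimpleGraph V) (H : SimpleGraph W)
    (p a q b n l : ℕ) : Chains G p a ⊗[ℤ] Chains H q b →ₗ[ℤ] Chains (G □ H) n l :=
  TensorProduct.lift (exteriorChains G H p a q b n l)

@[simp] lemma exteriorTensor_tmul {V W : Type u} (G : SimpleGraph V) (H : SimpleGraph W)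
    (p a q b n l : ℕ) (x : Chains G p a) (y : Chains H q b) :
    exteriorTensor G H p a q b n l (x ⊗ₜ y) = exteriorChains G H p a q b n l x y := rfl

/-- The shuffle product of two lists whose lengths add up to at most `l`, read as a chain of length
`l`, is the exterior product of the chains that they represent. -/
lemma fromFormal_shuffle {V W : Type u} (G : SimpleGraph V) (H : SimpleGraph W) (n l : ℕ)
    (x : List V) (y : List W) (hx : x ≠ []) (hy : y ≠ []) (hn : x.length + y.length = n + 2)
    (hl : listLength G x + listLength H y ≤ l) :
    fromFormal (G □ H) n l (shuffle x y) = ∑ d : Bidegrees n l,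
      exteriorTensor G H d.1.1.1 d.1.1.2 d.1.2.1 d.1.2.2 n l
        (tensorFromFormal G H d.1.1.1 d.1.1.2 d.1.2.1 d.1.2.2
          (Finsupp.single x 1 ⊗ₜ Finsupp.single y 1)) := by
  by_cases hxy : (x.IsChain (· ≠ ·) ∧ y.IsChain (· ≠ ·)) ∧ listLength G x + listLength H y = l
  · obtain ⟨⟨hcx, hcy⟩, hl'⟩ := hxy
    obtain ⟨a, ha⟩ := ENat.ne_top_iff_exists.1
      (ne_top_of_le_ne_top (ENat.natCast_ne_top l) (hl' ▸ le_self_add) : listLength G x ≠ ⊤)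
    obtain ⟨b, hb⟩ := ENat.ne_top_iff_exists.1
      (ne_top_of_le_ne_top (ENat.natCast_ne_top l) (hl' ▸ le_add_self) : listLength H y ≠ ⊤)
    have hab : a + b = l := by rw [← ha, ← hb] at hl'; exact_mod_cast hl'
    obtain ⟨c, x, rfl⟩ := List.exists_cons_of_ne_nil hx
    obtain ⟨e, y, rfl⟩ := List.exists_cons_of_ne_nil hy
    have hk : x.length + y.length = n := by simp at hn; omega
    rw [Finset.sum_eq_single ⟨((x.length, a), (y.length, b)), hk, hab⟩]
    · rw [tensorFromFormal_tmul, exteriorTensor_tmul, exteriorChains_eq_fromFormal G H hk,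
        toFormal_fromFormal G x.length a ⟨hcx, ha.symm⟩ (by simp),
        toFormal_fromFormal H y.length b ⟨hcy, hb.symm⟩ (by simp), shuffleMap_single, mul_one,
        one_smul]
    · rintro ⟨⟨⟨p, a'⟩, ⟨q, b'⟩⟩, h1, h2⟩ - hne
      simp only at h1 h2 hne ⊢
      rw [tensorFromFormal_tmul]
      by_cases hp : (c :: x).length = p + 1
      · by_cases hg : IsGen G a' (c :: x)
        · refine absurd ?_ hne
          have h3 := ha.trans hg.2
          have h3 : a = a' := by exact_mod_cast h3
          simp only [List.length_cons] at hp
          simp only [Subtype.mk.injEq, Prod.mk.injEq]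
          omega
        · rw [fromFormal_of_not_isGen G p hg, TensorProduct.zero_tmul, map_zero]
      · rw [fromFormal_of_length_ne G a' hp, TensorProduct.zero_tmul, map_zero]
    · simp
  · rw [Finset.sum_eq_zero]
    · refine fromFormal_eq_zero _ _ _ ?_
      by_cases hc : x.IsChain (· ≠ ·) ∧ y.IsChain (· ≠ ·)
      · exact Finsupp.supported_mono (fun s hs => not_isGen_of_lt _ hs)
          (shuffle_lt G H l x y (lt_of_le_of_ne hl fun h => hxy ⟨hc, h⟩))
      · rw [not_and_or] at hc
        exact Finsupp.supported_mono (fun s hs => not_isGen_of_not_isChain _ _ hs)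
          (shuffle_not_isChain_mem x y hc)
    · rintro ⟨⟨⟨p, a⟩, ⟨q, b⟩⟩, h1, h2⟩ -
      simp only at h1 h2 ⊢
      rw [tensorFromFormal_tmul]
      by_cases hgx : IsGen G a x
      · by_cases hgy : IsGen H b y
        · refine absurd ⟨⟨hgx.1, hgy.1⟩, ?_⟩ hxy
          rw [hgx.2, hgy.2, ← h2]
          push_cast
          rfl
        · rw [fromFormal_of_not_isGen H q hgy, TensorProduct.tmul_zero, map_zero]
      · rw [fromFormal_of_not_isGen G p hgx, TensorProduct.zero_tmul, map_zero]

lemma homotopyMap_mem {V W : Type u} {S T : Set (List (V × W))}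
    (h : ∀ s ∈ S, homotopyList s ∈ Finsupp.supported ℤ ℤ T) {z : FormalSum (V × W)}
    (hz : z ∈ Finsupp.supported ℤ ℤ S) : homotopyMap z ∈ Finsupp.supported ℤ ℤ T :=
  map_mem_supported _ (fun s hs => by rw [homotopyMap_single, one_smul]; exact h s hs) hz

/-- A cycle is homologous to the exterior product of its image under the Alexander–Whitney map. -/
lemma exists_boundary_eq_sum_exteriorTensor_sub {V W : Type u} (G : SimpleGraph V)
    (H : SimpleGraph W) (n l : ℕ) (z : Chains (G □ H) n l)
    (hz : formalBoundary (G □ H) n l z = 0) :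
    ∃ e, boundary (G □ H) n l e = (∑ d : Bidegrees n l,
      exteriorTensor G H d.1.1.1 d.1.1.2 d.1.2.1 d.1.2.2 n l
        (alexanderWhitneyChains G H d.1.1.1 d.1.1.2 d.1.2.1 d.1.2.2 n l z)) - z := by
  refine ⟨fromFormal (G □ H) (n + 1) l (homotopyMap (toFormal (G □ H) n l z)), ?_⟩
  have hlen : ∀ {k : ℕ} (u : Chains (G □ H) k l), toFormal (G □ H) k l u ∈
      Finsupp.supported ℤ ℤ {s | listLength (G □ H) s ≤ l} := fun u =>
    Finsupp.supported_mono (fun s hs => hs.1.2.le) (toFormal_mem _ _ _ u)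
  rw [← fromFormal_fullMap (G □ H) n l (homotopyMap_mem
    (T := {s | listLength (G □ H) s ≤ l}) (fun s hs => Finsupp.supported_mono
      (fun t ht => le_trans (b := listLength (G □ H) s) ht hs) (homotopyList_listLength_mem G H s))
    (hlen z))]
  -- the homotopy formula
  have h1 : fullMap (homotopyMap (toFormal (G □ H) n l z)) +
      homotopyMap (fullMap (toFormal (G □ H) n l z)) =
      shuffleTensor (alexanderWhitney (toFormal (G □ H) n l z)) - toFormal (G □ H) n l z +
        nilPart (toFormal (G □ H) n l z) := by
    generalize toFormal (G □ H) n l z = u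
    induction u using Finsupp.induction_linear with
    | zero => simp
    | add u v hu hv =>
      simp only [map_add]
      rw [add_add_add_comm, hu, hv]
      abel
    | single s m =>
      have hm : Finsupp.single s m = m • Finsupp.single s (1 : ℤ) := by simp
      rw [hm]
      simp only [map_smul]
      rw [homotopyMap_single, one_smul, fullMap_single, one_smul, alexanderWhitney_single,
        one_smul, ← smul_add, fullMap_homotopyList, smul_add, smul_sub]
  -- The full boundary of a cycle is a sum of shorter lists, and the homotopy keeps them short.
  have h2 : fromFormal (G □ H) n l (homotopyMap (fullMap (toFormal (G □ H) n l z))) = 0 := by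
    refine fromFormal_eq_zero _ _ _ (homotopyMap_mem ?_
      (fullMap_toFormal_mem_of_formalBoundary (G □ H) n l z hz))
    rintro s (rfl | hs)
    · simp [homotopyList]
    · exact Finsupp.supported_mono (fun t ht => not_isGen_of_lt _ (lt_of_le_of_lt ht hs))
        (homotopyList_listLength_mem G H s)
  have h3 : fromFormal (G □ H) n l (nilPart (toFormal (G □ H) n l z)) = 0 := by
    rw [nilPart, LinearMap.comp_apply, Finsupp.lapply_apply, Finsupp.lsingle_apply,
      ← mul_one (toFormal (G □ H) n l z []), ← smul_eq_mul, ← Finsupp.smul_single, map_smul,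
      fromFormal_of_length_ne _ _ (by simp), smul_zero]
  have h4 : fromFormal (G □ H) n l (shuffleTensor (alexanderWhitney (toFormal (G □ H) n l z))) =
      ∑ d : Bidegrees n l, exteriorTensor G H d.1.1.1 d.1.1.2 d.1.2.1 d.1.2.2 n l
        (alexanderWhitneyChains G H d.1.1.1 d.1.1.2 d.1.2.1 d.1.2.2 n l z) := by
    have hsum : ∀ t : FormalSum V ⊗[ℤ] FormalSum W,
        (∑ d : Bidegrees n l, exteriorTensor G H d.1.1.1 d.1.1.2 d.1.2.1 d.1.2.2 n l ∘ₗ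
          tensorFromFormal G H d.1.1.1 d.1.1.2 d.1.2.1 d.1.2.2) t =
        ∑ d : Bidegrees n l, exteriorTensor G H d.1.1.1 d.1.1.2 d.1.2.1 d.1.2.2 n l
          (tensorFromFormal G H d.1.1.1 d.1.1.2 d.1.2.1 d.1.2.2 t) :=
      fun t => LinearMap.sum_apply _ _ _
    refine (eqOn_pairSpan (fromFormal (G □ H) n l ∘ₗ shuffleTensor) _ (fun x y hxy => ?_)
      (alexanderWhitney_toFormal_mem G H n l z)).trans (hsum _)
    obtain ⟨hx, hy, hk, hl⟩ := hxy
    rw [LinearMap.comp_apply, shuffleTensor_tmul, shuffleMap_single, mul_one, one_smul]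
    exact (fromFormal_shuffle G H n l x y hx hy hk hl).trans (hsum _).symm
  have h5 := congrArg (fromFormal (G □ H) n l) h1
  rw [map_add, h2, map_add, h3, map_sub, h4, fromFormal_toFormal] at h5
  simpa using h5

/-! ### Two-term resolutions -/

section
variable {R : Type} [CommRing R] {A B : ModuleCat.{u} R} (f : A ⟶ B)

/-- The objects of the complex `⋯ ⟶ 0 ⟶ A ⟶ B`. -/
noncomputable def twoTermObj (A B : ModuleCat.{u} R) : ℕ → ModuleCat.{u} R
  | 0 => B
  | 1 => A
  | _ + 2 => ModuleCat.of R PUnit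

/-- The differentials of the complex `⋯ ⟶ 0 ⟶ A ⟶ B`. -/
noncomputable def twoTermD : ∀ n, twoTermObj A B (n + 1) ⟶ twoTermObj A B n
  | 0 => f
  | _ + 1 => 0

/-- The complex `⋯ ⟶ 0 ⟶ A ⟶ B`, with `B` in degree `0`. -/
noncomputable def twoTerm : ChainComplex (ModuleCat.{u} R) ℕ :=
  ChainComplex.of (twoTermObj A B) (twoTermD f) fun _ => Limits.zero_comp

lemma twoTerm_d_one : (twoTerm f).d 1 0 = f :=
  ChainComplex.of_d (X := twoTermObj A B) (twoTermD f) 0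

instance twoTerm_subsingleton (n : ℕ) : Subsingleton ((twoTerm f).X (n + 2)) :=
  inferInstanceAs (Subsingleton PUnit)

lemma twoTerm_d_two : (twoTerm f).d 2 1 = 0 := by
  ext x
  obtain rfl : x = 0 := Subsingleton.elim (α := (twoTerm f).X 2) _ _
  simp

/-- The augmentation of `⋯ ⟶ 0 ⟶ A ⟶ B` given by a map out of `B` that vanishes on `A`. -/
noncomputable def twoTermπ {C : ModuleCat.{u} R} (g : B ⟶ C) (w : f ≫ g = 0) :
    twoTerm f ⟶ (ChainComplex.single₀ _).obj C :=
  (ChainComplex.toSingle₀Equiv (twoTerm f) C).symm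
    ⟨g, (congrArg (· ≫ g) (twoTerm_d_one f)).trans w⟩

lemma twoTermπ_f_zero {C : ModuleCat.{u} R} (g : B ⟶ C) (w : f ≫ g = 0) :
    (twoTermπ f g w).f 0 = g :=
  ChainComplex.toSingle₀Equiv_symm_apply_f_zero (C := twoTerm f) g _

lemma twoTerm_exactAt_succ (hf : Function.Injective f.hom) (n : ℕ) :
    (twoTerm f).ExactAt (n + 1) := by
  rw [HomologicalComplex.exactAt_iff' _ (n + 2) (n + 1) n (by simp) (by simp)]
  rw [ShortComplex.moduleCat_exact_iff]
  cases n with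
  | zero =>
    intro x hx
    have h : f.hom x = 0 := (ConcreteCategory.congr_hom (twoTerm_d_one f) x).symm.trans hx
    exact ⟨0, ((map_eq_zero_iff f.hom hf).1 h).symm⟩
  | succ n => exact fun x _ => ⟨0, Subsingleton.elim (α := (twoTerm f).X (n + 2)) _ _⟩

lemma quasiIso_twoTermπ {C : ModuleCat.{u} R} (g : B ⟶ C) (w : f ≫ g = 0)
    (hf : Function.Injective f.hom) (hg : Function.Surjective g.hom)
    (hfg : Function.Exact f.hom g.hom) : QuasiIso (twoTermπ f g w) where
  quasiIsoAt n := by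
    cases n with
    | zero =>
      rw [ChainComplex.quasiIsoAt₀_iff, ShortComplex.quasiIso_iff_of_zeros' _ rfl rfl rfl]
      constructor
      · rw [ShortComplex.moduleCat_exact_iff]
        intro x hx
        obtain ⟨y, hy⟩ := (hfg x).1
          ((ConcreteCategory.congr_hom (twoTermπ_f_zero f g w) x).symm.trans hx)
        exact ⟨y, (ConcreteCategory.congr_hom (twoTerm_d_one f) y).trans hy⟩
      · rw [ModuleCat.epi_iff_surjective]
        intro y
        obtain ⟨x, rfl⟩ := hg y
        exact ⟨x, ConcreteCategory.congr_hom (twoTermπ_f_zero f g w) x⟩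
    | succ n =>
      rw [quasiIsoAt_iff_exactAt' (hL := ChainComplex.exactAt_succ_single_obj ..)]
      exact twoTerm_exactAt_succ f hf n

/-- The projective resolution given by a short exact sequence whose first two terms are
projective. -/
noncomputable def twoTermResolution {C : ModuleCat.{u} R} (g : B ⟶ C) (w : f ≫ g = 0)
    (hA : Projective A) (hB : Projective B)
    (hf : Function.Injective f.hom) (hg : Function.Surjective g.hom)
    (hfg : Function.Exact f.hom g.hom) : ProjectiveResolution C where
  complex := twoTerm f
  projective n := match n with
    | 0 => hB
    | 1 => hA
    | n + 2 => (ModuleCat.isZero_of_subsingleton ((twoTerm f).X (n + 2))).projective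
  π := twoTermπ f g w
  quasiIso := quasiIso_twoTermπ f g w hf hg hfg

/-- The components of the chain map between two-term complexes given by a commutative square. -/
noncomputable def twoTermMapF {A' B' : ModuleCat.{u} R} (a : A ⟶ A') (b : B ⟶ B') :
    ∀ n, twoTermObj A B n ⟶ twoTermObj A' B' n
  | 0 => b
  | 1 => a
  | _ + 2 => 0

/-- The chain map between two-term complexes given by a commutative square. -/
noncomputable def twoTermMap {A' B' : ModuleCat.{u} R} {f : A ⟶ B} {f' : A' ⟶ B'} (a : A ⟶ A')
    (b : B ⟶ B') (h : a ≫ f' = f ≫ b) : twoTerm f ⟶ twoTerm f' :=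
  ChainComplex.ofHom (twoTermMapF a b) fun n => match n with
    | 0 => (congrArg (a ≫ ·) (twoTerm_d_one f')).trans
        (h.trans (congrArg (· ≫ b) (twoTerm_d_one f)).symm)
    | 1 => (congrArg ((0 : twoTermObj A B 2 ⟶ twoTermObj A' B' 2) ≫ ·) (twoTerm_d_two f')).trans
        (Limits.zero_comp.trans ((congrArg (· ≫ a) (twoTerm_d_two f)).trans
          Limits.zero_comp).symm)
    | n + 2 => by
      ext x
      exact Subsingleton.elim (α := (twoTerm f').X (n + 2)) _ _

end

/-- The induced map on homology takes the class of `z` to the class of the image of `z`. -/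
lemma homologyMap_classOf {R : Type} [CommRing R] {K L : ChainComplex (ModuleCat.{u} R) ℕ}
    (f : K ⟶ L) (n : ℕ) (z : cyclesOf K n) (w : cyclesOf L n) (h : w.1 = (f.f n).hom z.1) :
    (HomologicalComplex.homologyMap f n).hom (classOf K n z) = classOf L n w := by
  have hz : (K.iCycles n).hom ((K.sc n).moduleCatCyclesIso.inv.hom z) = z.1 :=
    ConcreteCategory.congr_hom (K.sc n).moduleCatCyclesIso_inv_iCycles z
  rw [classOf_eq K n _ z hz, classOf_eq L n ((HomologicalComplex.cyclesMap f n).hom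
    ((K.sc n).moduleCatCyclesIso.inv.hom z)) w]
  · exact ConcreteCategory.congr_hom (HomologicalComplex.homologyπ_naturality f n) _
  · rw [h, ← hz]
    exact ConcreteCategory.congr_hom (HomologicalComplex.cyclesMap_i f n) _

section
variable {R : Type} [CommRing R]

/-- The resolution `0 ⟶ ker φ ⟶ B ⟶ C ⟶ 0` given by a surjective map `φ`, if its kernel and its
source are projective. -/
noncomputable def kerResolution {B C : Type u} [AddCommGroup B] [Module R B] [AddCommGroup C]
    [Module R C] (φ : B →ₗ[R] C) (hφ : Function.Surjective φ) [Module.Projective R B]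
    [Module.Projective R (LinearMap.ker φ)] : ProjectiveResolution (ModuleCat.of R C) :=
  twoTermResolution (ModuleCat.ofHom (LinearMap.ker φ).subtype) (ModuleCat.ofHom φ)
    (by ext x; exact x.2)
    ((IsProjective.iff_projective _).1 inferInstance)
    ((IsProjective.iff_projective _).1 inferInstance)
    (Submodule.subtype_injective _) hφ
    (fun x => ⟨fun h => ⟨⟨x, h⟩, rfl⟩, fun ⟨y, hy⟩ => hy ▸ y.2⟩)

lemma kerResolution_π {B C : Type u} [AddCommGroup B] [Module R B] [AddCommGroup C]
    [Module R C] (φ : B →ₗ[R] C) (hφ : Function.Surjective φ) [Module.Projective R B]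
    [Module.Projective R (LinearMap.ker φ)] :
    (kerResolution φ hφ).π.f 0 = ModuleCat.ofHom φ :=
  twoTermπ_f_zero _ _ (by ext x; exact x.2)

/-- The resolution `kerResolution φ`, tensored with `T`. -/
noncomputable abbrev tensorResolution (T : ModuleCat.{u} R) {B C : Type u} [AddCommGroup B]
    [Module R B] [AddCommGroup C]
    [Module R C] (φ : B →ₗ[R] C) (hφ : Function.Surjective φ) [Module.Projective R B]
    [Module.Projective R (LinearMap.ker φ)] : ChainComplex (ModuleCat.{u} R) ℕ :=
  ((tensorFunctor T).mapHomologicalComplex _).obj (kerResolution φ hφ).complex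

variable (T : ModuleCat.{u} R) {B C : Type u} [AddCommGroup B]
    [Module R B] [AddCommGroup C]
    [Module R C] (φ : B →ₗ[R] C) (hφ : Function.Surjective φ) [Module.Projective R B]
    [Module.Projective R (LinearMap.ker φ)]

lemma mem_cyclesOf_tensorResolution (x : T ⊗[R] LinearMap.ker φ) :
    (show (tensorResolution T φ hφ).X 1 from x) ∈ cyclesOf (tensorResolution T φ hφ) 1 ↔
      (LinearMap.ker φ).subtype.lTensor T x = 0 := by
  refine (mem_cyclesOf_iff (tensorResolution T φ hφ) 1 0 (by simp) _).trans ?_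
  have h : (tensorResolution T φ hφ).d 1 0 =
      (tensorFunctor T).map (ModuleCat.ofHom (LinearMap.ker φ).subtype) :=
    congrArg (tensorFunctor T).map (twoTerm_d_one _)
  exact iff_of_eq (congrArg (· = 0) (ConcreteCategory.congr_hom h x))

/-- The cycles of degree `1` of `kerResolution φ` tensored with `T`. -/
noncomputable def tensorCycle :
    LinearMap.ker ((LinearMap.ker φ).subtype.lTensor T) →ₗ[R]
      cyclesOf (tensorResolution T φ hφ) 1 where
  toFun x := ⟨x.1, (mem_cyclesOf_tensorResolution T φ hφ x.1).2 x.2⟩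
  map_add' _ _ := rfl
  map_smul' _ _ := rfl

/-- The isomorphism from the kernel of `T ⊗ ker φ → T ⊗ B` to `Tor₁(T, C)`, for a surjective map
`φ : B → C` whose source and kernel are projective; see `kerToTor_bijective`. -/
noncomputable def kerToTor :
    LinearMap.ker ((LinearMap.ker φ).subtype.lTensor T) →ₗ[R] torObj T (ModuleCat.of R C) :=
  ((kerResolution φ hφ).isoLeftDerivedObj (tensorFunctor T) 1).inv.hom ∘ₗ
    classOf (tensorResolution T φ hφ) 1 ∘ₗ tensorCycle T φ hφ

lemma kerToTor_bijective : Function.Bijective (kerToTor T φ hφ) := by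
  have h1 : Function.Bijective
      ((kerResolution φ hφ).isoLeftDerivedObj (tensorFunctor T) 1).inv.hom :=
    ConcreteCategory.bijective_of_isIso
      ((kerResolution φ hφ).isoLeftDerivedObj (tensorFunctor T) 1).inv
  have h2 : Function.Bijective (tensorCycle T φ hφ) :=
    ⟨fun x y h => by
      have h' := Subtype.ext_iff.1 h
      exact Subtype.ext h',
      fun x => ⟨⟨x.1, (mem_cyclesOf_tensorResolution T φ hφ x.1).1 x.2⟩, rfl⟩⟩
  have h3 : Function.Bijective (classOf (tensorResolution T φ hφ) 1) := by
    refine ⟨?_, classOf_surjective _ _⟩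
    refine (injective_iff_map_eq_zero _).2 fun z hz => ?_
    obtain ⟨c, hc⟩ := (classOf_eq_zero_iff _ _ z).1 hz
    have h3 : (tensorResolution T φ hφ).d 2 1 = 0 :=
      (congrArg (tensorFunctor T).map (twoTerm_d_two _)).trans ((tensorFunctor T).map_zero _ _)
    exact Subtype.ext (hc.symm.trans (ConcreteCategory.congr_hom h3 c))
  exact h1.comp (h3.comp h2)

end

/-- `kerToTor` is natural. -/
lemma torMap_kerToTor {R : Type} [CommRing R] {T T' C C' : ModuleCat.{u} R} {B B' : Type u}
    [AddCommGroup B] [Module R B] [AddCommGroup B'] [Module R B']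
    (φ : B →ₗ[R] C) (hφ : Function.Surjective φ) [Module.Projective R B]
    [Module.Projective R (LinearMap.ker φ)]
    (φ' : B' →ₗ[R] C') (hφ' : Function.Surjective φ') [Module.Projective R B']
    [Module.Projective R (LinearMap.ker φ')]
    (t : T ⟶ T') (c : C ⟶ C') (b : B →ₗ[R] B') (hbc : φ' ∘ₗ b = c.hom ∘ₗ φ)
    (a : LinearMap.ker φ →ₗ[R] LinearMap.ker φ')
    (hab : (LinearMap.ker φ').subtype ∘ₗ a = b ∘ₗ (LinearMap.ker φ).subtype)
    (x : LinearMap.ker ((LinearMap.ker φ).subtype.lTensor T))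
    (y : LinearMap.ker ((LinearMap.ker φ').subtype.lTensor T'))
    (hxy : y.1 = TensorProduct.map t.hom a x.1) :
    (torMap t c).hom (kerToTor T φ hφ x) = kerToTor T' φ' hφ' y := by
  let P := kerResolution φ hφ
  let Q := kerResolution φ' hφ'
  let χ : P.complex ⟶ Q.complex := twoTermMap (ModuleCat.ofHom a) (ModuleCat.ofHom b) (by
    ext1; exact hab)
  have hχ : χ.f 0 ≫ Q.π.f 0 = P.π.f 0 ≫ c := by
    refine (congrArg (ModuleCat.ofHom b ≫ ·) (kerResolution_π φ' hφ')).trans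
      (Eq.trans ?_ (congrArg (· ≫ c) (kerResolution_π φ hφ)).symm)
    ext1
    exact hbc
  have h1 := P.leftDerived_app_eq (tensorFunctorMap t) 1
  have h2 := P.isoLeftDerivedObj_inv_naturality c Q χ hχ (tensorFunctor T') 1
  have h3 : (P.isoLeftDerivedObj (tensorFunctor T) 1).inv ≫ torMap t c =
      (HomologicalComplex.homologyMap
        ((NatTrans.mapHomologicalComplex (tensorFunctorMap t) _).app P.complex) 1 ≫
      HomologicalComplex.homologyMap (((tensorFunctor T').mapHomologicalComplex _).map χ) 1) ≫
        (Q.isoLeftDerivedObj (tensorFunctor T') 1).inv := by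
    have h : ∀ {X₁ X₂ X₃ X₄ X₅ X₆ : ModuleCat.{u} R} (i : X₁ ≅ X₂) (m : X₂ ⟶ X₃) (j : X₄ ≅ X₃)
        (g : X₄ ⟶ X₅) (n : X₃ ⟶ X₆) (k : X₆ ⟶ X₅), j.inv ≫ g = n ≫ k →
        i.inv ≫ (i.hom ≫ m ≫ j.inv) ≫ g = (m ≫ n) ≫ k := by
      intro X₁ X₂ X₃ X₄ X₅ X₆ i m j g n k hg
      simp [hg]
    exact (congrArg (fun s => (P.isoLeftDerivedObj (tensorFunctor T) 1).inv ≫ s ≫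
      ((tensorFunctor T').leftDerived 1).map c) h1).trans (h _ _ _ _ _ _ h2)
  refine (ConcreteCategory.congr_hom h3 (classOf (tensorResolution T φ hφ) 1
    (tensorCycle T φ hφ x))).trans ?_
  rw [← HomologicalComplex.homologyMap_comp]
  refine congrArg (Q.isoLeftDerivedObj (tensorFunctor T') 1).inv.hom ?_
  refine homologyMap_classOf _ 1 _ (tensorCycle T' φ' hφ' y) ?_
  refine hxy.trans ?_
  have h4 : TensorProduct.map t.hom a =
      TensorProduct.map (LinearMap.id : T' →ₗ[R] T') a ∘ₗ
        TensorProduct.map t.hom (LinearMap.id : LinearMap.ker φ →ₗ[R] _) := by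
    rw [← TensorProduct.map_comp]; rfl
  exact LinearMap.congr_fun h4 x.1

/-! ### Tensor products of flat modules -/

section
variable {R : Type*} [CommRing R] {A B C N : Type*} [AddCommGroup A] [AddCommGroup B]
  [AddCommGroup C] [AddCommGroup N] [Module R A] [Module R B] [Module R C] [Module R N]

lemma tensorProduct_map_sub_left {D : Type*} [AddCommGroup D] [Module R D] (f f' : A →ₗ[R] B)
    (g : C →ₗ[R] D) :
    TensorProduct.map (f - f') g = TensorProduct.map f g - TensorProduct.map f' g :=
  TensorProduct.ext' fun x y => by simp [TensorProduct.sub_tmul]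

lemma tensorProduct_map_sub_right {D : Type*} [AddCommGroup D] [Module R D] (f : A →ₗ[R] B)
    (g g' : C →ₗ[R] D) :
    TensorProduct.map f (g - g') = TensorProduct.map f g - TensorProduct.map f g' :=
  TensorProduct.ext' fun x y => by simp [TensorProduct.tmul_sub]

/-- A linear map vanishing on the kernel of `g` factors through the range of `g`. -/
lemma exists_comp_rangeRestrict_eq (g : A →ₗ[R] B) (f : A →ₗ[R] C)
    (h : ∀ x, g x = 0 → f x = 0) :
    ∃ f' : LinearMap.range g →ₗ[R] C, f' ∘ₗ g.rangeRestrict = f := by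
  refine ⟨(LinearMap.ker g).liftQ f h ∘ₗ g.quotKerEquivRange.symm.toLinearMap, ?_⟩
  ext x
  have : g.quotKerEquivRange.symm (g.rangeRestrict x) = Submodule.Quotient.mk x := by
    rw [LinearEquiv.symm_apply_eq]; rfl
  rw [LinearMap.comp_apply, LinearMap.comp_apply, LinearEquiv.coe_coe, this]
  rfl

/-- If `N` is flat and `f` vanishes on the kernel of `g`, then `f ⊗ N` vanishes on the kernel of
`g ⊗ N`. -/
lemma rTensor_eq_zero_of_flat [Module.Flat R N] (g : A →ₗ[R] B) (f : A →ₗ[R] C)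
    (h : ∀ x, g x = 0 → f x = 0) (x : A ⊗[R] N)
    (hx : TensorProduct.map g LinearMap.id x = 0) :
    TensorProduct.map f LinearMap.id x = 0 := by
  obtain ⟨f', rfl⟩ := exists_comp_rangeRestrict_eq g f h
  have hinj := Module.Flat.rTensor_preserves_injective_linearMap (M := N)
    (LinearMap.range g).subtype (Submodule.subtype_injective _)
  have h0 : g.rangeRestrict.rTensor N x = 0 := by
    apply hinj
    rw [map_zero, ← LinearMap.comp_apply, ← LinearMap.rTensor_comp]
    exact hx
  change (f' ∘ₗ g.rangeRestrict).rTensor N x = 0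
  rw [LinearMap.rTensor_comp, LinearMap.comp_apply, h0, map_zero]

/-- The analogue of `rTensor_eq_zero_of_flat` with the flat module on the left. -/
lemma lTensor_eq_zero_of_flat [Module.Flat R N] (g : A →ₗ[R] B) (f : A →ₗ[R] C)
    (h : ∀ x, g x = 0 → f x = 0) (x : N ⊗[R] A)
    (hx : TensorProduct.map LinearMap.id g x = 0) :
    TensorProduct.map LinearMap.id f x = 0 := by
  obtain ⟨f', rfl⟩ := exists_comp_rangeRestrict_eq g f h
  have hinj := Module.Flat.lTensor_preserves_injective_linearMap (M := N)
    (LinearMap.range g).subtype (Submodule.subtype_injective _)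
  have h0 : g.rangeRestrict.lTensor N x = 0 := by
    apply hinj
    rw [map_zero, ← LinearMap.comp_apply, ← LinearMap.lTensor_comp]
    exact hx
  change (f' ∘ₗ g.rangeRestrict).lTensor N x = 0
  rw [LinearMap.lTensor_comp, LinearMap.comp_apply, h0, map_zero]

/-- The kernel of `A ⊗ ι` for an injective map `ι` vanishes after tensoring with a field that is
flat over the base ring. -/
lemma subsingleton_tensor_ker_lTensor (Q : Type*) [Field Q] [Algebra R Q] [Module.Flat R Q]
    (ι : B →ₗ[R] C) (hι : Function.Injective ι) :
    Subsingleton (Q ⊗[R] LinearMap.ker (ι.lTensor A)) := by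
  have h1 : Function.Injective ((LinearMap.ker (ι.lTensor A)).subtype.lTensor Q) :=
    Module.Flat.lTensor_preserves_injective_linearMap _ (Submodule.subtype_injective _)
  have : Module.Flat R (Q ⊗[R] A) := Module.Flat.trans R Q (Q ⊗[R] A)
  have h2 : Function.Injective ((ι.lTensor A).lTensor Q) := by
    have h3 : Function.Injective (ι.lTensor (Q ⊗[R] A)) :=
      Module.Flat.lTensor_preserves_injective_linearMap _ hι
    rw [LinearMap.lTensor_tensor] at h3
    simpa using h3
  refine ⟨fun x y => h1 (h2 ?_)⟩
  rw [← LinearMap.comp_apply, ← LinearMap.comp_apply, ← LinearMap.lTensor_comp,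
    LinearMap.comp_ker_subtype, LinearMap.lTensor_zero]
  rfl

end

/-! ### Cycles and boundaries in complexes of free modules -/

section
variable {R : Type} [CommRing R] (K L : ChainComplex (ModuleCat.{u} R) ℕ)

/-- A chain complex of finitely generated free modules. -/
class IsFiniteFree : Prop where
  free : ∀ n, Module.Free R (K.X n)
  finite : ∀ n, Module.Finite R (K.X n)

attribute [instance] IsFiniteFree.free IsFiniteFree.finite

/-- The submodule of boundaries in the module of cycles of degree `n`. -/
noncomputable abbrev boundariesOf (n : ℕ) : Submodule R (cyclesOf K n) :=
  LinearMap.ker (classOf K n)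

lemma d_mem_cyclesOf (n : ℕ) (x : K.X (n + 1)) : (K.d (n + 1) n).hom x ∈ cyclesOf K n :=
  (mem_cyclesOf_iff K n _ rfl _).2 (ConcreteCategory.congr_hom (K.d_comp_d (n + 1) n _) x)

/-- The differential, as a map to cycles. -/
noncomputable def dCycles (n : ℕ) : K.X (n + 1) →ₗ[R] cyclesOf K n :=
  (K.d (n + 1) n).hom.codRestrict _ (d_mem_cyclesOf K n)

lemma classOf_dCycles (n : ℕ) (x : K.X (n + 1)) : classOf K n (dCycles K n x) = 0 :=
  (classOf_eq_zero_iff K n _).2 ⟨x, rfl⟩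

/-- The differential, as a map to boundaries. -/
noncomputable def dBoundaries (n : ℕ) : K.X (n + 1) →ₗ[R] boundariesOf K n :=
  (dCycles K n).codRestrict _ (classOf_dCycles K n)

lemma dBoundaries_surjective (n : ℕ) : Function.Surjective (dBoundaries K n) := by
  rintro ⟨x, hx⟩
  obtain ⟨c, hc⟩ := (classOf_eq_zero_iff K n x).1 hx
  exact ⟨c, Subtype.ext (Subtype.ext hc)⟩

lemma dBoundaries_eq_zero_iff (n : ℕ) (x : K.X (n + 1)) :
    dBoundaries K n x = 0 ↔ x ∈ cyclesOf K (n + 1) := by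
  rw [mem_cyclesOf_iff K (n + 1) n (by simp)]
  exact ⟨fun h => congrArg (fun z => z.1.1) h, fun h => Subtype.ext (Subtype.ext h)⟩

lemma exact_dCycles_classOf (n : ℕ) : Function.Exact (dCycles K n) (classOf K n) := fun x =>
  ⟨fun h => ((classOf_eq_zero_iff K n x).1 h).imp fun _ hc => Subtype.ext hc,
    fun ⟨c, hc⟩ => (classOf_eq_zero_iff K n x).2 ⟨c, congrArg Subtype.val hc⟩⟩

/-- The induced map on cycles. -/
noncomputable def cyclesOfMap {K K' : ChainComplex (ModuleCat.{u} R) ℕ} (f : K ⟶ K') (n : ℕ) :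
    cyclesOf K n →ₗ[R] cyclesOf K' n :=
  ((f.f n).hom ∘ₗ (cyclesOf K n).subtype).codRestrict _ fun z => by
    have h := ConcreteCategory.congr_hom (f.comm n ((ComplexShape.down ℕ).next n)) z.1
    exact h.trans ((congrArg (f.f _).hom z.2).trans (map_zero _))

lemma homologyMap_classOf_cyclesOfMap {K K' : ChainComplex (ModuleCat.{u} R) ℕ} (f : K ⟶ K') (n : ℕ)
    (z : cyclesOf K n) :
    (HomologicalComplex.homologyMap f n).hom (classOf K n z) = classOf K' n (cyclesOfMap f n z) :=
  homologyMap_classOf f n z _ rfl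

/-- The induced map on boundaries. -/
noncomputable def boundariesOfMap {K K' : ChainComplex (ModuleCat.{u} R) ℕ} (f : K ⟶ K') (n : ℕ) :
    boundariesOf K n →ₗ[R] boundariesOf K' n :=
  (cyclesOfMap f n ∘ₗ (boundariesOf K n).subtype).codRestrict _ fun z => by
    refine (homologyMap_classOf_cyclesOfMap f n z.1).symm.trans ?_
    rw [LinearMap.mem_ker.1 z.2, map_zero]

lemma boundariesOfMap_dBoundaries {K K' : ChainComplex (ModuleCat.{u} R) ℕ} (f : K ⟶ K') (n : ℕ) :
    boundariesOfMap f n ∘ₗ dBoundaries K n = dBoundaries K' n ∘ₗ (f.f (n + 1)).hom := by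
  refine LinearMap.ext fun x => Subtype.ext (Subtype.ext ?_)
  exact (ConcreteCategory.congr_hom (f.comm (n + 1) n) x).symm

variable [IsDomain R] [IsPrincipalIdealRing R] [IsFiniteFree K]

/-- The cycles are a direct summand of the chains, because the image of the differential is a
submodule of a free module over a principal ideal domain, hence projective. -/
lemma exists_cycleRetraction (n : ℕ) :
    ∃ r : K.X n →ₗ[R] cyclesOf K n, ∀ z : cyclesOf K n, r z.1 = z := by
  obtain ⟨s, hs⟩ : ∃ s : LinearMap.range (K.sc n).g.hom →ₗ[R] K.X n,
      (K.sc n).g.hom.rangeRestrict ∘ₗ s = LinearMap.id := by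
    have : Module.Free R (K.sc n).X₃ := IsFiniteFree.free (K := K) _
    have : Module.Finite R (K.sc n).X₃ := IsFiniteFree.finite (K := K) _
    exact Module.projective_lifting_property _ _ (K.sc n).g.hom.surjective_rangeRestrict
  refine ⟨(LinearMap.id - s ∘ₗ (K.sc n).g.hom.rangeRestrict).codRestrict _ fun x => ?_,
    fun z => Subtype.ext ?_⟩
  rotate_left
  · have h := congrArg Subtype.val (LinearMap.congr_fun hs ((K.sc n).g.hom.rangeRestrict x))
    exact (map_sub (K.sc n).g.hom x _).trans (sub_eq_zero.2 h.symm)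
  · have h : (K.sc n).g.hom.rangeRestrict z.1 = 0 := Subtype.ext z.2
    refine (congrArg (fun t => z.1 - s t) h).trans ?_
    rw [map_zero, sub_zero]

/-- A linear projection from chains to cycles. -/
noncomputable def cycleRetraction (n : ℕ) : K.X n →ₗ[R] cyclesOf K n :=
  (exists_cycleRetraction K n).choose

lemma cycleRetraction_coe (n : ℕ) (z : cyclesOf K n) : cycleRetraction K n z.1 = z :=
  (exists_cycleRetraction K n).choose_spec z

/-- The projection from chains to cycles, as an endomorphism. -/
noncomputable def cycleProj (n : ℕ) : K.X n →ₗ[R] K.X n :=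
  (cyclesOf K n).subtype ∘ₗ cycleRetraction K n

lemma cycleProj_of_mem (n : ℕ) {x : K.X n} (hx : x ∈ cyclesOf K n) : cycleProj K n x = x :=
  congrArg Subtype.val (cycleRetraction_coe K n ⟨x, hx⟩)

/-- The class of a cycle, extended to all chains by the projection from chains to cycles. -/
noncomputable def chainClass (n : ℕ) : K.X n →ₗ[R] K.homology n :=
  classOf K n ∘ₗ cycleRetraction K n

lemma chainClass_coe (n : ℕ) (z : cyclesOf K n) : chainClass K n z.1 = classOf K n z :=
  congrArg (classOf K n) (cycleRetraction_coe K n z)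

lemma chainClass_d (n : ℕ) : chainClass K n ∘ₗ (K.d (n + 1) n).hom = 0 := by
  ext x
  exact (chainClass_coe K n (dCycles K n x)).trans (classOf_dCycles K n x)

lemma cycleRetraction_d (n : ℕ) : cycleRetraction K n ∘ₗ (K.d (n + 1) n).hom = dCycles K n := by
  ext1 x
  exact cycleRetraction_coe K n (dCycles K n x)

end

/-! ### The components of the Künneth sequence -/

section
variable {R : Type} [CommRing R] {K L M : ChainComplex (ModuleCat.{u} R) ℕ}

/-- A family of maps `c p q n : M_n → K_p ⊗ L_q` that are the components of a chain map from `M` to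
the total complex of `K ⊗ L`. Only the components with `p + q = n` matter; the condition is imposed
on all of them. -/
def IsCoproduct (c : ∀ p q n, M.X n →ₗ[R] K.X p ⊗[R] L.X q) : Prop :=
  ∀ p q n z, c p q n ((M.d (n + 1) n).hom z) =
    TensorProduct.map (K.d (p + 1) p).hom LinearMap.id (c (p + 1) q (n + 1) z) +
      (-1 : R) ^ p • TensorProduct.map LinearMap.id (L.d (q + 1) q).hom (c p (q + 1) (n + 1) z)

variable {c : ∀ p q n, M.X n →ₗ[R] K.X p ⊗[R] L.X q}

lemma IsCoproduct.of_mem_cyclesOf (hc : IsCoproduct c) (p q n : ℕ) {z : M.X (n + 1)}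
    (hz : z ∈ cyclesOf M (n + 1)) :
    TensorProduct.map (K.d (p + 1) p).hom LinearMap.id (c (p + 1) q (n + 1) z) =
      -((-1 : R) ^ p •
        TensorProduct.map LinearMap.id (L.d (q + 1) q).hom (c p (q + 1) (n + 1) z)) := by
  rw [← add_eq_zero_iff_eq_neg, ← hc, (mem_cyclesOf_iff M (n + 1) n (by simp) z).1 hz, map_zero]

/-- The kernel of `H_p(K) ⊗ B_q(L) → H_p(K) ⊗ Z_q(L)`, a model of `Tor₁(H_p(K), H_q(L))`. -/
noncomputable abbrev torKer (K L : ChainComplex (ModuleCat.{u} R) ℕ) (p q : ℕ) :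
    Submodule R (K.homology p ⊗[R] boundariesOf L q) :=
  LinearMap.ker ((boundariesOf L q).subtype.lTensor (K.homology p))

variable [IsDomain R] [IsPrincipalIdealRing R] [IsFiniteFree K] [IsFiniteFree L]

/-- For a cycle `z`, its component `z_{p,q+1}` is killed by `d ⊗ d`: by the cycle condition,
`(1 ⊗ d) z_{p,q+1}` is up to sign equal to `(d ⊗ 1) z_{p+1,q}`. As `B_q` is flat, `f ⊗ d` kills
`z_{p,q+1}` for each `f` that vanishes on the cycles. -/
lemma IsCoproduct.map_dBoundaries_eq_zero (hc : IsCoproduct c) (p q n : ℕ) {z : M.X (n + 1)}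
    (hz : z ∈ cyclesOf M (n + 1)) {N : Type*} [AddCommGroup N] [Module R N]
    (f : K.X p →ₗ[R] N) (hf : ∀ x ∈ cyclesOf K p, f x = 0) :
    TensorProduct.map f (dBoundaries L q) (c p (q + 1) (n + 1) z) = 0 := by
  let g := (K.d p ((ComplexShape.down ℕ).next p)).hom
  have h1 : TensorProduct.map g (L.d (q + 1) q).hom (c p (q + 1) (n + 1) z) = 0 := by
    have h2 : g ∘ₗ (K.d (p + 1) p).hom = 0 :=
      LinearMap.ext fun x => ConcreteCategory.congr_hom (K.d_comp_d (p + 1) p _) x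
    have h3 := congrArg (TensorProduct.map g LinearMap.id) (hc.of_mem_cyclesOf p q n hz)
    rw [TensorProduct.map_map, h2, TensorProduct.map_zero_left, LinearMap.zero_apply, map_neg,
      map_smul, TensorProduct.map_map, LinearMap.comp_id, LinearMap.id_comp, eq_comm, neg_eq_zero,
      IsUnit.smul_eq_zero (IsUnit.pow p isUnit_one.neg)] at h3
    exact h3
  have h2 : TensorProduct.map g (dBoundaries L q) (c p (q + 1) (n + 1) z) = 0 := by
    have hinj : Function.Injective
        (((cyclesOf L q).subtype ∘ₗ (boundariesOf L q).subtype).lTensor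
          (K.X ((ComplexShape.down ℕ).next p))) :=
      Module.Flat.lTensor_preserves_injective_linearMap _
        ((Submodule.subtype_injective _).comp (Submodule.subtype_injective _))
    apply hinj
    rw [map_zero, LinearMap.lTensor, TensorProduct.map_map]
    exact h1
  have h3 := rTensor_eq_zero_of_flat g f hf
    (TensorProduct.map LinearMap.id (dBoundaries L q) (c p (q + 1) (n + 1) z))
  rw [TensorProduct.map_map, TensorProduct.map_map] at h3
  exact h3 h2

/-- The component `H_n(M) → H_p(K) ⊗ H_q(L)` of the map induced by a coproduct; see
`homologyCoproduct_classOf`. -/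
noncomputable def homologyCoproduct (hc : IsCoproduct c) (p q n : ℕ) :
    M.homology n →ₗ[R] tensorObj (K.homology p) (L.homology q) :=
  homologyLift M n
    (TensorProduct.map (chainClass K p) (chainClass L q) ∘ₗ c p q n ∘ₗ (cyclesOf M n).subtype) (by
      rintro ⟨_, hz⟩ ⟨x, rfl⟩
      refine (congrArg (TensorProduct.map (chainClass K p) (chainClass L q))
        (hc p q n x)).trans ?_
      rw [map_add, map_smul, TensorProduct.map_map, TensorProduct.map_map, chainClass_d,
        chainClass_d]
      simp)

lemma homologyCoproduct_classOf (hc : IsCoproduct c) (p q n : ℕ) (z : cyclesOf M n) :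
    homologyCoproduct hc p q n (classOf M n z) =
      TensorProduct.map (chainClass K p) (chainClass L q) (c p q n z.1) :=
  homologyLift_classOf _ _ _ _ _

/-- For a cycle `z`, the element `(class ⊗ d) z_{p,q+1}` vanishes in `H_p(K) ⊗ Z_q(L)`, since it is
there up to sign equal to `(class ∘ d ⊗ 1) z_{p+1,q}`. -/
lemma IsCoproduct.mem_torKer (hc : IsCoproduct c) (p q n : ℕ) (z : cyclesOf M (n + 1)) :
    TensorProduct.map (chainClass K p) (dBoundaries L q) (c p (q + 1) (n + 1) z.1) ∈
      torKer K L p q := by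
  have h1 : (boundariesOf L q).subtype ∘ₗ dBoundaries L q =
      cycleRetraction L q ∘ₗ (L.d (q + 1) q).hom := by
    rw [cycleRetraction_d]; rfl
  have h2 := congrArg (TensorProduct.map (chainClass K p) (cycleRetraction L q))
    (hc.of_mem_cyclesOf p q n z.2)
  rw [TensorProduct.map_map, chainClass_d, TensorProduct.map_zero_left, LinearMap.zero_apply,
    map_neg, map_smul, eq_comm, neg_eq_zero,
    IsUnit.smul_eq_zero (IsUnit.pow p isUnit_one.neg), TensorProduct.map_map] at h2
  rw [LinearMap.mem_ker, LinearMap.lTensor, TensorProduct.map_map, h1]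
  exact h2

/-- The map `z ↦ (class ⊗ d) z_{p,q+1}` from the cycles of `M` to the model `torKer` of
`Tor₁(H_p(K), H_q(L))`. -/
noncomputable def cyclesToTorKer (hc : IsCoproduct c) (p q n : ℕ) :
    cyclesOf M (n + 1) →ₗ[R] torKer K L p q :=
  (TensorProduct.map (chainClass K p) (dBoundaries L q) ∘ₗ c p (q + 1) (n + 1) ∘ₗ
    (cyclesOf M (n + 1)).subtype).codRestrict _ (hc.mem_torKer p q n)

/-- Boundaries map to zero, because `class ∘ d` and `d ∘ d` vanish. -/
lemma cyclesToTorKer_boundary (hc : IsCoproduct c) (p q n : ℕ) (z : cyclesOf M (n + 1))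
    (hz : ∃ x : M.X (n + 2), (M.d (n + 2) (n + 1)).hom x = z.1) :
    cyclesToTorKer hc p q n z = 0 := by
  obtain ⟨x, hx⟩ := hz
  have h : dBoundaries L q ∘ₗ (L.d (q + 2) (q + 1)).hom = 0 :=
    LinearMap.ext fun y => (dBoundaries_eq_zero_iff L q _).2 (d_mem_cyclesOf L (q + 1) y)
  refine Subtype.ext ?_
  refine (congrArg (fun y => TensorProduct.map (chainClass K p) (dBoundaries L q)
    (c p (q + 1) (n + 1) y)) hx.symm).trans ?_
  refine (congrArg _ (hc p (q + 1) (n + 1) x)).trans ?_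
  rw [map_add, map_smul, TensorProduct.map_map, TensorProduct.map_map, chainClass_d, h]
  simp

/-- The component `H_{n+1}(M) → Tor₁(H_p(K), H_q(L))` of the second map of the Künneth sequence. -/
noncomputable def torComponent (hc : IsCoproduct c) (p q n : ℕ) :
    M.homology (n + 1) →ₗ[R] torObj (K.homology p) (L.homology q) :=
  homologyLift M (n + 1)
    (kerToTor (K.homology p) (classOf L q) (classOf_surjective L q) ∘ₗ cyclesToTorKer hc p q n)
    fun z hz => by
      rw [LinearMap.comp_apply, cyclesToTorKer_boundary hc p q n z hz, map_zero]

lemma torComponent_classOf (hc : IsCoproduct c) (p q n : ℕ) (z : cyclesOf M (n + 1)) :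
    torComponent hc p q n (classOf M (n + 1) z) =
      kerToTor (K.homology p) (classOf L q) (classOf_surjective L q)
        (cyclesToTorKer hc p q n z) :=
  homologyLift_classOf _ _ _ _ _

/-- The maps `torComponent` are natural, although they are defined by means of a choice of
projections from chains to cycles: two choices differ by a map that factors through the
differential of `K`. -/
lemma torMap_torComponent {K' L' M' : ChainComplex (ModuleCat.{u} R) ℕ}
    [IsFiniteFree K'] [IsFiniteFree L']
    {c' : ∀ p q n, M'.X n →ₗ[R] K'.X p ⊗[R] L'.X q} (hc : IsCoproduct c) (hc' : IsCoproduct c')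
    (f : K ⟶ K') (g : L ⟶ L') (h : M ⟶ M') (p q n : ℕ)
    (hfg : ∀ z, c' p (q + 1) (n + 1) ((h.f (n + 1)).hom z) =
      TensorProduct.map (f.f p).hom (g.f (q + 1)).hom (c p (q + 1) (n + 1) z))
    (x : M.homology (n + 1)) :
    (torMap (HomologicalComplex.homologyMap f p) (HomologicalComplex.homologyMap g q)).hom
        (torComponent hc p q n x) =
      torComponent hc' p q n ((HomologicalComplex.homologyMap h (n + 1)).hom x) := by
  obtain ⟨z, rfl⟩ := classOf_surjective M (n + 1) x
  rw [homologyMap_classOf_cyclesOfMap, torComponent_classOf, torComponent_classOf]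
  refine torMap_kerToTor (classOf L q) (classOf_surjective L q) (classOf L' q)
    (classOf_surjective L' q) _ _ (cyclesOfMap g q) ?_ (boundariesOfMap g q) rfl _ _ ?_
  · exact LinearMap.ext fun y => (homologyMap_classOf_cyclesOfMap g q y).symm
  -- `δ` measures the dependence on the choice of the projections to the cycles.
  · let δ := chainClass K' p ∘ₗ (f.f p).hom -
      (HomologicalComplex.homologyMap f p).hom ∘ₗ chainClass K p
    have hδ : ∀ y ∈ cyclesOf K p, δ y = 0 := by
      intro y hy
      refine sub_eq_zero.2 ?_
      have h1 := chainClass_coe K' p (cyclesOfMap f p ⟨y, hy⟩)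
      have h2 := chainClass_coe K p ⟨y, hy⟩
      exact h1.trans ((homologyMap_classOf_cyclesOfMap f p ⟨y, hy⟩).symm.trans (congrArg _ h2.symm))
    have h3 := congrArg (TensorProduct.map LinearMap.id (boundariesOfMap g q))
      (hc.map_dBoundaries_eq_zero p q n z.2 δ hδ)
    rw [map_zero, TensorProduct.map_map, LinearMap.id_comp, tensorProduct_map_sub_left,
      LinearMap.sub_apply, sub_eq_zero, boundariesOfMap_dBoundaries,
      ← TensorProduct.map_map, ← hfg, ← boundariesOfMap_dBoundaries, ← TensorProduct.map_map] at h3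
    exact h3

end

/-! ### Decomposition of cycles in a tensor product of complexes -/

section
variable {R : Type} [CommRing R] (K : ChainComplex (ModuleCat.{u} R) ℕ) [IsDomain R]
  [IsPrincipalIdealRing R] [IsFiniteFree K]

/-- The projection from chains to a complement of the cycles. -/
noncomputable def cycleCompl (n : ℕ) : K.X n →ₗ[R] K.X n :=
  LinearMap.id - cycleProj K n

lemma cycleCompl_of_mem (n : ℕ) {x : K.X n} (hx : x ∈ cyclesOf K n) : cycleCompl K n x = 0 :=
  sub_eq_zero.2 (cycleProj_of_mem K n hx).symm

lemma cycleCompl_zero : cycleCompl K 0 = 0 := by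
  refine LinearMap.ext fun x => cycleCompl_of_mem K 0 ?_
  rw [mem_cyclesOf_iff K 0 0 (by simp), K.shape 0 0 (by simp)]
  rfl

lemma d_cycleCompl (n : ℕ) :
    (K.d (n + 1) n).hom ∘ₗ cycleCompl K (n + 1) = (K.d (n + 1) n).hom := by
  refine LinearMap.ext fun x => ?_
  have h := (mem_cyclesOf_iff K (n + 1) n (by simp) _).1 (cycleRetraction K (n + 1) x).2
  refine (map_sub (K.d (n + 1) n).hom x _).trans ?_
  refine (congrArg ((K.d (n + 1) n).hom x - ·) h).trans (sub_zero _)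

lemma cycleProj_d (n : ℕ) :
    cycleProj K n ∘ₗ (K.d (n + 1) n).hom = (K.d (n + 1) n).hom :=
  LinearMap.ext fun x => cycleProj_of_mem K n (d_mem_cyclesOf K n x)

end

section
variable {R : Type} [CommRing R] {K L M : ChainComplex (ModuleCat.{u} R) ℕ}
  {c : ∀ p q n, M.X n →ₗ[R] K.X p ⊗[R] L.X q}
  [IsDomain R] [IsPrincipalIdealRing R] [IsFiniteFree K] [IsFiniteFree L]

/-- The components of a cycle have no part in `C ⊗ C`, on which `d ⊗ d` is injective. -/
lemma IsCoproduct.map_cycleCompl_eq_zero (hc : IsCoproduct c) (p q n : ℕ) {z : M.X (n + 1)}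
    (hz : z ∈ cyclesOf M (n + 1)) :
    TensorProduct.map (cycleCompl K p) (cycleCompl L q) (c p q (n + 1) z) = 0 := by
  cases q with
  | zero => rw [cycleCompl_zero, TensorProduct.map_zero_right, LinearMap.zero_apply]
  | succ q =>
    have h1 := hc.map_dBoundaries_eq_zero p q n hz (cycleCompl K p)
      fun x hx => cycleCompl_of_mem K p hx
    have h2 := lTensor_eq_zero_of_flat (dBoundaries L q) (cycleCompl L (q + 1))
      (fun x hx => cycleCompl_of_mem L (q + 1) ((dBoundaries_eq_zero_iff L q x).1 hx))
      (TensorProduct.map (cycleCompl K p) LinearMap.id (c p (q + 1) (n + 1) z))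
    rw [TensorProduct.map_map, TensorProduct.map_map] at h2
    exact h2 h1

/-- A component of a cycle is the sum of its components in `Z ⊗ Z`, `Z ⊗ C` and `C ⊗ Z`, if `C`
denotes the complement of the cycles `Z`. -/
lemma IsCoproduct.eq_add_add (hc : IsCoproduct c) (p q n : ℕ) {z : M.X (n + 1)}
    (hz : z ∈ cyclesOf M (n + 1)) :
    c p q (n + 1) z = TensorProduct.map (cycleProj K p) (cycleProj L q) (c p q (n + 1) z) +
      TensorProduct.map (cycleProj K p) (cycleCompl L q) (c p q (n + 1) z) +
      TensorProduct.map (cycleCompl K p) (cycleProj L q) (c p q (n + 1) z) := by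
  have h := hc.map_cycleCompl_eq_zero p q n hz
  generalize c p q (n + 1) z = t at h ⊢
  rw [cycleCompl, cycleCompl, tensorProduct_map_sub_left, tensorProduct_map_sub_right,
    tensorProduct_map_sub_right, TensorProduct.map_id] at h
  rw [cycleCompl, cycleCompl, tensorProduct_map_sub_left, tensorProduct_map_sub_right]
  simp only [LinearMap.sub_apply, LinearMap.id_apply] at h ⊢
  rw [← sub_eq_zero, ← h]
  abel

/-- If the component in `Tor₁(H_p(K), H_q(L))` of the class of a cycle vanishes, then the part of
the cycle in `Z_p ⊗ C_{q+1}` and `C_{p+1} ⊗ Z_q` is a boundary. -/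
lemma IsCoproduct.exists_boundary (hc : IsCoproduct c) (p q n : ℕ) (z : cyclesOf M (n + 1))
    (hz : cyclesToTorKer hc p q n z = 0) :
    ∃ e : K.X (p + 1) ⊗[R] L.X (q + 1),
      TensorProduct.map (K.d (p + 1) p).hom LinearMap.id e =
        TensorProduct.map (cycleProj K p) (cycleCompl L (q + 1)) (c p (q + 1) (n + 1) z.1) ∧
      (-1 : R) ^ (p + 1) • TensorProduct.map LinearMap.id (L.d (q + 1) q).hom e =
        TensorProduct.map (cycleCompl K (p + 1)) (cycleProj L q) (c (p + 1) q (n + 1) z.1) := by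
  -- The element `(retraction ⊗ d) t` of `Z_p ⊗ B_q` vanishes in `H_p ⊗ B_q`, and so comes from an
  -- element of `K_{p+1} ⊗ B_q`, which is lifted to an element `e` of `K_{p+1} ⊗ L_{q+1}`.
  have hw : TensorProduct.map (classOf K p) LinearMap.id
      (TensorProduct.map (cycleRetraction K p) (dBoundaries L q)
        (c p (q + 1) (n + 1) z.1)) = 0 := by
    rw [TensorProduct.map_map]
    exact congrArg Subtype.val hz
  have hrel := hc.of_mem_cyclesOf p q n z.2
  have hcd := hc.map_dBoundaries_eq_zero p q n z.2 (cycleCompl K p)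
    fun x hx => cycleCompl_of_mem K p hx
  generalize c p (q + 1) (n + 1) z.1 = t at *
  generalize c (p + 1) q (n + 1) z.1 = t' at *
  obtain ⟨u, hu⟩ := (rTensor_exact (boundariesOf L q) (exact_dCycles_classOf K p)
    (classOf_surjective K p) _).1 hw
  obtain ⟨e, rfl⟩ := LinearMap.lTensor_surjective (K.X (p + 1)) (dBoundaries_surjective L q) u
  have hu : TensorProduct.map (dCycles K p) (dBoundaries L q) e =
      TensorProduct.map (cycleRetraction K p) (dBoundaries L q) t := by
    rw [← hu, LinearMap.lTensor, LinearMap.rTensor, TensorProduct.map_map]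
    rfl
  have hι : ∀ {N : Type u} [AddCommGroup N] [Module R N] (f : boundariesOf L q →ₗ[R] N),
      TensorProduct.map (K.d (p + 1) p).hom (f ∘ₗ dBoundaries L q) e =
        TensorProduct.map (cycleProj K p) (f ∘ₗ dBoundaries L q) t := by
    intro N _ _ f
    have := congrArg (TensorProduct.map (cyclesOf K p).subtype f) hu
    rwa [TensorProduct.map_map, TensorProduct.map_map] at this
  have hι' : TensorProduct.map (K.d (p + 1) p).hom (L.d (q + 1) q).hom e =
        TensorProduct.map (cycleProj K p) (L.d (q + 1) q).hom t :=
    hι ((cyclesOf L q).subtype ∘ₗ (boundariesOf L q).subtype)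
  refine ⟨TensorProduct.map (cycleCompl K (p + 1)) (cycleCompl L (q + 1)) e, ?_, ?_⟩
  -- Elements of `C_{q+1}` and of `C_{p+1}` are determined by their boundaries.
  · have h := lTensor_eq_zero_of_flat (dBoundaries L q) (cycleCompl L (q + 1))
      (fun x hx => cycleCompl_of_mem L (q + 1) ((dBoundaries_eq_zero_iff L q x).1 hx))
      (TensorProduct.map (K.d (p + 1) p).hom LinearMap.id e -
        TensorProduct.map (cycleProj K p) LinearMap.id t)
    simp only [map_sub, TensorProduct.map_map, LinearMap.id_comp, LinearMap.comp_id,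
      sub_eq_zero] at h
    rw [TensorProduct.map_map, d_cycleCompl, LinearMap.id_comp]
    exact h (hι LinearMap.id)
  · have h := rTensor_eq_zero_of_flat (K.d (p + 1) p).hom (cycleCompl K (p + 1))
      (fun x hx => cycleCompl_of_mem K (p + 1)
        ((mem_cyclesOf_iff K (p + 1) p (by simp) x).2 hx))
      (TensorProduct.map LinearMap.id (cycleProj L q) t' +
        (-1 : R) ^ p • TensorProduct.map LinearMap.id (L.d (q + 1) q).hom e)
    have h1 := congrArg (TensorProduct.map LinearMap.id (cycleProj L q)) hrel
    have h2 := congrArg (TensorProduct.map (LinearMap.id : K.X p →ₗ[R] K.X p)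
      ((cyclesOf L q).subtype ∘ₗ (boundariesOf L q).subtype)) hcd
    rw [map_zero, TensorProduct.map_map] at h2
    have h2 : TensorProduct.map (cycleCompl K p) (L.d (q + 1) q).hom t = 0 := h2
    rw [cycleCompl, tensorProduct_map_sub_left, LinearMap.sub_apply, sub_eq_zero] at h2
    simp only [map_neg, map_smul, map_add, TensorProduct.map_map, LinearMap.id_comp,
      LinearMap.comp_id, cycleProj_d] at h h1
    rw [h1, hι', h2, neg_add_cancel] at h
    rw [TensorProduct.map_map, d_cycleCompl, LinearMap.id_comp, pow_succ, mul_neg_one, neg_smul,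
      eq_comm, ← add_eq_zero_iff_eq_neg]
    exact h rfl

end

section
variable {R : Type} [CommRing R] {K L : ChainComplex (ModuleCat.{u} R) ℕ}

/-- Every element of the model `torKer` of `Tor₁(H_p(K), H_q(L))` comes from elements of
`Z_p ⊗ L_{q+1}` and `K_{p+1} ⊗ Z_q` with the same differential. -/
lemma exists_of_torKer (p q : ℕ) (v : torKer K L p q) :
    ∃ (y : cyclesOf K p ⊗[R] L.X (q + 1)) (w : K.X (p + 1) ⊗[R] cyclesOf L q),
      TensorProduct.map (classOf K p) (dBoundaries L q) y = v.1 ∧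
      TensorProduct.map LinearMap.id (dCycles L q) y =
        TensorProduct.map (dCycles K p) LinearMap.id w := by
  obtain ⟨t, ht⟩ := LinearMap.rTensor_surjective (boundariesOf L q) (classOf_surjective K p) v.1
  obtain ⟨y, rfl⟩ := LinearMap.lTensor_surjective (cyclesOf K p) (dBoundaries_surjective L q) t
  have h : TensorProduct.map (classOf K p) LinearMap.id
      (TensorProduct.map LinearMap.id (dCycles L q) y) = 0 := by
    have h1 := LinearMap.mem_ker.1 v.2
    rw [← ht, LinearMap.lTensor, LinearMap.lTensor, LinearMap.rTensor, TensorProduct.map_map,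
      TensorProduct.map_map] at h1
    rw [TensorProduct.map_map]
    exact h1
  obtain ⟨w, hw⟩ := (rTensor_exact (cyclesOf L q) (exact_dCycles_classOf K p)
    (classOf_surjective K p) _).1 h
  refine ⟨y, w, ?_, hw.symm⟩
  rw [← ht, LinearMap.lTensor, LinearMap.rTensor, TensorProduct.map_map]
  rfl

/-- The model `torKer` of `Tor₁(H_p(K), H_q(L))` vanishes if one of the homology modules is
torsion-free. -/
lemma subsingleton_torKer [IsDomain R] [IsPrincipalIdealRing R] [IsFiniteFree L] (p q : ℕ)
    (h : Module.IsTorsionFree R (K.homology p) ∨ Module.IsTorsionFree R (L.homology q)) :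
    Subsingleton (torKer K L p q) := by
  have hinj : Function.Injective ((boundariesOf L q).subtype.lTensor (K.homology p)) := by
    rcases h with h | h
    · exact Module.Flat.lTensor_preserves_injective_linearMap _ (Submodule.subtype_injective _)
    · have : Module.Finite R (L.homology q) :=
        Module.Finite.of_surjective (classOf L q) (classOf_surjective L q)
      obtain ⟨s, hs⟩ := Module.projective_lifting_property (classOf L q) LinearMap.id
        (classOf_surjective L q)
      -- A section of `Z_q → H_q` gives a retraction of `B_q → Z_q`.
      let r : cyclesOf L q →ₗ[R] boundariesOf L q :=
        (LinearMap.id - s ∘ₗ classOf L q).codRestrict _ fun z => by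
          have h1 := LinearMap.congr_fun hs (classOf L q z)
          rw [LinearMap.mem_ker, LinearMap.sub_apply, map_sub, sub_eq_zero]
          exact h1.symm
      have hr : r ∘ₗ (boundariesOf L q).subtype = LinearMap.id := by
        refine LinearMap.ext fun z => Subtype.ext ?_
        refine (congrArg (fun t => z.1 - s t) z.2).trans ?_
        rw [map_zero, sub_zero]
        rfl
      refine Function.LeftInverse.injective (g := r.lTensor (K.homology p)) fun x => ?_
      rw [← LinearMap.comp_apply, ← LinearMap.lTensor_comp, hr, LinearMap.lTensor_id]
      rfl
  rw [torKer, LinearMap.ker_eq_bot.2 hinj]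
  infer_instance

end

/-! ### The algebraic Künneth sequence -/

instance finite_torBidegrees (k l : ℕ) : Finite (TorBidegrees k l) :=
  Finite.of_injective
    (fun d : TorBidegrees k l =>
      (⟨((d.1.1.1 + 1, d.1.1.2), d.1.2), by have := d.2; dsimp only; omega⟩ : Bidegrees k l))
    fun d d' h => by
      simp only [Subtype.mk.injEq, Prod.mk.injEq, Nat.add_right_cancel_iff] at h
      exact Subtype.ext (Prod.ext (Prod.ext h.1.1 h.1.2) h.2)

noncomputable instance fintype_torBidegrees (k l : ℕ) : Fintype (TorBidegrees k l) :=
  Fintype.ofFinite _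

lemma sumDesc_lof {R : Type} [CommRing R] {ι : Type} [DecidableEq ι] {M : ι → ModuleCat.{u} R}
    {P : ModuleCat.{u} R} (g : ∀ i, M i ⟶ P) (i : ι) (x : M i) :
    (sumDesc g).hom (DirectSum.lof R ι (fun i => M i) i x) = (g i).hom x :=
  DirectSum.toModule_lof (M := fun i => M i) R (φ := fun i => (g i).hom) i x

section
variable {R : Type} [CommRing R] {ι : Type} [Fintype ι] [DecidableEq ι]
  {M : ι → ModuleCat.{u} R} {N : Type*} [AddCommGroup N] [Module R N]

/-- The map into a finite direct sum with the given components. -/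
noncomputable def sumLift (f : ∀ i, N →ₗ[R] M i) : N →ₗ[R] ⨁ i, M i :=
  ∑ i, DirectSum.lof R ι (fun i => M i) i ∘ₗ f i

lemma sumLift_apply (f : ∀ i, N →ₗ[R] M i) (x : N) (i : ι) : sumLift f x i = f i x := by
  rw [sumLift, LinearMap.sum_apply, DirectSum.sum_apply, Finset.sum_eq_single i]
  · exact DirectSum.of_eq_same _ _
  · intro j _ hj
    exact DirectSum.of_eq_of_ne _ _ _ hj.symm
  · simp

lemma sumLift_eq_zero_iff (f : ∀ i, N →ₗ[R] M i) (x : N) :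
    sumLift f x = 0 ↔ ∀ i, f i x = 0 := by
  refine ⟨fun h i => ?_, fun h => ?_⟩
  · rw [← sumLift_apply f x i, h]
    rfl
  · exact DFinsupp.ext fun i => (sumLift_apply f x i).trans (h i)

lemma sumLift_surjective (f : ∀ i, N →ₗ[R] M i)
    (h : ∀ i x, ∃ z, f i z = x ∧ ∀ j, j ≠ i → f j z = 0) : Function.Surjective (sumLift f) := by
  rw [← LinearMap.range_eq_top, ← top_le_iff]
  rintro x -
  induction x using DirectSum.induction_on with
  | zero => exact Submodule.zero_mem _
  | add x y hx hy => exact Submodule.add_mem _ hx hy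
  | of i x =>
    obtain ⟨z, hz, hz'⟩ := h i x
    refine ⟨z, DFinsupp.ext fun j => (sumLift_apply f z j).trans ?_⟩
    by_cases hj : j = i
    · subst hj
      exact hz.trans (DirectSum.of_eq_same (β := fun i => M i) j x).symm
    · exact (hz' j hj).trans (DirectSum.of_eq_of_ne (β := fun i => M i) i j x hj).symm

lemma sumDesc_comp_sumLift_eq_id {P : ModuleCat.{u} R} (g : ∀ i, M i ⟶ P) (f : ∀ i, P →ₗ[R] M i)
    (h : ∀ i x, f i ((g i).hom x) = x) (h' : ∀ i j, i ≠ j → ∀ x, f j ((g i).hom x) = 0) :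
    sumDesc g ≫ ModuleCat.ofHom (sumLift f) = 𝟙 (sumObj M) := by
  ext1
  refine DirectSum.linearMap_ext R fun i => LinearMap.ext fun x => ?_
  refine (congrArg (sumLift f) (sumDesc_lof g i x)).trans ?_
  refine DFinsupp.ext fun j => (sumLift_apply f _ j).trans ?_
  by_cases hj : i = j
  · subst hj
    exact (h i x).trans (DirectSum.of_eq_same (β := fun i => M i) i x).symm
  · exact (h' i j hj x).trans (DirectSum.of_eq_of_ne (β := fun i => M i) i j x (Ne.symm hj)).symm

lemma sumDesc_comp_sumLift_eq_zero {κ : Type} [DecidableEq κ] {T : κ → ModuleCat.{u} R}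
    {P : ModuleCat.{u} R} (g : ∀ i, T i ⟶ P) (f : ∀ i, P →ₗ[R] M i)
    (h : ∀ i j x, f j ((g i).hom x) = 0) :
    sumDesc g ≫ ModuleCat.ofHom (sumLift f) = (0 : sumObj T ⟶ sumObj M) := by
  ext1
  refine DirectSum.linearMap_ext R fun i => LinearMap.ext fun x => ?_
  refine (congrArg (sumLift f) (sumDesc_lof g i x)).trans ?_
  exact (sumLift_eq_zero_iff f _).2 fun j => h i j x

lemma sumLift_comp_sumMap {M' : ι → ModuleCat.{u} R} {P P' : ModuleCat.{u} R}
    (f : ∀ i, P →ₗ[R] M i) (f' : ∀ i, P' →ₗ[R] M' i) (φ : ∀ i, M i ⟶ M' i) (ψ : P ⟶ P')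
    (h : ∀ i x, (φ i).hom (f i x) = f' i (ψ.hom x)) :
    ModuleCat.ofHom (sumLift f) ≫ sumMap φ = ψ ≫ ModuleCat.ofHom (sumLift f') := by
  ext1
  refine LinearMap.ext fun x => DFinsupp.ext fun i => ?_
  refine (congrArg (φ i).hom (sumLift_apply f x i)).trans ((h i x).trans ?_)
  exact (sumLift_apply f' (ψ.hom x) i).symm

end

/-- A sum over the bidegrees of the torsion term, with the second degree raised by `1`. -/
lemma sum_torBidegrees_right {A : Type*} [AddCommMonoid A] (k l : ℕ) (F : ℕ → ℕ → ℕ → ℕ → A)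
    (hF : ∀ p a b, F p a 0 b = 0) :
    ∑ d : TorBidegrees k l, F d.1.1.1 d.1.1.2 (d.1.2.1 + 1) d.1.2.2 =
      ∑ d : Bidegrees k l, F d.1.1.1 d.1.1.2 d.1.2.1 d.1.2.2 := by
  refine Fintype.sum_of_injective
    (fun d => ⟨(d.1.1, (d.1.2.1 + 1, d.1.2.2)), by have := d.2; dsimp only; omega⟩)
    (fun d d' hd => ?_) _ _ (fun d hd => ?_) (fun d => rfl)
  · simp only [Subtype.mk.injEq, Prod.mk.injEq, Nat.add_right_cancel_iff] at hd
    exact Subtype.ext (Prod.ext hd.1 (Prod.ext hd.2.1 hd.2.2))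
  · obtain ⟨⟨⟨p, a⟩, q, b⟩, hp, hl⟩ := d
    cases q with
    | zero => exact hF p a b
    | succ q => exact absurd ⟨⟨((p, a), (q, b)), hp, hl⟩, rfl⟩ hd

/-- A sum over the bidegrees of the torsion term, with the first degree raised by `1`. -/
lemma sum_torBidegrees_left {A : Type*} [AddCommMonoid A] (k l : ℕ) (F : ℕ → ℕ → ℕ → ℕ → A)
    (hF : ∀ a q b, F 0 a q b = 0) :
    ∑ d : TorBidegrees k l, F (d.1.1.1 + 1) d.1.1.2 d.1.2.1 d.1.2.2 =
      ∑ d : Bidegrees k l, F d.1.1.1 d.1.1.2 d.1.2.1 d.1.2.2 := by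
  refine Fintype.sum_of_injective
    (fun d => ⟨((d.1.1.1 + 1, d.1.1.2), d.1.2), by have := d.2; dsimp only; omega⟩)
    (fun d d' hd => ?_) _ _ (fun d hd => ?_) (fun d => rfl)
  · simp only [Subtype.mk.injEq, Prod.mk.injEq, Nat.add_right_cancel_iff] at hd
    exact Subtype.ext (Prod.ext (Prod.ext hd.1.1 hd.1.2) hd.2)
  · obtain ⟨⟨⟨p, a⟩, q, b⟩, hp, hl⟩ := d
    cases p with
    | zero => exact hF a q b
    | succ p => exact absurd ⟨⟨((p, a), (q, b)), by simp only at hp; dsimp only; omega, hl⟩, rfl⟩ hd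

section
variable {R : Type} [CommRing R] {K L M : ChainComplex (ModuleCat.{u} R) ℕ}

/-- The product of two cycles under a pairing of complexes, extended to the tensor product of the
modules of cycles, represents the product of their classes. -/
lemma exists_classOf_eq_homologyPairing {p q n : ℕ} {μ : K.X p →ₗ[R] L.X q →ₗ[R] M.X n}
    (h : IsCyclePairing μ) (t : cyclesOf K p ⊗[R] cyclesOf L q) :
    ∃ ht : TensorProduct.lift μ
        (TensorProduct.map (cyclesOf K p).subtype (cyclesOf L q).subtype t) ∈ cyclesOf M n,
      classOf M n ⟨_, ht⟩ =
        (homologyPairing μ h).hom (TensorProduct.map (classOf K p) (classOf L q) t) := by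
  induction t using TensorProduct.induction_on with
  | zero =>
    simp only [map_zero]
    exact ⟨Submodule.zero_mem _, map_zero _⟩
  | tmul x y => exact ⟨h.cycle x.1 x.2 y.1 y.2, (homologyPairing_classOf μ h x y).symm⟩
  | add s t hs ht =>
    obtain ⟨hs, hs'⟩ := hs
    obtain ⟨ht, ht'⟩ := ht
    simp only [map_add]
    refine ⟨Submodule.add_mem _ hs ht, ?_⟩
    rw [← hs', ← ht']
    exact map_add (classOf M n) ⟨_, hs⟩ ⟨_, ht⟩

variable {c : ∀ p q n, M.X n →ₗ[R] K.X p ⊗[R] L.X q} [IsDomain R] [IsPrincipalIdealRing R]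
  [IsFiniteFree K] [IsFiniteFree L]

/-- The map `torComponent`, with its degree given by an equation. -/
noncomputable def torComponentOf (hc : IsCoproduct c) (p q k : ℕ) (hk : p + q + 1 = k) :
    M.homology k →ₗ[R] torObj (K.homology p) (L.homology q) :=
  hk ▸ torComponent hc p q (p + q)

lemma torComponentOf_succ (hc : IsCoproduct c) (p q n : ℕ) (hk : p + q + 1 = n + 1) :
    torComponentOf hc p q (n + 1) hk = torComponent hc p q n := by
  obtain rfl : n = p + q := by omega
  rfl

lemma torComponentOf_classOf_eq_zero_iff (hc : IsCoproduct c) (p q n : ℕ) (hk : p + q + 1 = n + 1)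
    (z : cyclesOf M (n + 1)) :
    torComponentOf hc p q (n + 1) hk (classOf M (n + 1) z) = 0 ↔
      cyclesToTorKer hc p q n z = 0 := by
  rw [torComponentOf_succ, torComponent_classOf]
  exact map_eq_zero_iff _ (kerToTor_bijective _ _ _).1

end

section
variable {R : Type} [CommRing R]
  {K L M : ℕ → ChainComplex (ModuleCat.{u} R) ℕ}

/-- Families of maps `c : M_n → K_p ⊗ L_q` and `μ : K_p ⊗ L_q → M_n`, compatible with a further
grading by a length, with the properties of the Alexander–Whitney map and the shuffle product: both
are chain maps, `c ∘ μ` is the identity, and `μ ∘ c` induces the identity in homology. -/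
structure IsEilenbergZilber
    (c : ∀ a b l p q n, (M l).X n →ₗ[R] (K a).X p ⊗[R] (L b).X q)
    (μ : ∀ p a q b n l, (K a).X p →ₗ[R] (L b).X q →ₗ[R] (M l).X n) : Prop where
  isCoproduct : ∀ a b l, a + b = l → IsCoproduct (c a b l)
  isCyclePairing : ∀ p a q b n l, p + q = n → a + b = l → IsCyclePairing (μ p a q b n l)
  map_d : ∀ p a q b n l, p + q = n → a + b = l → ∀ x y,
    ((M l).d (n + 2) (n + 1)).hom (μ (p + 1) a (q + 1) b (n + 2) l x y) =
      μ p a (q + 1) b (n + 1) l (((K a).d (p + 1) p).hom x) y +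
        (-1 : R) ^ (p + 1) • μ (p + 1) a q b (n + 1) l x (((L b).d (q + 1) q).hom y)
  map_d_left : ∀ p a q b n l, p + q = n → a + b = l → ∀ x, ∀ y ∈ cyclesOf (L b) q,
    ((M l).d (n + 1) n).hom (μ (p + 1) a q b (n + 1) l x y) =
      μ p a q b n l (((K a).d (p + 1) p).hom x) y
  map_d_right : ∀ p a q b n l, p + q = n → a + b = l → ∀ x ∈ cyclesOf (K a) p, ∀ y,
    ((M l).d (n + 1) n).hom (μ p a (q + 1) b (n + 1) l x y) =
      (-1 : R) ^ p • μ p a q b n l x (((L b).d (q + 1) q).hom y)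
  coproduct_self : ∀ p a q b n l, p + q = n → a + b = l → ∀ x y,
    c a b l p q n (μ p a q b n l x y) = x ⊗ₜ y
  coproduct_of_ne : ∀ p a q b n l, p + q = n → a + b = l → ∀ p' a' q' b',
    ¬ (p = p' ∧ a = a') → ∀ x y, c a' b' l p' q' n (μ p a q b n l x y) = 0
  exists_homotopy : ∀ n l, ∀ z ∈ cyclesOf (M l) n, ∃ e, ((M l).d (n + 1) n).hom e =
    (∑ d : Bidegrees n l, TensorProduct.lift (μ d.1.1.1 d.1.1.2 d.1.2.1 d.1.2.2 n l)
      (c d.1.1.2 d.1.2.2 l d.1.1.1 d.1.2.1 n z)) - z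

namespace IsEilenbergZilber

variable {c : ∀ a b l p q n, (M l).X n →ₗ[R] (K a).X p ⊗[R] (L b).X q}
  {μ : ∀ p a q b n l, (K a).X p →ₗ[R] (L b).X q →ₗ[R] (M l).X n}

/-- The sum of the products in homology, in bidegree `(k, l)`. -/
noncomputable def product (h : IsEilenbergZilber c μ) (k l : ℕ) :
    sumObj (fun d : Bidegrees k l => tensorObj ((K d.1.1.2).homology d.1.1.1)
      ((L d.1.2.2).homology d.1.2.1)) ⟶ (M l).homology k :=
  sumDesc fun d => homologyPairing _ (h.isCyclePairing _ _ _ _ _ _ d.2.1 d.2.2)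

lemma coproduct_lift (h : IsEilenbergZilber c μ) {p a q b n l : ℕ} (hn : p + q = n)
    (hl : a + b = l) (t : (K a).X p ⊗[R] (L b).X q) :
    c a b l p q n (TensorProduct.lift (μ p a q b n l) t) = t := by
  induction t using TensorProduct.induction_on with
  | zero => simp only [map_zero]
  | tmul x y => exact h.coproduct_self p a q b n l hn hl x y
  | add s t hs ht => rw [map_add, map_add, hs, ht]

lemma coproduct_lift_of_ne (h : IsEilenbergZilber c μ) {p a q b n l : ℕ} (hn : p + q = n)
    (hl : a + b = l) {p' a' : ℕ} (q' b' : ℕ) (hne : ¬ (p = p' ∧ a = a'))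
    (t : (K a).X p ⊗[R] (L b).X q) :
    c a' b' l p' q' n (TensorProduct.lift (μ p a q b n l) t) = 0 := by
  induction t using TensorProduct.induction_on with
  | zero => simp only [map_zero]
  | tmul x y => exact h.coproduct_of_ne p a q b n l hn hl p' a' q' b' hne x y
  | add s t hs ht => rw [map_add, map_add, hs, ht, add_zero]

lemma d_lift (h : IsEilenbergZilber c μ) {p a q b n l : ℕ} (hn : p + q = n)
    (hl : a + b = l) (t : (K a).X (p + 1) ⊗[R] (L b).X (q + 1)) :
    ((M l).d (n + 2) (n + 1)).hom (TensorProduct.lift (μ (p + 1) a (q + 1) b (n + 2) l) t) =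
      TensorProduct.lift (μ p a (q + 1) b (n + 1) l)
          (TensorProduct.map ((K a).d (p + 1) p).hom LinearMap.id t) +
        TensorProduct.lift (μ (p + 1) a q b (n + 1) l)
          ((-1 : R) ^ (p + 1) • TensorProduct.map LinearMap.id ((L b).d (q + 1) q).hom t) := by
  induction t using TensorProduct.induction_on with
  | zero => simp only [map_zero, smul_zero, add_zero]
  | tmul x y =>
    rw [map_smul]
    exact h.map_d p a q b n l hn hl x y
  | add s t hs ht =>
    simp only [map_add, smul_add, hs, ht]
    abel

lemma d_lift_left (h : IsEilenbergZilber c μ) {p a q b n l : ℕ} (hn : p + q = n)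
    (hl : a + b = l) (t : (K a).X (p + 1) ⊗[R] cyclesOf (L b) q) :
    ((M l).d (n + 1) n).hom (TensorProduct.lift (μ (p + 1) a q b (n + 1) l)
        (TensorProduct.map LinearMap.id (cyclesOf (L b) q).subtype t)) =
      TensorProduct.lift (μ p a q b n l)
        (TensorProduct.map (cyclesOf (K a) p).subtype (cyclesOf (L b) q).subtype
          (TensorProduct.map (dCycles (K a) p) LinearMap.id t)) := by
  induction t using TensorProduct.induction_on with
  | zero => simp only [map_zero]
  | tmul x y => exact h.map_d_left p a q b n l hn hl x y.1 y.2
  | add s t hs ht => simp only [map_add, hs, ht]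

lemma d_lift_right (h : IsEilenbergZilber c μ) {p a q b n l : ℕ} (hn : p + q = n)
    (hl : a + b = l) (t : cyclesOf (K a) p ⊗[R] (L b).X (q + 1)) :
    ((M l).d (n + 1) n).hom (TensorProduct.lift (μ p a (q + 1) b (n + 1) l)
        (TensorProduct.map (cyclesOf (K a) p).subtype LinearMap.id t)) =
      (-1 : R) ^ p • TensorProduct.lift (μ p a q b n l)
        (TensorProduct.map (cyclesOf (K a) p).subtype (cyclesOf (L b) q).subtype
          (TensorProduct.map LinearMap.id (dCycles (L b) q) t)) := by
  induction t using TensorProduct.induction_on with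
  | zero => simp only [map_zero, smul_zero]
  | tmul x y => exact h.map_d_right p a q b n l hn hl x.1 x.2 y
  | add s t hs ht => simp only [map_add, smul_add, hs, ht]

variable [IsDomain R] [IsPrincipalIdealRing R] [∀ a, IsFiniteFree (K a)]

/-- The product of a chain with a cycle does not contribute to the component in
`Tor₁(H_{p'}(K), H_{q'}(L))`. -/
lemma map_dBoundaries_coproduct (h : IsEilenbergZilber c μ) {p a q b n l : ℕ} (hn : p + q = n)
    (hl : a + b = l) {p' a' q' b' : ℕ} (hn' : p' + q' + 1 = n) (hl' : a' + b' = l)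
    (x : (K a).X p) (y : cyclesOf (L b) q) :
    TensorProduct.map (chainClass (K a') p') (dBoundaries (L b') q')
      (c a' b' l p' (q' + 1) n (μ p a q b n l x y.1)) = 0 := by
  by_cases hne : p = p' ∧ a = a'
  · obtain ⟨rfl, rfl⟩ := hne
    obtain rfl : q = q' + 1 := by omega
    obtain rfl : b = b' := by omega
    rw [h.coproduct_self _ _ _ _ _ _ hn hl, TensorProduct.map_tmul,
      (dBoundaries_eq_zero_iff _ _ _).2 y.2, TensorProduct.tmul_zero]
  · rw [h.coproduct_of_ne _ _ _ _ _ _ hn hl _ _ _ _ hne, map_zero]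

lemma map_dBoundaries_coproduct_lift (h : IsEilenbergZilber c μ) {p a q b n l : ℕ}
    (hn : p + q = n) (hl : a + b = l) {p' a' q' b' : ℕ} (hn' : p' + q' + 1 = n)
    (hl' : a' + b' = l) (t : (K a).X p ⊗[R] cyclesOf (L b) q) :
    TensorProduct.map (chainClass (K a') p') (dBoundaries (L b') q')
      (c a' b' l p' (q' + 1) n (TensorProduct.lift (μ p a q b n l)
        (TensorProduct.map LinearMap.id (cyclesOf (L b) q).subtype t))) = 0 := by
  induction t using TensorProduct.induction_on with
  | zero => simp only [map_zero]
  | tmul x y => exact h.map_dBoundaries_coproduct hn hl hn' hl' x y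
  | add s t hs ht => simp only [map_add, hs, ht, add_zero]

variable [∀ b, IsFiniteFree (L b)]

/-- The sum of the maps `torComponentOf`, in bidegree `(k, l)`. -/
noncomputable def connecting (h : IsEilenbergZilber c μ) (k l : ℕ) :
    (M l).homology k ⟶ sumObj (fun d : TorBidegrees k l =>
      torObj ((K d.1.1.2).homology d.1.1.1) ((L d.1.2.2).homology d.1.2.1)) :=
  ModuleCat.ofHom (sumLift fun d =>
    torComponentOf (h.isCoproduct d.1.1.2 d.1.2.2 l d.2.2) d.1.1.1 d.1.2.1 k d.2.1)

/-- The retraction of the product in homology given by the coproduct, in bidegree `(k, l)`. -/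
noncomputable def retraction (h : IsEilenbergZilber c μ) (k l : ℕ) :
    (M l).homology k ⟶ sumObj (fun d : Bidegrees k l => tensorObj ((K d.1.1.2).homology d.1.1.1)
      ((L d.1.2.2).homology d.1.2.1)) :=
  ModuleCat.ofHom (sumLift fun d =>
    homologyCoproduct (h.isCoproduct d.1.1.2 d.1.2.2 l d.2.2) d.1.1.1 d.1.2.1 k)

lemma homologyCoproduct_homologyPairing (h : IsEilenbergZilber c μ) {p a q b n l : ℕ}
    (hn : p + q = n) (hl : a + b = l) (t : (K a).homology p ⊗[R] (L b).homology q) :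
    homologyCoproduct (h.isCoproduct a b l hl) p q n
      ((homologyPairing _ (h.isCyclePairing p a q b n l hn hl)).hom t) = t := by
  induction t using TensorProduct.induction_on with
  | zero => simp only [map_zero]
  | tmul x y =>
    obtain ⟨x, rfl⟩ := classOf_surjective _ _ x
    obtain ⟨y, rfl⟩ := classOf_surjective _ _ y
    rw [homologyPairing_classOf, homologyCoproduct_classOf,
      h.coproduct_self p a q b n l hn hl, TensorProduct.map_tmul, chainClass_coe, chainClass_coe]
  | add s t hs ht => rw [map_add, map_add, hs, ht]

lemma homologyCoproduct_homologyPairing_of_ne (h : IsEilenbergZilber c μ) {p a q b n l : ℕ}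
    (hn : p + q = n) (hl : a + b = l) {p' a' : ℕ} (q' b' : ℕ) (hl' : a' + b' = l)
    (hne : ¬ (p = p' ∧ a = a')) (t : (K a).homology p ⊗[R] (L b).homology q) :
    homologyCoproduct (h.isCoproduct a' b' l hl') p' q' n
      ((homologyPairing _ (h.isCyclePairing p a q b n l hn hl)).hom t) = 0 := by
  induction t using TensorProduct.induction_on with
  | zero => simp only [map_zero]
  | tmul x y =>
    obtain ⟨x, rfl⟩ := classOf_surjective _ _ x
    obtain ⟨y, rfl⟩ := classOf_surjective _ _ y
    rw [homologyPairing_classOf, homologyCoproduct_classOf,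
      h.coproduct_of_ne p a q b n l hn hl p' a' q' b' hne, map_zero]
  | add s t hs ht => rw [map_add, map_add, hs, ht, add_zero]

lemma product_retraction (h : IsEilenbergZilber c μ) (k l : ℕ) :
    h.product k l ≫ h.retraction k l = 𝟙 _ := by
  refine sumDesc_comp_sumLift_eq_id _ _
    (fun d => h.homologyCoproduct_homologyPairing d.2.1 d.2.2) fun d d' hd =>
      h.homologyCoproduct_homologyPairing_of_ne d.2.1 d.2.2 _ _ d'.2.2 ?_
  rintro ⟨h1, h2⟩
  have h3 := d.2
  have h4 := d'.2
  exact hd (Subtype.ext (Prod.ext (Prod.ext h1 h2) (Prod.ext (by omega) (by omega))))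

lemma torComponentOf_homologyPairing (h : IsEilenbergZilber c μ) {p a q b n l : ℕ}
    (hn : p + q = n) (hl : a + b = l) {p' a' q' b' : ℕ} (hn' : p' + q' + 1 = n)
    (hl' : a' + b' = l) (t : (K a).homology p ⊗[R] (L b).homology q) :
    torComponentOf (h.isCoproduct a' b' l hl') p' q' n hn'
      ((homologyPairing _ (h.isCyclePairing p a q b n l hn hl)).hom t) = 0 := by
  induction t using TensorProduct.induction_on with
  | zero => simp only [map_zero]
  | tmul x y =>
    obtain ⟨x, rfl⟩ := classOf_surjective _ _ x
    obtain ⟨y, rfl⟩ := classOf_surjective _ _ y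
    subst hn'
    rw [homologyPairing_classOf, torComponentOf_classOf_eq_zero_iff]
    exact Subtype.ext (h.map_dBoundaries_coproduct hn hl rfl hl' x.1 y)
  | add s t hs ht => rw [map_add, map_add, hs, ht, add_zero]

lemma product_connecting (h : IsEilenbergZilber c μ) (k l : ℕ) :
    h.product k l ≫ h.connecting k l = 0 :=
  sumDesc_comp_sumLift_eq_zero _ _ fun d d' =>
    h.torComponentOf_homologyPairing d.2.1 d.2.2 d'.2.1 d'.2.2

/-- If the components in `Tor₁` of the class of a cycle `z` vanish, then `z` is homologous to the
sum of the products of its components in the tensor products of cycles. -/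
lemma exists_homotopy_cycleProj (h : IsEilenbergZilber c μ) (k l : ℕ) (z : cyclesOf (M l) k)
    (hz : (h.connecting k l).hom (classOf (M l) k z) = 0) :
    ∃ e, ((M l).d (k + 1) k).hom e =
      (∑ d : Bidegrees k l, TensorProduct.lift (μ d.1.1.1 d.1.1.2 d.1.2.1 d.1.2.2 k l)
        (TensorProduct.map (cycleProj (K d.1.1.2) d.1.1.1) (cycleProj (L d.1.2.2) d.1.2.1)
          (c d.1.1.2 d.1.2.2 l d.1.1.1 d.1.2.1 k z.1))) - z.1 := by
  obtain ⟨e₀, he₀⟩ := h.exists_homotopy k l z.1 z.2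
  cases k with
  | zero =>
    refine ⟨e₀, he₀.trans (congrArg (· - z.1) (Finset.sum_congr rfl fun d _ => ?_))⟩
    obtain ⟨⟨⟨p, a⟩, q, b⟩, hp, hl⟩ := d
    obtain ⟨rfl, rfl⟩ : p = 0 ∧ q = 0 := by simp only at hp; omega
    have hp : ∀ K : ChainComplex (ModuleCat.{u} R) ℕ, [IsFiniteFree K] →
        cycleProj K 0 = LinearMap.id := fun K _ => (sub_eq_zero.1 (cycleCompl_zero K)).symm
    rw [hp, hp, TensorProduct.map_id, LinearMap.id_apply]
  | succ n =>
    have hz' : ∀ d : TorBidegrees (n + 1) l,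
        cyclesToTorKer (h.isCoproduct d.1.1.2 d.1.2.2 l d.2.2) d.1.1.1 d.1.2.1 n z = 0 := fun d =>
      (torComponentOf_classOf_eq_zero_iff _ _ _ _ d.2.1 z).1 ((sumLift_eq_zero_iff _ _).1 hz d)
    have he := fun d : TorBidegrees (n + 1) l =>
      (h.isCoproduct d.1.1.2 d.1.2.2 l d.2.2).exists_boundary d.1.1.1 d.1.2.1 n z (hz' d)
    choose e he using he
    -- `X` and `Y` are the parts of the cycle in `Z ⊗ C` and in `C ⊗ Z`. The boundaries given by
    -- `exists_boundary` contain one term of each, with indices shifted against each other.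
    let X : ℕ → ℕ → ℕ → ℕ → (M l).X (n + 1) := fun p a q b =>
      TensorProduct.lift (μ p a q b (n + 1) l)
        (TensorProduct.map (cycleProj (K a) p) (cycleCompl (L b) q) (c a b l p q (n + 1) z.1))
    let Y : ℕ → ℕ → ℕ → ℕ → (M l).X (n + 1) := fun p a q b =>
      TensorProduct.lift (μ p a q b (n + 1) l)
        (TensorProduct.map (cycleCompl (K a) p) (cycleProj (L b) q) (c a b l p q (n + 1) z.1))
    have he' : ∀ d : TorBidegrees (n + 1) l,
        ((M l).d (n + 2) (n + 1)).hom (TensorProduct.lift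
          (μ (d.1.1.1 + 1) d.1.1.2 (d.1.2.1 + 1) d.1.2.2 (n + 2) l) (e d)) =
        X d.1.1.1 d.1.1.2 (d.1.2.1 + 1) d.1.2.2 + Y (d.1.1.1 + 1) d.1.1.2 d.1.2.1 d.1.2.2 := by
      intro d
      have hn : d.1.1.1 + d.1.2.1 = n := by have := d.2.1; omega
      rw [h.d_lift hn d.2.2, (he d).1, (he d).2]
    have hX := sum_torBidegrees_right (n + 1) l X fun p a b => by
      simp only [X, cycleCompl_zero, TensorProduct.map_zero_right, LinearMap.zero_apply, map_zero]
    have hY := sum_torBidegrees_left (n + 1) l Y fun a q b => by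
      simp only [Y, cycleCompl_zero, TensorProduct.map_zero_left, LinearMap.zero_apply, map_zero]
    refine ⟨e₀ - ∑ d : TorBidegrees (n + 1) l, TensorProduct.lift
      (μ (d.1.1.1 + 1) d.1.1.2 (d.1.2.1 + 1) d.1.2.2 (n + 2) l) (e d), ?_⟩
    rw [map_sub, map_sum, he₀, Finset.sum_congr rfl fun d _ => he' d, Finset.sum_add_distrib,
      hX, hY, sub_right_comm, ← Finset.sum_add_distrib, ← Finset.sum_sub_distrib]
    refine congrArg (· - z.1) (Finset.sum_congr rfl fun d _ => ?_)
    rw [sub_eq_iff_eq_add, ← map_add, ← map_add, ← add_assoc]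
    exact congrArg _ ((h.isCoproduct d.1.1.2 d.1.2.2 l d.2.2).eq_add_add _ _ n z.2)

/-- Exactness in the middle: by `exists_homotopy_cycleProj`, a class with trivial torsion components
is represented by a sum of products of cycles. -/
lemma exact_product_connecting (h : IsEilenbergZilber c μ) (k l : ℕ) (x : (M l).homology k)
    (hx : (h.connecting k l).hom x = 0) : ∃ y, (h.product k l).hom y = x := by
  obtain ⟨z, rfl⟩ := classOf_surjective _ _ x
  obtain ⟨e, he⟩ := h.exists_homotopy_cycleProj k l z hx
  let t : ∀ d : Bidegrees k l, cyclesOf (K d.1.1.2) d.1.1.1 ⊗[R] cyclesOf (L d.1.2.2) d.1.2.1 :=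
    fun d => TensorProduct.map (cycleRetraction (K d.1.1.2) d.1.1.1)
      (cycleRetraction (L d.1.2.2) d.1.2.1) (c d.1.1.2 d.1.2.2 l d.1.1.1 d.1.2.1 k z.1)
  choose ht ht' using fun d : Bidegrees k l =>
    exists_classOf_eq_homologyPairing (h.isCyclePairing _ _ _ _ _ _ d.2.1 d.2.2) (t d)
  refine ⟨∑ d, DirectSum.lof R _ (fun d : Bidegrees k l =>
      tensorObj ((K d.1.1.2).homology d.1.1.1) ((L d.1.2.2).homology d.1.2.1)) d
      (TensorProduct.map (classOf _ _) (classOf _ _) (t d)), ?_⟩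
  have hd := fun d : Bidegrees k l =>
    (sumDesc_lof (fun d : Bidegrees k l =>
      homologyPairing _ (h.isCyclePairing _ _ _ _ _ _ d.2.1 d.2.2)) d _).trans (ht' d).symm
  refine ((map_sum (h.product k l).hom _ _).trans (Finset.sum_congr rfl fun d _ => hd d)).trans ?_
  rw [← map_sum, ← sub_eq_zero, ← map_sub, classOf_eq_zero_iff]
  refine ⟨e, he.trans ?_⟩
  rw [Submodule.coe_sub, Submodule.coe_sum]
  refine congrArg (· - z.1) (Finset.sum_congr rfl fun d _ => ?_)
  refine congrArg _ ?_
  rw [TensorProduct.map_map]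
  rfl

/-- An element of `Tor₁(H_p(K), H_q(L))` given by `y ∈ Z_p ⊗ L_{q+1}` and `w ∈ K_{p+1} ⊗ Z_q` with
equal differentials is the image of the class of the cycle `μ(y) - (-1)ᵖ μ(w)`. -/
lemma connecting_surjective (h : IsEilenbergZilber c μ) (k l : ℕ) :
    Function.Surjective (h.connecting k l).hom := by
  refine sumLift_surjective _ fun d x => ?_
  obtain ⟨⟨⟨p, a⟩, q, b⟩, hk, hl⟩ := d
  dsimp only at hk hl x
  obtain rfl : k = p + q + 1 := hk.symm
  obtain ⟨v, rfl⟩ := (kerToTor_bijective ((K a).homology p) (classOf (L b) q)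
    (classOf_surjective (L b) q)).2 x
  obtain ⟨y, w, hv, hyw⟩ := exists_of_torKer p q v
  have hm : TensorProduct.lift (μ p a (q + 1) b (p + q + 1) l)
        (TensorProduct.map (cyclesOf (K a) p).subtype LinearMap.id y) -
      (-1 : R) ^ p • TensorProduct.lift (μ (p + 1) a q b (p + q + 1) l)
        (TensorProduct.map LinearMap.id (cyclesOf (L b) q).subtype w) ∈
      cyclesOf (M l) (p + q + 1) := by
    rw [mem_cyclesOf_iff (M l) (p + q + 1) (p + q) (by simp), map_sub, map_smul,
      h.d_lift_right rfl hl, h.d_lift_left rfl hl, hyw, sub_self]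
  -- The summand with `w` has no torsion component, since its second factor is a cycle.
  have key : ∀ p' a' q' b' (hk' : p' + q' + 1 = p + q + 1) (hl' : a' + b' = l),
      (cyclesToTorKer (h.isCoproduct a' b' l hl') p' q' (p + q) ⟨_, hm⟩).1 =
        TensorProduct.map (chainClass (K a') p') (dBoundaries (L b') q')
          (c a' b' l p' (q' + 1) (p + q + 1) (TensorProduct.lift (μ p a (q + 1) b (p + q + 1) l)
            (TensorProduct.map (cyclesOf (K a) p).subtype LinearMap.id y))) := by
    intro p' a' q' b' hk' hl'
    refine (congrArg (TensorProduct.map (chainClass (K a') p') (dBoundaries (L b') q'))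
      (map_sub (c a' b' l p' (q' + 1) (p + q + 1)) _ _)).trans ?_
    rw [map_sub, map_smul, map_smul,
      h.map_dBoundaries_coproduct_lift (p := p + 1) (by omega) hl hk' hl' w, smul_zero, sub_zero]
  refine ⟨classOf (M l) (p + q + 1) ⟨_, hm⟩, ?_, ?_⟩
  · refine (torComponent_classOf (h.isCoproduct a b l hl) p q (p + q) ⟨_, hm⟩).trans ?_
    refine congrArg _ (Subtype.ext ((key p a q b rfl hl).trans ?_))
    rw [h.coproduct_lift (by omega) hl, TensorProduct.map_map, ← hv]
    congr 2
    exact LinearMap.ext fun x => chainClass_coe (K a) p x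
  · rintro ⟨⟨⟨p', a'⟩, q', b'⟩, hk', hl'⟩ hd
    refine (torComponentOf_classOf_eq_zero_iff _ _ _ _ hk' _).2 (Subtype.ext ?_)
    refine (key p' a' q' b' hk' hl').trans ?_
    rw [h.coproduct_lift_of_ne (by omega) hl, map_zero]
    · rfl
    · rintro ⟨rfl, rfl⟩
      obtain rfl : q = q' := by simp only at hk'; omega
      obtain rfl : b = b' := by simp only at hl'; omega
      exact hd rfl

end IsEilenbergZilber

end

/-! ### Naturality, splitting and the vanishing of the torsion term -/

lemma homologyPairing_naturality {R : Type} [CommRing R]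
    {K L M K' L' M' : ChainComplex (ModuleCat.{u} R) ℕ} {p q n : ℕ}
    {μ : K.X p →ₗ[R] L.X q →ₗ[R] M.X n} (hμ : IsCyclePairing μ)
    {μ' : K'.X p →ₗ[R] L'.X q →ₗ[R] M'.X n} (hμ' : IsCyclePairing μ')
    (f : K ⟶ K') (g : L ⟶ L') (h : M ⟶ M')
    (hfg : ∀ x y, (h.f n).hom (μ x y) = μ' ((f.f p).hom x) ((g.f q).hom y)) :
    homologyPairing μ hμ ≫ HomologicalComplex.homologyMap h n =
      tensorMap (HomologicalComplex.homologyMap f p) (HomologicalComplex.homologyMap g q) ≫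
        homologyPairing μ' hμ' := by
  ext1
  refine TensorProduct.ext' fun x y => ?_
  obtain ⟨x, rfl⟩ := classOf_surjective _ _ x
  obtain ⟨y, rfl⟩ := classOf_surjective _ _ y
  refine (congrArg (HomologicalComplex.homologyMap h n).hom
    (homologyPairing_classOf μ hμ x y)).trans ((homologyMap_classOf_cyclesOfMap h n _).trans ?_)
  have h1 := homologyMap_classOf_cyclesOfMap f p x
  have h2 := homologyMap_classOf_cyclesOfMap g q y
  refine Eq.trans ?_ (congrArg (homologyPairing μ' hμ').hom (congrArg₂ (· ⊗ₜ[R] ·) h1 h2)).symm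
  refine Eq.trans ?_ (homologyPairing_classOf μ' hμ' _ _).symm
  exact congrArg (classOf M' n) (Subtype.ext (hfg x.1 y.1))

lemma sumDesc_comp {R : Type} [CommRing R] {ι : Type} [DecidableEq ι] {M M' : ι → ModuleCat.{u} R}
    {P P' : ModuleCat.{u} R} (g : ∀ i, M i ⟶ P) (g' : ∀ i, M' i ⟶ P') (φ : ∀ i, M i ⟶ M' i)
    (ψ : P ⟶ P') (h : ∀ i, g i ≫ ψ = φ i ≫ g' i) : sumDesc g ≫ ψ = sumMap φ ≫ sumDesc g' := by
  ext1
  refine DirectSum.linearMap_ext R fun i => LinearMap.ext fun x => ?_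
  refine (congrArg ψ.hom (sumDesc_lof g i x)).trans ((ConcreteCategory.congr_hom (h i) x).trans ?_)
  refine (sumDesc_lof g' i ((φ i).hom x)).symm.trans ?_
  exact (congrArg (sumDesc g').hom (DirectSum.lmap_lof (fun i => (φ i).hom) i x)).symm

lemma subsingleton_tensor_directSum {R : Type} [CommRing R] {ι : Type} [DecidableEq ι]
    (M : ι → ModuleCat.{u} R) (Q : Type*) [AddCommGroup Q] [Module R Q]
    (h : ∀ i, Subsingleton (Q ⊗[R] M i)) : Subsingleton (Q ⊗[R] ⨁ i, M i) := by
  have h0 : ∀ x : Q ⊗[R] ⨁ i, M i, x = 0 := by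
    intro x
    induction x using TensorProduct.induction_on with
    | zero => rfl
    | add x y hx hy => rw [hx, hy, add_zero]
    | tmul q x =>
      induction x using DirectSum.induction_on with
      | zero => exact TensorProduct.tmul_zero _ _
      | add x y hx hy => rw [TensorProduct.tmul_add, hx, hy, add_zero]
      | of i x =>
        refine (congrArg ((DirectSum.lof R ι (fun i => M i) i).lTensor Q)
          (Subsingleton.elim (q ⊗ₜ[R] x) 0)).trans (map_zero _)
  exact ⟨fun x y => (h0 x).trans (h0 y).symm⟩

namespace IsEilenbergZilber

section
variable {R : Type} [CommRing R]
  {K L M : ℕ → ChainComplex (ModuleCat.{u} R) ℕ}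
  {c : ∀ a b l p q n, (M l).X n →ₗ[R] (K a).X p ⊗[R] (L b).X q}
  {μ : ∀ p a q b n l, (K a).X p →ₗ[R] (L b).X q →ₗ[R] (M l).X n}
  {K' L' M' : ℕ → ChainComplex (ModuleCat.{u} R) ℕ}
  {c' : ∀ a b l p q n, (M' l).X n →ₗ[R] (K' a).X p ⊗[R] (L' b).X q}
  {μ' : ∀ p a q b n l, (K' a).X p →ₗ[R] (L' b).X q →ₗ[R] (M' l).X n}

lemma product_naturality (h : IsEilenbergZilber c μ) (h' : IsEilenbergZilber c' μ')
    (f : ∀ a, K a ⟶ K' a) (g : ∀ b, L b ⟶ L' b) (m : ∀ l, M l ⟶ M' l)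
    (hfg : ∀ p a q b n l, p + q = n → a + b = l → ∀ x y, ((m l).f n).hom (μ p a q b n l x y) =
      μ' p a q b n l (((f a).f p).hom x) (((g b).f q).hom y)) (k l : ℕ) :
    h.product k l ≫ HomologicalComplex.homologyMap (m l) k =
      sumMap (fun d : Bidegrees k l =>
        tensorMap (HomologicalComplex.homologyMap (f d.1.1.2) d.1.1.1)
          (HomologicalComplex.homologyMap (g d.1.2.2) d.1.2.1)) ≫ h'.product k l :=
  sumDesc_comp _ _ _ _ fun d => homologyPairing_naturality
    (h.isCyclePairing _ _ _ _ _ _ d.2.1 d.2.2) (h'.isCyclePairing _ _ _ _ _ _ d.2.1 d.2.2)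
    (f d.1.1.2) (g d.1.2.2) (m l) (hfg _ _ _ _ _ _ d.2.1 d.2.2)

variable [IsDomain R] [IsPrincipalIdealRing R] [∀ a, IsFiniteFree (K a)] [∀ b, IsFiniteFree (L b)]

lemma connecting_naturality [∀ a, IsFiniteFree (K' a)] [∀ b, IsFiniteFree (L' b)]
    (h : IsEilenbergZilber c μ) (h' : IsEilenbergZilber c' μ')
    (f : ∀ a, K a ⟶ K' a) (g : ∀ b, L b ⟶ L' b) (m : ∀ l, M l ⟶ M' l)
    (hfg : ∀ a b l p q n, a + b = l → ∀ z, c' a b l p q n (((m l).f n).hom z) =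
      TensorProduct.map ((f a).f p).hom ((g b).f q).hom (c a b l p q n z)) (k l : ℕ) :
    h.connecting k l ≫ sumMap (fun d : TorBidegrees k l =>
        torMap (HomologicalComplex.homologyMap (f d.1.1.2) d.1.1.1)
          (HomologicalComplex.homologyMap (g d.1.2.2) d.1.2.1)) =
      HomologicalComplex.homologyMap (m l) k ≫ h'.connecting k l := by
  refine sumLift_comp_sumMap _ _ _ _ fun d x => ?_
  obtain ⟨⟨⟨p, a⟩, q, b⟩, hk, hl⟩ := d
  dsimp only at hk hl
  obtain rfl : k = p + q + 1 := hk.symm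
  exact torMap_torComponent (h.isCoproduct a b l hl) (h'.isCoproduct a b l hl) (f a) (g b) (m l)
    p q (p + q) (hfg a b l p (q + 1) (p + q + 1) hl) x

lemma exact (h : IsEilenbergZilber c μ) (k l : ℕ) :
    (ShortComplex.mk (h.product k l) (h.connecting k l) (h.product_connecting k l)).Exact := by
  rw [ShortComplex.moduleCat_exact_iff]
  exact h.exact_product_connecting k l

lemma mono_product (h : IsEilenbergZilber c μ) (k l : ℕ) : Mono (h.product k l) :=
  mono_of_mono_fac (h.product_retraction k l)

lemma epi_connecting (h : IsEilenbergZilber c μ) (k l : ℕ) : Epi (h.connecting k l) :=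
  (ModuleCat.epi_iff_surjective _).2 (h.connecting_surjective k l)

lemma shortExact (h : IsEilenbergZilber c μ) (k l : ℕ) :
    (ShortComplex.mk (h.product k l) (h.connecting k l) (h.product_connecting k l)).ShortExact :=
  ShortComplex.ShortExact.mk' (h.exact k l) (h.mono_product k l) (h.epi_connecting k l)

/-- The Künneth sequence splits, since the coproduct induces a retraction. -/
noncomputable def splitting (h : IsEilenbergZilber c μ) (k l : ℕ) :
    (ShortComplex.mk (h.product k l) (h.connecting k l) (h.product_connecting k l)).Splitting :=
  ShortComplex.Splitting.ofExactOfRetraction _ (h.exact k l) (h.retraction k l)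
    (h.product_retraction k l) (h.epi_connecting k l)

/-- If all homology modules of one of the complexes are torsion-free, then the torsion term
vanishes. -/
lemma isIso_product (h : IsEilenbergZilber c μ) (k l : ℕ)
    (ht : (∀ i j, Module.IsTorsionFree R ((K j).homology i)) ∨
      (∀ i j, Module.IsTorsionFree R ((L j).homology i))) :
    IsIso (h.product k l) := by
  rw [ConcreteCategory.isIso_iff_bijective]
  refine ⟨(ModuleCat.mono_iff_injective _).1 (h.mono_product k l), fun x => ?_⟩
  refine h.exact_product_connecting k l x ((sumLift_eq_zero_iff _ x).2 fun d => ?_)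
  have : Subsingleton (torKer (K d.1.1.2) (L d.1.2.2) d.1.1.1 d.1.2.1) :=
    subsingleton_torKer _ _ (ht.imp (fun h => h _ _) (fun h => h _ _))
  obtain ⟨v, hv⟩ := (kerToTor_bijective ((K d.1.1.2).homology d.1.1.1)
    (classOf (L d.1.2.2) d.1.2.1) (classOf_surjective _ _)).2
      (torComponentOf (h.isCoproduct d.1.1.2 d.1.2.2 l d.2.2) d.1.1.1 d.1.2.1 k d.2.1 x)
  refine hv.symm.trans ((congrArg _ ?_).trans (map_zero _))
  exact Subsingleton.elim (α := torKer (K d.1.1.2) (L d.1.2.2) d.1.1.1 d.1.2.1) v 0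

/-- The torsion term vanishes after tensoring with a field that is flat over the base ring. -/
lemma bijective_lTensor_product (h : IsEilenbergZilber c μ) (k l : ℕ) (Q : Type*) [Field Q]
    [Algebra R Q] [Module.Flat R Q] :
    Function.Bijective ((h.product k l).hom.lTensor Q) := by
  constructor
  · refine Function.LeftInverse.injective (g := (h.retraction k l).hom.lTensor Q) fun x => ?_
    have h1 : (h.retraction k l).hom ∘ₗ (h.product k l).hom = LinearMap.id :=
      congrArg ModuleCat.Hom.hom (h.product_retraction k l)
    rw [← LinearMap.comp_apply, ← LinearMap.lTensor_comp, h1, LinearMap.lTensor_id]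
    rfl
  · have hex : Function.Exact (h.product k l).hom (h.connecting k l).hom := fun x =>
      ⟨h.exact_product_connecting k l x, fun ⟨y, hy⟩ =>
        hy ▸ ConcreteCategory.congr_hom (h.product_connecting k l) y⟩
    have hsub : Subsingleton (Q ⊗[R] ⨁ d : TorBidegrees k l,
        torObj ((K d.1.1.2).homology d.1.1.1) ((L d.1.2.2).homology d.1.2.1)) := by
      refine subsingleton_tensor_directSum _ Q fun d => ?_
      have h1 : Subsingleton (Q ⊗[R] torKer (K d.1.1.2) (L d.1.2.2) d.1.1.1 d.1.2.1) :=
        subsingleton_tensor_ker_lTensor Q _ (Submodule.subtype_injective _)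
      exact (LinearMap.lTensor_surjective Q (kerToTor_bijective ((K d.1.1.2).homology d.1.1.1)
        (classOf (L d.1.2.2) d.1.2.1) (classOf_surjective _ _)).2).subsingleton
    intro x
    exact (lTensor_exact Q hex (h.connecting_surjective k l) x).1 (Subsingleton.elim _ _)

end

end IsEilenbergZilber

/-! ### The Künneth sequence for magnitude homology -/

instance isFiniteFree_magnitudeComplex {V : Type u} [Finite V] (G : SimpleGraph V) (l : ℕ) :
    IsFiniteFree (magnitudeComplex G l) where
  free n := inferInstanceAs (Module.Free ℤ (Chains G n l))
  finite n := inferInstanceAs (Module.Finite ℤ (Chains G n l))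

/-- The Alexander–Whitney map and the exterior product of magnitude chains satisfy the
Eilenberg–Zilber theorem. -/
lemma isEilenbergZilber_magnitudeComplex {V W : Type u} [Finite V] [Finite W] (G : SimpleGraph V)
    (H : SimpleGraph W) :
    IsEilenbergZilber (K := magnitudeComplex G) (L := magnitudeComplex H)
      (M := magnitudeComplex (G □ H))
      (fun a b l p q n => alexanderWhitneyChains G H p a q b n l)
      (exteriorChains G H) where
  isCoproduct a b l hl p q n z := by
    rw [magnitudeComplex_d, magnitudeComplex_d, magnitudeComplex_d]
    exact alexanderWhitneyChains_boundary G H p a q b n l hl z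
  isCyclePairing p a q b n l := isCyclePairing_exteriorChains G H p a q b n l
  map_d p a q b n l hn hl x y := by
    rw [magnitudeComplex_d, magnitudeComplex_d, magnitudeComplex_d]
    exact boundary_exteriorChains G H p a q b n l hn hl x y
  map_d_left p a q b n l hn hl x y hy := by
    rw [magnitudeComplex_d, magnitudeComplex_d]
    exact exteriorChains_left G H p a q b n l hn hl x y
      ((mem_cyclesOf_magnitudeComplex _ _ _ _).1 hy)
  map_d_right p a q b n l hn hl x hx y := by
    have h : boundary (G □ H) n l (exteriorChains G H p a (q + 1) b (n + 1) l x y) =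
        (-1 : ℤ) ^ p • exteriorChains G H p a q b n l x (boundary H q b y) := by
      rw [← exteriorChains_right G H p a q b n l hn hl x y
        ((mem_cyclesOf_magnitudeComplex _ _ _ _).1 hx), map_smul, smul_smul, ← mul_pow,
        neg_mul_neg, one_mul, one_pow, one_smul]
    rw [magnitudeComplex_d, magnitudeComplex_d]
    exact h
  coproduct_self p a q b n l hn hl x y :=
    alexanderWhitneyChains_exteriorChains G H hn hl x y
  coproduct_of_ne p a q b n l hn hl p' a' q' b' h x y :=
    alexanderWhitneyChains_exteriorChains_of_ne G H hn hl p' a' q' b' h x y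
  exists_homotopy n l z hz := by
    obtain ⟨e, he⟩ := exists_boundary_eq_sum_exteriorTensor_sub G H n l z
      ((mem_cyclesOf_magnitudeComplex _ _ _ _).1 hz)
    rw [magnitudeComplex_d]
    exact ⟨e, he⟩

end MagnitudeHomology

open CategoryTheory MagnitudeHomology
theorem mainTheorem2 :
    (∀ {V W V' W' : Type u} [Finite V] [Finite W] [Finite V'] [Finite W']
      {G : SimpleGraph V} {H : SimpleGraph W} {G' : SimpleGraph V'} {H' : SimpleGraph W'}
      (f : GraphMap G G') (g : GraphMap H H') (k l : ℕ),
      exteriorProduct G H k l ≫ inducedHomology (f.boxProd g) k l =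
        tensorMHMap f g k l ≫ exteriorProduct G' H' k l) ∧
    (∃ τ : ∀ {V W : Type u} [Finite V] [Finite W] (G : SimpleGraph V) (H : SimpleGraph W)
        (k l : ℕ), MH (G □ H) k l ⟶ torMH G H k l,
      (∀ {V W V' W' : Type u} [Finite V] [Finite W] [Finite V'] [Finite W']
        {G : SimpleGraph V} {H : SimpleGraph W} {G' : SimpleGraph V'} {H' : SimpleGraph W'}
        (f : GraphMap G G') (g : GraphMap H H') (k l : ℕ),
        τ G H k l ≫ torMHMap f g k l = inducedHomology (f.boxProd g) k l ≫ τ G' H' k l) ∧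
      (∀ {V W : Type u} [Finite V] [Finite W] (G : SimpleGraph V) (H : SimpleGraph W) (k l : ℕ),
        ∃ w : exteriorProduct G H k l ≫ τ G H k l = 0,
          (ShortComplex.mk (exteriorProduct G H k l) (τ G H k l) w).ShortExact ∧
          Nonempty (ShortComplex.mk (exteriorProduct G H k l) (τ G H k l) w).Splitting)) ∧
    (∀ {V W : Type u} [Finite V] [Finite W] (G : SimpleGraph V) (H : SimpleGraph W),
      (∀ k l : ℕ, Function.Bijective (LinearMap.lTensor ℚ (exteriorProduct G H k l).hom)) ∧
      ((∀ i j : ℕ, Module.IsTorsionFree ℤ (MH G i j)) ∨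
        (∀ i j : ℕ, Module.IsTorsionFree ℤ (MH H i j)) →
        ∀ k l : ℕ, IsIso (exteriorProduct G H k l))) := by
  refine ⟨?_, ⟨fun G H k l => (isEilenbergZilber_magnitudeComplex G H).connecting k l, ?_, ?_⟩, ?_⟩
  · intro V W V' W' _ _ _ _ G H G' H' f g k l
    exact (isEilenbergZilber_magnitudeComplex G H).product_naturality
      (isEilenbergZilber_magnitudeComplex G' H') (inducedChainMap f) (inducedChainMap g)
      (inducedChainMap (f.boxProd g))
      (fun p a q b n l hn hl x y => inducedChains_exteriorChains f g hn hl x y) k l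
  · intro V W V' W' _ _ _ _ G H G' H' f g k l
    exact (isEilenbergZilber_magnitudeComplex G H).connecting_naturality
      (isEilenbergZilber_magnitudeComplex G' H') (inducedChainMap f) (inducedChainMap g)
      (inducedChainMap (f.boxProd g))
      (fun a b l p q n hl z => alexanderWhitneyChains_inducedChains f g p a q b n l hl z) k l
  · intro V W _ _ G H k l
    exact ⟨(isEilenbergZilber_magnitudeComplex G H).product_connecting k l,
      (isEilenbergZilber_magnitudeComplex G H).shortExact k l,
      ⟨(isEilenbergZilber_magnitudeComplex G H).splitting k l⟩⟩
  · intro V W _ _ G H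
    exact ⟨fun k l => (isEilenbergZilber_magnitudeComplex G H).bijective_lTensor_product k l ℚ,
      fun ht k l => (isEilenbergZilber_magnitudeComplex G H).isIso_product k l
        (ht.imp (fun h i j => h i j) (fun h i j => h i j))⟩
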